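/- **Setting.** Let $(\Omega,\mathcal F,\mathbb P)$ be a complete probability space, $T>0$, $B$ a $d$-dimensional Brownian motion on $[0,T]$, and $\mathbb F=(\mathcal F_t)_{0\le t\le T}$ its natural filtration completed by the $\mathbb P$-null sets of $\mathcal F$. For $0\le a<b\le T$ and a process $X$ put $$\|X\|_{1,[a,b]}=\sup_{\tau}\mathbb E|X_\tau| ,$$ the supremum running over all $\mathbb F$-stopping times $\tau$ with $a\le\tau\le b$ a.s. Let $\mathcal D([a,b])$ be the space of real-valued, $\mathbb F$-adapted, continuous processes $X$ on $[a,b]$ with $\|X\|_{1,[a,b]}<\infty$ (indistinguishable processes being identified), and let $\mathcal D_{\rm ui}([a,b])$ be the subspace of those $X$ that are of class (D), i.e. for which the family $\{X_\tau\}$, $\tau$ as above, is uniformly integrable. **Assumptions.** Let $f,h,g:[0,T]\times\Omega\times\mathbb R^2\to\mathbb R$ and $\xi:\Omega\to\mathbb R$, and let $C_f,\gamma_1,\gamma_2,\beta_1,\beta_2>0$ be constants, such that: 1. for all $y,y'$ the process $f(\cdot,y,y')$ is progressively measurable; $\mathbb E\int_0^T|f(t,0,0)|\,dt<\infty$; and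 a.s., for all $t\in[0,T]$ and all reals $y_1,y_1',y_2,y_2'$, $|f(t,y_1,y_1')-f(t,y_2,y_2')|\le C_f(|y_1-y_2|+|y_1'-y_2'|)$; 2. for all $x,x'$ the processes $h(\cdot,x,x')$ and $g(\cdot,x,x')$ are adapted and continuous; $h(\cdot,0,0)$ and $g(\cdot,0,0)$ belong to $\mathcal D_{\rm ui}([0,T])$; and a.s., for all $t\in[0,T]$ and all reals $x,x',y,y'$, $$|h(t,x,x')-h(t,y,y')|\le\gamma_1|x-y|+\gamma_2|x'-y'|,\quad |g(t,x,x')-g(t,y,y')|\le\beta_1|x-y|+\beta_2|x'-y'|,\quad h(t,x,x')<g(t,x,x');$$ 3. $\xi$ is $\mathcal F_T$-measurable and integrable, and a.s. $h(T,\xi,\mathbb E[\xi])\le\xi\le g(T,\xi,\mathbb E[\xi])$. **The map $\Phi$.** For a process $Y$ write $m_Y(t)=\mathbb E[Y_t]$. For each $t$, $\Phi(Y)_t$ is the random variable, unique up to a.s. equality, $$\Phi(Y)_t=\operatorname*{ess\,sup}_{\tau}\ \operatorname*{ess\,inf}_{\sigma}\ \mathbb E\Big[\int_t^{\sigma\wedge\tau}f(s,Y_s,m_Y(s))\,ds+g(\sigma,Y_\sigma,m_Y(\sigma))\mathbf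 1_{\{\sigma<\tau\}}+h(\tau,Y_\tau,m_Y(\tau))\mathbf 1_{\{\tau\le\sigma,\ \tau<T\}}+\xi\,\mathbf 1_{\{\tau=\sigma=T\}}\,\Big|\,\mathcal F_t\Big],$$ where $\tau,\sigma$ run over the stopping times with $t\le\tau,\sigma\le T$ a.s. "$X=\Phi(Y)$ on $[a,T]$" means that these essential extrema exist as real random variables and $X_t=\Phi(Y)_t$ a.s. for every $t\in[a,T]$. **Proposition.** Suppose that $\gamma_1+\gamma_2+\beta_1+\beta_2<1$. Then there are $\delta>0$ and $\kappa\in[0,1)$, depending only on $C_f,\gamma_1,\gamma_2,\beta_1,\beta_2$, such that for all $\Omega,\mathbb P,T,B,f,h,g,\xi$ as above (with these constants), with $a=\max(T-\delta,0)$: * for every $Y\in\mathcal D_{\rm ui}([a,T])$ with $Y_T=\xi$ a.s. there is $X\in\mathcal D_{\rm ui}([a,T])$ with $X=\Phi(Y)$ on $[a,T]$ and $X_T=\xi$ a.s.; * $\|\Phi(Y)-\Phi(Y')\|_{1,[a,T]}\le\kappa\,\|Y-Y'\|_{1,[a,T]}$ for all $Y,Y'\in\mathcal D([a,T])$ such that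 $\Phi(Y),\Phi(Y')\in\mathcal D([a,T])$. In particular $\Phi$ is a contraction of $\{Y\in\mathcal D_{\rm ui}([a,T]):Y_T=\xi\}$ into itself. Moreover * there is $Y\in\mathcal D_{\rm ui}([a,T])$ with $Y=\Phi(Y)$ on $[a,T]$, and every $Y'\in\mathcal D([a,T])$ with $Y'=\Phi(Y')$ on $[a,T]$ is indistinguishable from $Y$ on $[a,T]$. -/

import Mathlib

open MeasureTheory ProbabilityTheory Set
open scoped NNReal ENNReal

namespace MFDRBSDE

/-- `B` is a standard `d`-dimensional Brownian motion on the time interval `[0,T]`. -/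
structure IsBrownianMotion {Ω : Type*} [MeasurableSpace Ω] (P : Measure Ω) {T : ℝ} {d : ℕ}
    (B : Icc (0 : ℝ) T → Ω → (Fin d → ℝ)) : Prop where
  measurable : ∀ t, Measurable (B t)
  start_zero : ∀ t : Icc (0 : ℝ) T, (t : ℝ) = 0 → ∀ᵐ ω ∂P, B t ω = 0
  indep_increments : HasIndepIncrements B P
  increments_law : ∀ s t : Icc (0 : ℝ) T, s ≤ t →
    HasLaw (fun ω => B t ω - B s ω)
      (Measure.pi fun _ : Fin d => gaussianReal 0 (Real.toNNReal ((t : ℝ) - s))) P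
  continuous_paths : ∀ᵐ ω ∂P, Continuous fun t => B t ω

/-- The filtration generated by `B` and completed by the `P`-null sets. For convenience it is
indexed by `ℝ`; it is constant after `T`, and trivial (null sets only) before time `0`. -/
def completedFiltration {Ω : Type*} [m : MeasurableSpace Ω] (P : Measure Ω) {T : ℝ} {d : ℕ}
    (B : Icc (0 : ℝ) T → Ω → (Fin d → ℝ)) (hB : ∀ t, Measurable (B t)) : Filtration ℝ m where
  seq t := (⨆ (s : Icc (0 : ℝ) T) (_ : (s : ℝ) ≤ t), MeasurableSpace.comap (B s) inferInstance) ⊔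
    MeasurableSpace.generateFrom {N | MeasurableSet N ∧ P N = 0}
  mono' _ _ hst := sup_le_sup_right (biSup_mono fun _ h => le_trans h hst) _
  le' _ := sup_le (iSup₂_le fun s _ => (hB s).comap_le)
    (MeasurableSpace.generateFrom_le fun _ hN => hN.1)

section Spaces

variable {Ω : Type*} [m : MeasurableSpace Ω]

/-- `τ` is a stopping time with `a ≤ τ ≤ b` almost surely. -/
def IsStoppingTimeIn (F : Filtration ℝ m) (P : Measure Ω) (a b : ℝ) (τ : Ω → ℝ) : Prop :=
  IsStoppingTime F (fun ω => ((τ ω : ℝ) : WithTop ℝ)) ∧ ∀ᵐ ω ∂P, τ ω ∈ Icc a b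

/-- The norm `‖X‖₁ = sup_τ E|X_τ|`, over the stopping times `τ` with values in `[a,b]`. -/
noncomputable def normOne (F : Filtration ℝ m) (P : Measure Ω) (a b : ℝ) (X : ℝ → Ω → ℝ) : ℝ≥0∞ :=
  ⨆ τ : {τ : Ω → ℝ // IsStoppingTimeIn F P a b τ}, ∫⁻ ω, ‖X (τ.1 ω) ω‖ₑ ∂P

/-- The space `D([a,b])`: adapted processes with (almost surely) continuous paths on `[a,b]`
and `‖X‖₁ < ∞`. Values of `X` at times outside `[a,b]` play no role. -/
structure MemD (F : Filtration ℝ m) (P : Measure Ω) (a b : ℝ) (X : ℝ → Ω → ℝ) : Prop where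
  adapted : ∀ t ∈ Icc a b, Measurable[F t] (X t)
  continuous_paths : ∀ᵐ ω ∂P, ContinuousOn (fun t => X t ω) (Icc a b)
  norm_lt_top : normOne F P a b X < ∞

/-- The members of `D([a,b])` that are of class (D): the family `X_τ`, with `τ` running through
the stopping times with values in `[a,b]`, is uniformly integrable. -/
structure MemClassD (F : Filtration ℝ m) (P : Measure Ω) (a b : ℝ) (X : ℝ → Ω → ℝ) : Prop
    extends MemD F P a b X where
  uniformIntegrable : UniformIntegrable
    (fun (τ : {τ : Ω → ℝ // IsStoppingTimeIn F P a b τ}) (ω : Ω) => X (τ.1 ω) ω) 1 P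

/-- `X` is (a version of) the essential supremum of the family `Z` of random variables. -/
def IsEssSup (P : Measure Ω) {ι : Type*} (Z : ι → Ω → ℝ) (X : Ω → ℝ) : Prop :=
  AEMeasurable X P ∧ (∀ i, Z i ≤ᵐ[P] X) ∧
    ∀ W : Ω → ℝ, AEMeasurable W P → (∀ i, Z i ≤ᵐ[P] W) → X ≤ᵐ[P] W

/-- `X` is (a version of) the essential infimum of the family `Z` of random variables. -/
def IsEssInf (P : Measure Ω) {ι : Type*} (Z : ι → Ω → ℝ) (X : Ω → ℝ) : Prop :=
  AEMeasurable X P ∧ (∀ i, X ≤ᵐ[P] Z i) ∧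
    ∀ W : Ω → ℝ, AEMeasurable W P → (∀ i, W ≤ᵐ[P] Z i) → W ≤ᵐ[P] X

/-- The assumptions on the data `(f, ξ, h, g)`, in the case `p = 1`. The arguments of `f`, `h`, `g`
are `t, ω, y, y'`; only times in `[0,T]` matter. -/
structure AssumptionA1 (F : Filtration ℝ m) (P : Measure Ω) (T : ℝ)
    (f h g : ℝ → Ω → ℝ → ℝ → ℝ) (ξ : Ω → ℝ) (Cf γ₁ γ₂ β₁ β₂ : ℝ) : Prop where
  f_progressive : ∀ y y', IsStronglyProgressive F
    fun t ω => (Icc (0 : ℝ) T).indicator (fun s => f s ω y y') t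
  f_zero_integrable : ∫⁻ ω, (∫⁻ t in Icc (0 : ℝ) T, ‖f t ω 0 0‖ₑ) ∂P < ∞
  f_lipschitz : ∀ᵐ ω ∂P, ∀ t ∈ Icc (0 : ℝ) T, ∀ y₁ y₁' y₂ y₂' : ℝ,
    |f t ω y₁ y₁' - f t ω y₂ y₂'| ≤ Cf * (|y₁ - y₂| + |y₁' - y₂'|)
  h_adapted : ∀ x x', ∀ t ∈ Icc (0 : ℝ) T, Measurable[F t] fun ω => h t ω x x'
  g_adapted : ∀ x x', ∀ t ∈ Icc (0 : ℝ) T, Measurable[F t] fun ω => g t ω x x'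
  h_continuous : ∀ x x', ∀ᵐ ω ∂P, ContinuousOn (fun t => h t ω x x') (Icc 0 T)
  g_continuous : ∀ x x', ∀ᵐ ω ∂P, ContinuousOn (fun t => g t ω x x') (Icc 0 T)
  h_lipschitz : ∀ᵐ ω ∂P, ∀ t ∈ Icc (0 : ℝ) T, ∀ x x' y y' : ℝ,
    |h t ω x x' - h t ω y y'| ≤ γ₁ * |x - y| + γ₂ * |x' - y'|
  g_lipschitz : ∀ᵐ ω ∂P, ∀ t ∈ Icc (0 : ℝ) T, ∀ x x' y y' : ℝ,
    |g t ω x x' - g t ω y y'| ≤ β₁ * |x - y| + β₂ * |x' - y'|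
  h_lt_g : ∀ᵐ ω ∂P, ∀ t ∈ Icc (0 : ℝ) T, ∀ x x' : ℝ, h t ω x x' < g t ω x x'
  h_zero_classD : MemClassD F P 0 T fun t ω => h t ω 0 0
  g_zero_classD : MemClassD F P 0 T fun t ω => g t ω 0 0
  ξ_measurable : Measurable[F T] ξ
  ξ_integrable : Integrable ξ P
  ξ_between : ∀ᵐ ω ∂P, h T ω (ξ ω) (∫ ω', ξ ω' ∂P) ≤ ξ ω ∧ ξ ω ≤ g T ω (ξ ω) (∫ ω', ξ ω' ∂P)

/-- The payoff, from time `t` on, of the Dynkin game in which `τ` and `σ` are the players'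
stopping times, with running reward and obstacles evaluated along the process `Y` and its mean. -/
noncomputable def payoff (P : Measure Ω) (T : ℝ) (f h g : ℝ → Ω → ℝ → ℝ → ℝ) (ξ : Ω → ℝ)
    (Y : ℝ → Ω → ℝ) (t : ℝ) (τ σ : Ω → ℝ) (ω : Ω) : ℝ :=
  (∫ s in t..min (σ ω) (τ ω), f s ω (Y s ω) (∫ ω', Y s ω' ∂P))
    + (if σ ω < τ ω then g (σ ω) ω (Y (σ ω) ω) (∫ ω', Y (σ ω) ω' ∂P) else 0)
    + (if τ ω ≤ σ ω ∧ τ ω < T then h (τ ω) ω (Y (τ ω) ω) (∫ ω', Y (τ ω) ω' ∂P) else 0)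
    + (if τ ω = T ∧ σ ω = T then ξ ω else 0)

/-- `X = Φ(Y)` on `[a,T]`: for every `t ∈ [a,T]`, almost surely,
`X_t = ess sup_{τ ≥ t} ess inf_{σ ≥ t} E[payoff(t, τ, σ) | F_t]`, the stopping times
`τ` and `σ` having values in `[t,T]`. Here `V τ` is the inner essential infimum. -/
def IsPhi (F : Filtration ℝ m) (P : Measure Ω) (T : ℝ) (f h g : ℝ → Ω → ℝ → ℝ → ℝ) (ξ : Ω → ℝ)
    (a : ℝ) (Y X : ℝ → Ω → ℝ) : Prop :=
  ∀ t ∈ Icc a T, ∃ V : {τ : Ω → ℝ // IsStoppingTimeIn F P t T τ} → Ω → ℝ,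
    (∀ τ, IsEssInf P (fun σ : {σ : Ω → ℝ // IsStoppingTimeIn F P t T σ} =>
      P[payoff P T f h g ξ Y t τ.1 σ.1 | F t]) (V τ)) ∧
    IsEssSup P V (X t)

end Spaces

end MFDRBSDE

/-! Freeze the coefficients along `Y`: put `L = h(·, Y, m_Y)`, `U = g(·, Y, m_Y)` and `A_t = ∫_a^t
f(s, Y_s, m_Y(s)) ds`. Up to a version, `Φ(Y) + A` is the value of a Dynkin game without running
reward, with obstacles `L + A`, `U + A` and terminal payoff `ξ + A_T`. Two facts are needed: the
value has a continuous version of class (D), and it depends on `Y` in a contractive way.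

Contraction. For fixed `(τ, σ)` the payoffs along `Y` and `Y'` differ by at most `G_ρ`, where `ρ = τ
∧ σ` and `G` is `(γ₁ + β₁)|Y - Y'|` plus terms that do not depend on the stopping time. Sup-inf
preserves order, so `|Φ(Y)_t - Φ(Y')_t|` is at most the essential supremum of `E[G_ρ | F_t]` over `ρ
≥ t`. This family is directed, hence the essential supremum is an increasing limit; pasting
maximizing sequences at a stopping time with finitely many values bounds the norm by `sup_ρ E[G_ρ]`
(`NullComplete.normOne_le_of_condExp_le`). The factor is `γ₁ + γ₂ + β₁ + β₂ + 2 C_f (T - a)`, below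
1 on a short interval (`AssumptionA1.normOne_phi_sub_le`).

Continuity of the value. Martingales of the Brownian filtration have continuous versions
(`IsBrownianMotion.hasContinuousVersion`): for products of functions of `B` at finitely many times
this is the Markov property; a monotone class argument gives indicators, and Doob's inequality with
completeness of `‖·‖₁` gives all integrable variables. For bounded obstacles the game is solved by
backward induction on a fine grid and interpolated into a continuous process; equicontinuity of the
obstacle paths makes the error small in mean (`NullComplete.exists_approx_game`,
`NullComplete.exists_approx_saddle_of_bounded`). Truncation extends this to class (D). Playing
near-optimal strategies of two approximations against each other shows that the approximate values
are Cauchy in `‖·‖₁`; their limit is the value (`NullComplete.exists_game_value`).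

Fixed point. Class (D) is closed in the complete space of continuous processes under `‖·‖₁`, and so
is the condition `Y_T = ξ`, which places the terminal payoff between the obstacles. Picard iteration
from the martingale `E[ξ | F_t]` converges (`NullComplete.exists_fixedPoint`). Uniqueness in `D`
follows from the contraction estimate, as the norms are finite. -/

namespace MFDRBSDE

open Filter Topology

/-! ### Stopping times of a complete filtration: pasting, discretization, first times on a finite
grid. -/

section StoppingTimes

variable {Ω : Type*} [m : MeasurableSpace Ω] {F : Filtration ℝ m} {P : Measure Ω}

/-- Every `P`-null set belongs to every `σ`-algebra of the filtration. -/
def NullComplete (F : Filtration ℝ m) (P : Measure Ω) : Prop :=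
  ∀ t N, P N = 0 → MeasurableSet[F t] N

theorem NullComplete.measurableSet_congr (hF : NullComplete F P) {t : ℝ} {A B : Set Ω}
    (hA : MeasurableSet[F t] A) (h : A =ᵐ[P] B) : MeasurableSet[F t] B := by
  have h1 : P (A \ B) = 0 := (ae_le_set.1 h.le)
  have h2 : P (B \ A) = 0 := (ae_le_set.1 h.symm.le)
  have : B = (A \ (A \ B)) ∪ (B \ A) := by
    ext ω; simp only [mem_union, Set.mem_sdiff]; tauto
  rw [this]
  exact (hA.diff (hF t _ h1)).union (hF t _ h2)

theorem NullComplete.measurable_congr (hF : NullComplete F P) {t : ℝ} {f g : Ω → ℝ}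
    (hf : Measurable[F t] f) (h : f =ᵐ[P] g) : Measurable[F t] g := by
  intro s hs
  refine hF.measurableSet_congr (hf hs) ?_
  filter_upwards [h] with ω hω
  change (f ω ∈ s) = (g ω ∈ s)
  rw [hω]

theorem isStoppingTimeIn_iff {a b : ℝ} {τ : Ω → ℝ} :
    IsStoppingTimeIn F P a b τ ↔
      (∀ s, MeasurableSet[F s] {ω | τ ω ≤ s}) ∧ ∀ᵐ ω ∂P, τ ω ∈ Icc a b := by
  simp [IsStoppingTimeIn, IsStoppingTime]

theorem IsStoppingTimeIn.measurableSet_le {a b : ℝ} {τ : Ω → ℝ}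
    (h : IsStoppingTimeIn F P a b τ) (s : ℝ) : MeasurableSet[F s] {ω | τ ω ≤ s} :=
  (isStoppingTimeIn_iff.1 h).1 s

theorem IsStoppingTimeIn.measurable {a b : ℝ} {τ : Ω → ℝ}
    (h : IsStoppingTimeIn F P a b τ) : Measurable τ :=
  measurable_of_Iic fun s => F.le s _ (h.measurableSet_le s)

theorem IsStoppingTimeIn.mono {a b a' b' : ℝ} {τ : Ω → ℝ} (h : IsStoppingTimeIn F P a b τ)
    (ha : a' ≤ a) (hb : b ≤ b') : IsStoppingTimeIn F P a' b' τ :=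
  ⟨h.1, h.2.mono fun _ hω => Icc_subset_Icc ha hb hω⟩

theorem isStoppingTimeIn_const {a b t : ℝ} (ht : t ∈ Icc a b) :
    IsStoppingTimeIn F P a b fun _ => t :=
  ⟨isStoppingTime_const F t, Eventually.of_forall fun _ => ht⟩

theorem IsStoppingTimeIn.min {a b : ℝ} {τ σ : Ω → ℝ} (h : IsStoppingTimeIn F P a b τ)
    (h' : IsStoppingTimeIn F P a b σ) : IsStoppingTimeIn F P a b fun ω => min (τ ω) (σ ω) := by
  refine isStoppingTimeIn_iff.2 ⟨fun s => ?_, ?_⟩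
  · have : {ω | Min.min (τ ω) (σ ω) ≤ s} = {ω | τ ω ≤ s} ∪ {ω | σ ω ≤ s} := by
      ext; simp
    rw [this]
    exact (h.measurableSet_le s).union (h'.measurableSet_le s)
  · filter_upwards [h.2, h'.2] with ω h1 h2
    exact ⟨le_min h1.1 h2.1, min_le_of_left_le h1.2⟩

theorem NullComplete.isStoppingTimeIn_congr (hF : NullComplete F P) {a b : ℝ} {τ σ : Ω → ℝ}
    (h : IsStoppingTimeIn F P a b τ) (hτ : τ =ᵐ[P] σ) : IsStoppingTimeIn F P a b σ := by
  refine isStoppingTimeIn_iff.2 ⟨fun s => hF.measurableSet_congr (h.measurableSet_le s) ?_, ?_⟩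
  · filter_upwards [hτ] with ω hω
    change (τ ω ≤ s) = (σ ω ≤ s)
    rw [hω]
  · filter_upwards [hτ, h.2] with ω h1 h2
    rwa [← h1]

/-- A change on a null set keeps a stopping time, so the bounds may be assumed at every `ω`.
Discretizations of the new time then have finite range. -/
theorem NullComplete.exists_clamp (hF : NullComplete F P) {a b : ℝ} (hab : a ≤ b) {τ : Ω → ℝ}
    (h : IsStoppingTimeIn F P a b τ) :
    ∃ σ, IsStoppingTimeIn F P a b σ ∧ (∀ ω, σ ω ∈ Icc a b) ∧ σ =ᵐ[P] τ := by
  have : (fun ω => max a (Min.min (τ ω) b)) =ᵐ[P] τ := by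
    filter_upwards [h.2] with ω hω
    rw [min_eq_left hω.2, max_eq_right hω.1]
  exact ⟨_, hF.isStoppingTimeIn_congr h this.symm,
    fun ω => ⟨le_max_left _ _, max_le hab (min_le_right _ _)⟩, this⟩

open Classical in
theorem NullComplete.isStoppingTimeIn_piecewise (hF : NullComplete F P) {t b : ℝ}
    {τ σ : Ω → ℝ} (h : IsStoppingTimeIn F P t b τ) (h' : IsStoppingTimeIn F P t b σ)
    {A : Set Ω} (hA : MeasurableSet[F t] A) : IsStoppingTimeIn F P t b (A.piecewise τ σ) := by
  have hmem : ∀ᵐ ω ∂P, A.piecewise τ σ ω ∈ Icc t b := by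
    filter_upwards [h.2, h'.2] with ω h1 h2
    by_cases hω : ω ∈ A
    · rwa [piecewise_eq_of_mem _ _ _ hω]
    · rwa [piecewise_eq_of_notMem _ _ _ hω]
  refine isStoppingTimeIn_iff.2 ⟨fun s => ?_, hmem⟩
  by_cases hs : s < t
  · refine hF s _ (measure_mono_null ?_ (ae_iff.1 hmem))
    intro ω hω hc
    exact absurd (hc.1.trans hω) (not_le.2 hs)
  · have : {ω | A.piecewise τ σ ω ≤ s} = (A ∩ {ω | τ ω ≤ s}) ∪ (Aᶜ ∩ {ω | σ ω ≤ s}) := by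
      ext ω
      by_cases hω : ω ∈ A <;> simp [hω]
    rw [this]
    have hA' := F.mono (not_lt.1 hs) _ hA
    exact (hA'.inter (h.measurableSet_le s)).union (hA'.compl.inter (h'.measurableSet_le s))

/-- Approximation of a random time from above, on the grid of mesh `1/(n+1)`, stopped at `b`. -/
noncomputable def roundUp (b : ℝ) (n : ℕ) (x : ℝ) : ℝ := min b (⌈x * (n + 1)⌉ / (n + 1))

theorem le_roundUp {b x : ℝ} (n : ℕ) (hx : x ≤ b) : x ≤ roundUp b n x := by
  refine le_min hx ?_
  rw [le_div_iff₀ (by positivity)]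
  exact Int.le_ceil _

theorem roundUp_le (b : ℝ) (n : ℕ) (x : ℝ) : roundUp b n x ≤ b := min_le_left _ _

theorem roundUp_mem {a b x : ℝ} (n : ℕ) (hx : x ∈ Icc a b) : roundUp b n x ∈ Icc a b :=
  ⟨hx.1.trans (le_roundUp n hx.2), roundUp_le _ _ _⟩

theorem tendsto_roundUp {b x : ℝ} (hx : x ≤ b) :
    Tendsto (fun n => roundUp b n x) atTop (𝓝 x) := by
  refine tendsto_of_tendsto_of_tendsto_of_le_of_le tendsto_const_nhds
    (g := fun _ => x) (h := fun n : ℕ => x + 1 / ((n : ℝ) + 1)) ?_ (fun n => le_roundUp n hx)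
    (fun n => ?_)
  · simpa using tendsto_const_nhds.add (tendsto_one_div_add_atTop_nhds_zero_nat (𝕜 := ℝ))
  · refine (min_le_right _ _).trans ?_
    rw [div_le_iff₀ (by positivity), add_mul, one_div, inv_mul_cancel₀ (by positivity)]
    exact (Int.ceil_lt_add_one _).le

theorem finite_range_roundUp {Ω : Type*} {a b : ℝ} (n : ℕ) {τ : Ω → ℝ} (hτ : ∀ ω, τ ω ∈ Icc a b) :
    (range fun ω => roundUp b n (τ ω)).Finite := by
  refine ((Set.finite_Icc ⌈a * (n + 1)⌉ ⌈b * (n + 1)⌉).image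
    fun k : ℤ => Min.min b ((k : ℝ) / (n + 1))).subset ?_
  rintro _ ⟨ω, rfl⟩
  refine ⟨⌈τ ω * (n + 1)⌉, ⟨Int.ceil_mono ?_, Int.ceil_mono ?_⟩, rfl⟩
  · exact mul_le_mul_of_nonneg_right (hτ ω).1 (by positivity)
  · exact mul_le_mul_of_nonneg_right (hτ ω).2 (by positivity)

theorem IsStoppingTimeIn.roundUp {a b : ℝ} {τ : Ω → ℝ} (h : IsStoppingTimeIn F P a b τ) (n : ℕ) :
    IsStoppingTimeIn F P a b fun ω => roundUp b n (τ ω) := by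
  refine isStoppingTimeIn_iff.2 ⟨fun s => ?_, h.2.mono fun ω hω => roundUp_mem n hω⟩
  by_cases hs : b ≤ s
  · have : {ω | MFDRBSDE.roundUp b n (τ ω) ≤ s} = univ :=
      eq_univ_of_forall fun ω => (roundUp_le _ _ _).trans hs
    rw [this]; exact MeasurableSet.univ
  · have h0 : (0 : ℝ) < n + 1 := by positivity
    -- For `s < b`, rounding up stays below `s` exactly when `τ` is at most the largest grid point
    -- not exceeding `s`.
    have : {ω | MFDRBSDE.roundUp b n (τ ω) ≤ s} = {ω | τ ω ≤ ⌊s * (n + 1)⌋ / (n + 1)} := by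
      ext ω
      simp only [MFDRBSDE.roundUp, mem_ofPred_eq, min_le_iff, hs, false_or]
      rw [div_le_iff₀ h0, le_div_iff₀ h0, ← Int.le_floor, ← Int.ceil_le]
    rw [this]
    refine F.mono ?_ _ (h.measurableSet_le _)
    rw [div_le_iff₀ h0]
    exact Int.floor_le _

open Classical in
/-- The first time `t` in the finite set `D` at which the event `A t` occurs; `b` if there is no
such time. -/
noncomputable def firstTime (b : ℝ) (D : Finset ℝ) (A : ℝ → Set Ω) (ω : Ω) : ℝ :=
  (insert b (D.filter fun t => ω ∈ A t)).min' (Finset.insert_nonempty _ _)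

theorem firstTime_le_iff {Ω : Type*} {b : ℝ} {D : Finset ℝ} {A : ℝ → Set Ω} {ω : Ω} {s : ℝ} :
    firstTime b D A ω ≤ s ↔ b ≤ s ∨ ∃ t ∈ D, ω ∈ A t ∧ t ≤ s := by
  classical
  simp only [firstTime]
  constructor
  · intro h
    have := Finset.min'_mem (insert b (D.filter fun t => ω ∈ A t)) (Finset.insert_nonempty _ _)
    rcases Finset.mem_insert.1 this with h1 | h1
    · left; rwa [h1] at h
    · right
      exact ⟨_, (Finset.mem_filter.1 h1).1, (Finset.mem_filter.1 h1).2, h⟩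
  · rintro (h | ⟨t, ht, hA, hs⟩)
    · exact (Finset.min'_le _ _ (Finset.mem_insert_self _ _)).trans h
    · exact (Finset.min'_le _ _ (Finset.mem_insert_of_mem (Finset.mem_filter.2 ⟨ht, hA⟩))).trans hs

theorem firstTime_eq_or {Ω : Type*} {b : ℝ} {D : Finset ℝ} {A : ℝ → Set Ω} {ω : Ω} :
    firstTime b D A ω = b ∨ (firstTime b D A ω ∈ D ∧ ω ∈ A (firstTime b D A ω)) := by
  classical
  rcases Finset.mem_insert.1 (Finset.min'_mem (insert b (D.filter fun t => ω ∈ A t))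
    (Finset.insert_nonempty _ _)) with h | h
  · exact Or.inl h
  · exact Or.inr (Finset.mem_filter.1 h)

theorem isStoppingTimeIn_firstTime {a b : ℝ} (hab : a ≤ b) {D : Finset ℝ} {A : ℝ → Set Ω}
    (hD : ∀ t ∈ D, t ∈ Icc a b) (hA : ∀ t ∈ D, MeasurableSet[F t] (A t)) :
    IsStoppingTimeIn F P a b (firstTime b D A) := by
  refine isStoppingTimeIn_iff.2 ⟨fun s => ?_, Eventually.of_forall fun ω => ⟨?_, ?_⟩⟩
  · have : {ω | firstTime b D A ω ≤ s} = {_ω : Ω | b ≤ s} ∪ ⋃ t ∈ D.filter (· ≤ s), A t := by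
      ext ω
      simp only [mem_ofPred_eq, firstTime_le_iff, mem_union, mem_iUnion, Finset.mem_filter]
      refine or_congr_right ⟨?_, ?_⟩
      · rintro ⟨t, h1, h2, h3⟩; exact ⟨t, ⟨h1, h3⟩, h2⟩
      · rintro ⟨t, ⟨h1, h3⟩, h2⟩; exact ⟨t, h1, h2, h3⟩
    rw [this]
    refine (MeasurableSet.const _).union (Finset.measurableSet_biUnion _ fun t ht => ?_)
    exact F.mono (Finset.mem_filter.1 ht).2 _ (hA t (Finset.mem_filter.1 ht).1)
  · rcases firstTime_eq_or (b := b) (D := D) (A := A) (ω := ω) with h | h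
    · rw [h]; exact hab
    · exact (hD _ h.1).1
  · exact firstTime_le_iff.2 (Or.inl le_rfl)

end StoppingTimes

/-! ### Continuous adapted processes, the norm `‖·‖₁` and its maximal inequality. -/

section Processes

variable {Ω : Type*} [m : MeasurableSpace Ω] {F : Filtration ℝ m} {P : Measure Ω}

/-- A process all of whose paths are continuous on the real line, adapted on `[a,b]`. -/
structure RegularOn (F : Filtration ℝ m) (a b : ℝ) (X : ℝ → Ω → ℝ) : Prop where
  continuous : ∀ ω, Continuous fun t => X t ω
  adapted : ∀ t ∈ Icc a b, Measurable[F t] (X t)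
  measurable : ∀ t, Measurable (X t)

theorem RegularOn.measurable_uncurry {a b : ℝ} {X : ℝ → Ω → ℝ} (hX : RegularOn F a b X) :
    Measurable fun p : ℝ × Ω => X p.1 p.2 :=
  measurable_uncurry_of_continuous_of_measurable (u := X) hX.continuous hX.measurable

theorem RegularOn.measurable_comp {a b : ℝ} {X : ℝ → Ω → ℝ} (hX : RegularOn F a b X)
    {τ : Ω → ℝ} (hτ : Measurable τ) : Measurable fun ω => X (τ ω) ω :=
  hX.measurable_uncurry.comp (hτ.prodMk measurable_id)

theorem RegularOn.mono {a b a' b' : ℝ} {X : ℝ → Ω → ℝ} (hX : RegularOn F a b X)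
    (h : Icc a' b' ⊆ Icc a b) : RegularOn F a' b' X :=
  ⟨hX.continuous, fun t ht => hX.adapted t (h ht), hX.measurable⟩

theorem RegularOn.add {a b : ℝ} {X Y : ℝ → Ω → ℝ} (hX : RegularOn F a b X)
    (hY : RegularOn F a b Y) : RegularOn F a b fun t ω => X t ω + Y t ω :=
  ⟨fun ω => (hX.continuous ω).add (hY.continuous ω),
    fun t ht => (hX.adapted t ht).add (hY.adapted t ht),
    fun t => (hX.measurable t).add (hY.measurable t)⟩

theorem RegularOn.sub {a b : ℝ} {X Y : ℝ → Ω → ℝ} (hX : RegularOn F a b X)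
    (hY : RegularOn F a b Y) : RegularOn F a b fun t ω => X t ω - Y t ω :=
  ⟨fun ω => (hX.continuous ω).sub (hY.continuous ω),
    fun t ht => (hX.adapted t ht).sub (hY.adapted t ht),
    fun t => (hX.measurable t).sub (hY.measurable t)⟩

theorem RegularOn.comp {a b : ℝ} {X : ℝ → Ω → ℝ} (hX : RegularOn F a b X)
    {φ : ℝ → ℝ} (hφ : Continuous φ) : RegularOn F a b fun t ω => φ (X t ω) :=
  ⟨fun ω => hφ.comp (hX.continuous ω),
    fun t ht => hφ.measurable.comp (hX.adapted t ht),
    fun t => hφ.measurable.comp (hX.measurable t)⟩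

theorem regularOn_of_deterministic {a b : ℝ} {φ : ℝ → ℝ} (hφ : Continuous φ) :
    RegularOn F a b fun t _ => φ t :=
  ⟨fun _ => hφ, fun _ _ => measurable_const, fun _ => measurable_const⟩

open Classical in
/-- A process with almost surely continuous paths agrees with one whose paths are all
continuous. -/
theorem NullComplete.exists_regularOn (hF : NullComplete F P) {a b : ℝ} (hab : a ≤ b)
    {X : ℝ → Ω → ℝ} (hX : ∀ t ∈ Icc a b, Measurable[F t] (X t))
    (hc : ∀ᵐ ω ∂P, ContinuousOn (fun t => X t ω) (Icc a b)) :
    ∃ X' : ℝ → Ω → ℝ, RegularOn F a b X' ∧ ∀ᵐ ω ∂P, ∀ t ∈ Icc a b, X' t ω = X t ω := by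
  set S : Set Ω := {ω | ContinuousOn (fun t => X t ω) (Icc a b)}
  -- The good paths are extended as constants beyond `[a,b]` and the others replaced by zero;
  -- completeness of the filtration keeps the process adapted.
  set X' : ℝ → Ω → ℝ := fun t ω => if ω ∈ S then X (projIcc a b hab t) ω else 0 with hX'
  have hS : ∀ᵐ ω ∂P, ω ∈ S := hc
  have hae : ∀ᵐ ω ∂P, ∀ t ∈ Icc a b, X' t ω = X t ω := by
    filter_upwards [hS] with ω hω t ht
    simp [hX', hω, projIcc_of_mem hab ht]
  have hae' : ∀ t, X (projIcc a b hab t) =ᵐ[P] X' t := fun t => by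
    filter_upwards [hS] with ω hω
    simp [hX', hω]
  refine ⟨X', ⟨fun ω => ?_, fun t ht => ?_, fun t => ?_⟩, hae⟩
  · by_cases hω : ω ∈ S
    · simp only [hX', hω, if_true]
      exact (continuousOn_iff_continuous_domRestrict.1 hω).comp continuous_projIcc
    · simp only [hX', hω, if_false]
      exact continuous_const
  · refine hF.measurable_congr (hX t ht) ?_
    have := hae' t
    rwa [projIcc_of_mem hab ht] at this
  · exact (hF.measurable_congr (hX _ (projIcc a b hab t).2) (hae' t)).mono (F.le _) le_rfl

theorem lintegral_le_normOne {a b : ℝ} (X : ℝ → Ω → ℝ) {τ : Ω → ℝ}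
    (hτ : IsStoppingTimeIn F P a b τ) :
    ∫⁻ ω, ‖X (τ ω) ω‖ₑ ∂P ≤ normOne F P a b X :=
  le_iSup (fun τ : {τ : Ω → ℝ // IsStoppingTimeIn F P a b τ} => ∫⁻ ω, ‖X (τ.1 ω) ω‖ₑ ∂P) ⟨τ, hτ⟩

theorem normOne_le {a b : ℝ} {X : ℝ → Ω → ℝ} {C : ℝ≥0∞}
    (h : ∀ τ, IsStoppingTimeIn F P a b τ → ∫⁻ ω, ‖X (τ ω) ω‖ₑ ∂P ≤ C) :
    normOne F P a b X ≤ C :=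
  iSup_le fun τ => h τ.1 τ.2

theorem normOne_mono_ae {a b : ℝ} {X Y : ℝ → Ω → ℝ}
    (h : ∀ᵐ ω ∂P, ∀ t ∈ Icc a b, |X t ω| ≤ |Y t ω|) :
    normOne F P a b X ≤ normOne F P a b Y := by
  refine normOne_le fun τ hτ => le_trans (lintegral_mono_ae ?_) (lintegral_le_normOne Y hτ)
  filter_upwards [h, hτ.2] with ω h1 h2
  rw [Real.enorm_eq_ofReal_abs, Real.enorm_eq_ofReal_abs]
  exact ENNReal.ofReal_le_ofReal (h1 _ h2)

theorem normOne_congr_ae {a b : ℝ} {X Y : ℝ → Ω → ℝ}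
    (h : ∀ᵐ ω ∂P, ∀ t ∈ Icc a b, X t ω = Y t ω) :
    normOne F P a b X = normOne F P a b Y :=
  le_antisymm (normOne_mono_ae (h.mono fun ω hω t ht => by rw [hω t ht]))
    (normOne_mono_ae (h.mono fun ω hω t ht => by rw [hω t ht]))

theorem normOne_mono_interval {a b a' b' : ℝ} (X : ℝ → Ω → ℝ) (ha : a' ≤ a) (hb : b ≤ b') :
    normOne F P a b X ≤ normOne F P a' b' X :=
  normOne_le fun _ hτ => lintegral_le_normOne X (hτ.mono ha hb)

theorem normOne_le_add {a b : ℝ} {X Y Z : ℝ → Ω → ℝ} (hY : RegularOn F a b Y)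
    (h : ∀ᵐ ω ∂P, ∀ t ∈ Icc a b, |X t ω| ≤ |Y t ω| + |Z t ω|) :
    normOne F P a b X ≤ normOne F P a b Y + normOne F P a b Z := by
  refine normOne_le fun τ hτ => ?_
  calc ∫⁻ ω, ‖X (τ ω) ω‖ₑ ∂P ≤ ∫⁻ ω, ‖Y (τ ω) ω‖ₑ + ‖Z (τ ω) ω‖ₑ ∂P := by
        refine lintegral_mono_ae ?_
        filter_upwards [h, hτ.2] with ω h1 h2
        simp only [Real.enorm_eq_ofReal_abs]
        rw [← ENNReal.ofReal_add (abs_nonneg _) (abs_nonneg _)]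
        exact ENNReal.ofReal_le_ofReal (h1 _ h2)
    _ = ∫⁻ ω, ‖Y (τ ω) ω‖ₑ ∂P + ∫⁻ ω, ‖Z (τ ω) ω‖ₑ ∂P :=
        lintegral_add_left (hY.measurable_comp hτ.measurable).enorm _
    _ ≤ _ := add_le_add (lintegral_le_normOne Y hτ) (lintegral_le_normOne Z hτ)

theorem normOne_sub_le {a b : ℝ} {X Y Z : ℝ → Ω → ℝ} (hX : RegularOn F a b X)
    (hY : RegularOn F a b Y) :
    normOne F P a b (fun t ω => X t ω - Z t ω) ≤ normOne F P a b (fun t ω => X t ω - Y t ω)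
      + normOne F P a b (fun t ω => Y t ω - Z t ω) :=
  normOne_le_add (hX.sub hY) (Eventually.of_forall fun _ _ _ => abs_sub_le _ _ _)

theorem normOne_sub_comm {a b : ℝ} (X Y : ℝ → Ω → ℝ) :
    normOne F P a b (fun t ω => X t ω - Y t ω) = normOne F P a b (fun t ω => Y t ω - X t ω) :=
  le_antisymm (normOne_mono_ae (Eventually.of_forall fun _ _ _ => (abs_sub_comm _ _).le))
    (normOne_mono_ae (Eventually.of_forall fun _ _ _ => (abs_sub_comm _ _).le))

theorem RegularOn.integrable_comp {a b : ℝ} {X : ℝ → Ω → ℝ} (hX : RegularOn F a b X)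
    (hn : normOne F P a b X < ∞) {τ : Ω → ℝ} (hτ : IsStoppingTimeIn F P a b τ) :
    Integrable (fun ω => X (τ ω) ω) P :=
  ⟨(hX.measurable_comp hτ.measurable).aestronglyMeasurable,
    (lintegral_le_normOne X hτ).trans_lt hn⟩

/-- In `normOne` it suffices to take stopping times with finitely many values. -/
theorem RegularOn.normOne_le_of_finite_range (hF : NullComplete F P) {a b : ℝ} (hab : a ≤ b)
    {X : ℝ → Ω → ℝ} (hX : RegularOn F a b X) {C : ℝ≥0∞}
    (h : ∀ τ, IsStoppingTimeIn F P a b τ → (∀ ω, τ ω ∈ Icc a b) → (range τ).Finite →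
      ∫⁻ ω, ‖X (τ ω) ω‖ₑ ∂P ≤ C) :
    normOne F P a b X ≤ C := by
  refine normOne_le fun τ hτ => ?_
  obtain ⟨σ, hσ, hσm, hστ⟩ := hF.exists_clamp hab hτ
  have h1 : ∫⁻ ω, ‖X (τ ω) ω‖ₑ ∂P = ∫⁻ ω, ‖X (σ ω) ω‖ₑ ∂P :=
    lintegral_congr_ae (by filter_upwards [hστ] with ω hω; rw [hω])
  rw [h1]
  -- Fatou's lemma along the discretized times, which decrease to `σ` up to the mesh; continuity of
  -- the paths identifies the limit.
  have h2 : ∀ ω, liminf (fun n => ‖X (roundUp b n (σ ω)) ω‖ₑ) atTop = ‖X (σ ω) ω‖ₑ := fun ω =>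
    (((hX.continuous ω).enorm.tendsto _).comp (tendsto_roundUp (hσm ω).2)).liminf_eq
  calc ∫⁻ ω, ‖X (σ ω) ω‖ₑ ∂P
      = ∫⁻ ω, liminf (fun n => ‖X (roundUp b n (σ ω)) ω‖ₑ) atTop ∂P := by simp_rw [h2]
    _ ≤ liminf (fun n => ∫⁻ ω, ‖X (roundUp b n (σ ω)) ω‖ₑ ∂P) atTop :=
        lintegral_liminf_le fun n => (hX.measurable_comp (hσ.roundUp n).measurable).enorm
    _ ≤ C := by
        refine liminf_le_of_frequently_le' (Frequently.of_forall fun n => ?_)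
        exact h _ (hσ.roundUp n) (fun ω => roundUp_mem n (hσm ω)) (finite_range_roundUp n hσm)

/-- The maximal inequality in the norm `normOne`. -/
theorem RegularOn.maximal_inequality {a b : ℝ} (hab : a < b) {X : ℝ → Ω → ℝ}
    (hX : RegularOn F a b X) (ε : ℝ) :
    ENNReal.ofReal ε * P {ω | ∃ t ∈ Icc a b, ε < |X t ω|} ≤ normOne F P a b X := by
  have : Nonempty (Icc a b) := ⟨⟨a, left_mem_Icc.2 hab.le⟩⟩
  -- Path continuity reduces the event to a dense sequence of times. For finitely many of these,
  -- Markov's inequality is applied at the first time where `|X|` exceeds `ε`.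
  set q : ℕ → ℝ := fun n => (TopologicalSpace.denseSeq (Icc a b) n : ℝ) with hq
  have hqm : ∀ n, q n ∈ Icc a b := fun n => (TopologicalSpace.denseSeq (Icc a b) n).2
  set E : ℕ → Set Ω := fun n => {ω | ∃ t ∈ (Finset.range n).image q, ε < |X t ω|} with hE
  have hEm : Monotone E := by
    rintro n k hnk ω ⟨t, ht, h⟩
    exact ⟨t, Finset.image_mono _ (Finset.range_mono hnk) ht, h⟩
  have hun : {ω | ∃ t ∈ Icc a b, ε < |X t ω|} ⊆ ⋃ n, E n := by
    rintro ω ⟨t, ht, h⟩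
    have hopen : IsOpen {s : Icc a b | ε < |X s ω|} :=
      isOpen_lt continuous_const ((hX.continuous ω).comp continuous_subtype_val).abs
    obtain ⟨_, hs, ⟨n, rfl⟩⟩ := (TopologicalSpace.denseRange_denseSeq (Icc a b)).exists_mem_open
      hopen ⟨⟨t, ht⟩, h⟩ |>.imp fun n hn => (⟨hn, n, rfl⟩ : _ ∧ ∃ k, k = n)
    exact mem_iUnion.2 ⟨n + 1, q n, Finset.mem_image_of_mem _ (by simp), hs⟩
  have hbound : ∀ n, ENNReal.ofReal ε * P (E n) ≤ normOne F P a b X := by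
    intro n
    set A : ℝ → Set Ω := fun t => {ω | ε < |X t ω|}
    have hD : ∀ t ∈ (Finset.range n).image q, t ∈ Icc a b := by
      intro t ht
      obtain ⟨k, -, rfl⟩ := Finset.mem_image.1 ht
      exact hqm k
    have hA : ∀ t ∈ (Finset.range n).image q, MeasurableSet[F t] (A t) := fun t ht => by
      have := (hX.adapted t (hD t ht))
      exact (continuous_abs.measurable.comp this) measurableSet_Ioi
    have hτ := isStoppingTimeIn_firstTime (P := P) hab.le hD hA
    set τ := firstTime b ((Finset.range n).image q) A
    have hsub : E n ⊆ {ω | ENNReal.ofReal ε ≤ ‖X (τ ω) ω‖ₑ} ∪ {ω | τ ω = b ∧ ω ∈ E n} := by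
      intro ω hω
      rcases firstTime_eq_or (b := b) (D := (Finset.range n).image q) (A := A) (ω := ω) with h | h
      · exact Or.inr ⟨h, hω⟩
      · left
        have h2 : ε < |X (τ ω) ω| := h.2
        simp only [mem_ofPred_eq, Real.enorm_eq_ofReal_abs]
        exact ENNReal.ofReal_le_ofReal h2.le
    have hsub' : E n ⊆ {ω | ENNReal.ofReal ε ≤ ‖X (τ ω) ω‖ₑ} := by
      intro ω hω
      rcases hsub hω with h | ⟨h, ⟨t, ht, hεt⟩⟩
      · exact h
      -- The default value `b` of the first time does no harm: on `E n` the witness satisfies `t ≥ τ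
      -- = b`, so the level is exceeded at `b` itself.
      · have h1 : τ ω ≤ t := firstTime_le_iff.2 (Or.inr ⟨t, ht, hεt, le_rfl⟩)
        have h2 : t = b := le_antisymm (hD t ht).2 (h ▸ h1)
        simp only [mem_ofPred_eq, Real.enorm_eq_ofReal_abs, h]
        rw [h2] at hεt
        exact ENNReal.ofReal_le_ofReal hεt.le
    calc ENNReal.ofReal ε * P (E n) ≤ ENNReal.ofReal ε * P {ω | ENNReal.ofReal ε ≤ ‖X (τ ω) ω‖ₑ} :=
          mul_le_mul_right (measure_mono hsub') _
      _ ≤ ∫⁻ ω, ‖X (τ ω) ω‖ₑ ∂P :=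
          mul_meas_ge_le_lintegral (hX.measurable_comp hτ.measurable).enorm _
      _ ≤ _ := lintegral_le_normOne X hτ
  calc ENNReal.ofReal ε * P {ω | ∃ t ∈ Icc a b, ε < |X t ω|}
      ≤ ENNReal.ofReal ε * P (⋃ n, E n) := mul_le_mul_right (measure_mono hun) _
    _ = ⨆ n, ENNReal.ofReal ε * P (E n) := by rw [hEm.measure_iUnion, ENNReal.mul_iSup]
    _ ≤ _ := iSup_le hbound

end Processes

end MFDRBSDE

namespace MFDRBSDE

open Filter Topology

theorem measurable_limsup_real {Ω : Type*} {m : MeasurableSpace Ω} {f : ℕ → Ω → ℝ}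
    (hf : ∀ n, Measurable[m] (f n)) : Measurable[m] fun ω => limsup (fun n => f n ω) atTop :=
  Measurable.limsup hf

/-! ### Completeness of the continuous adapted processes under `‖·‖₁`. -/

section Completeness

variable {Ω : Type*} [m : MeasurableSpace Ω] {F : Filtration ℝ m} {P : Measure Ω}

/-- Fatou's lemma for the absolute values of an almost surely convergent sequence. -/
theorem lintegral_enorm_le_of_tendsto {f : ℕ → Ω → ℝ} {g : Ω → ℝ} {C : ℝ≥0∞}
    (hf : ∀ n, AEMeasurable (f n) P) (h : ∀ᵐ ω ∂P, Tendsto (fun n => f n ω) atTop (𝓝 (g ω)))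
    (hC : ∃ᶠ n in atTop, ∫⁻ ω, ‖f n ω‖ₑ ∂P ≤ C) : ∫⁻ ω, ‖g ω‖ₑ ∂P ≤ C := by
  have h1 : (fun ω => ‖g ω‖ₑ) =ᵐ[P] fun ω => liminf (fun n => ‖f n ω‖ₑ) atTop := by
    filter_upwards [h] with ω hω
    exact hω.enorm.liminf_eq.symm
  rw [lintegral_congr_ae h1]
  exact (lintegral_liminf_le' fun n => (hf n).enorm).trans (liminf_le_of_frequently_le' hC)

/-- A sequence with summable increments in `normOne` converges uniformly almost surely. -/
theorem NullComplete.exists_tendsto_of_geometric (hF : NullComplete F P) {a b : ℝ} (hab : a < b)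
    {Z : ℕ → ℝ → Ω → ℝ} (hZ : ∀ n, RegularOn F a b (Z n))
    (h : ∀ n, normOne F P a b (fun t ω => Z (n + 1) t ω - Z n t ω) ≤ ENNReal.ofReal ((1 / 4) ^ n)) :
    ∃ Y, RegularOn F a b Y ∧
      ∀ᵐ ω ∂P, ∀ t ∈ Icc a b, Tendsto (fun n => Z n t ω) atTop (𝓝 (Y t ω)) := by
  -- Norms `4⁻ⁿ` against the threshold `2⁻ⁿ` give `P (E n) ≤ 2⁻ⁿ` by the maximal inequality. By
  -- Borel–Cantelli the increments are then eventually at most `2⁻ⁿ`, uniformly in time.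
  set E : ℕ → Set Ω := fun n => {ω | ∃ t ∈ Icc a b, (1 / 2 : ℝ) ^ n < |Z (n + 1) t ω - Z n t ω|}
  have hE : ∀ n, P (E n) ≤ ENNReal.ofReal ((1 / 2) ^ n) := by
    intro n
    have h1 := (((hZ (n + 1)).sub (hZ n)).maximal_inequality (P := P) hab ((1 / 2) ^ n)).trans (h n)
    have h2 : ((1 : ℝ) / 4) ^ n = (1 / 2) ^ n * (1 / 2) ^ n := by rw [← mul_pow]; norm_num
    rw [h2, ENNReal.ofReal_mul (by positivity)] at h1
    exact (ENNReal.mul_le_mul_iff_right (by simp) ENNReal.ofReal_ne_top).1 h1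
  have hsum : ∑' n, P (E n) ≠ ∞ := by
    refine ne_top_of_le_ne_top ?_ (ENNReal.tsum_le_tsum hE)
    rw [← ENNReal.ofReal_tsum_of_nonneg (fun n => by positivity) summable_geometric_two]
    exact ENNReal.ofReal_ne_top
  have hgood : ∀ᵐ ω ∂P, ∃ K, ∀ t ∈ Icc a b, ∀ n,
      dist (Z (n + K) t ω) (Z (n + 1 + K) t ω) ≤ (1 / 2) ^ K * (1 / 2 : ℝ) ^ n := by
    filter_upwards [ae_eventually_notMem hsum] with ω hω
    obtain ⟨K, hK⟩ := eventually_atTop.1 hω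
    refine ⟨K, fun t ht n => ?_⟩
    have h1 := hK (n + K) (by omega)
    simp only [E, mem_ofPred_eq, not_exists, not_and, not_lt] at h1
    have h2 := h1 t ht
    rw [dist_comm, Real.dist_eq, ← pow_add, add_comm K n, add_right_comm]
    exact h2
  -- The limit superior is defined for every `ω` and measurable with respect to `F t`, so
  -- adaptedness needs no separate treatment of the exceptional set.
  set Y : ℝ → Ω → ℝ := fun t ω => limsup (fun n => Z n t ω) atTop with hY
  have hlim : ∀ᵐ ω ∂P, ∀ t ∈ Icc a b, Tendsto (fun n => Z n t ω) atTop (𝓝 (Y t ω)) := by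
    filter_upwards [hgood] with ω ⟨K, hK⟩ t ht
    obtain ⟨l, hl⟩ := cauchySeq_tendsto_of_complete
      (cauchySeq_of_le_geometric (1 / 2) ((1 / 2) ^ K) (by norm_num) (hK t ht))
    have h1 : Tendsto (fun n => Z n t ω) atTop (𝓝 l) := (tendsto_add_atTop_iff_nat K).1 hl
    have h2 : Y t ω = l := h1.limsup_eq
    rwa [h2]
  have hcont : ∀ᵐ ω ∂P, ContinuousOn (fun t => Y t ω) (Icc a b) := by
    filter_upwards [hgood, hlim] with ω ⟨K, hK⟩ hl
    have hu : TendstoUniformlyOn (fun n t => Z (n + K) t ω) (fun t => Y t ω) atTop (Icc a b) := by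
      rw [Metric.tendstoUniformlyOn_iff]
      intro ε hε
      have h0 : Tendsto (fun n : ℕ => (1 / 2 : ℝ) ^ K * (1 / 2) ^ n / (1 - 1 / 2)) atTop (𝓝 0) := by
        have := ((tendsto_pow_atTop_nhds_zero_of_lt_one (r := (1 / 2 : ℝ)) (by norm_num)
          (by norm_num)).const_mul ((1 / 2 : ℝ) ^ K)).div_const (1 - 1 / 2 : ℝ)
        simpa using this
      filter_upwards [h0.eventually (gt_mem_nhds hε)] with n hn t ht
      rw [dist_comm]
      exact (dist_le_of_le_geometric_of_tendsto (1 / 2) ((1 / 2) ^ K) (by norm_num) (hK t ht)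
        ((tendsto_add_atTop_iff_nat K).2 (hl t ht)) n).trans_lt hn
    exact hu.continuousOn (Frequently.of_forall fun n => ((hZ _).continuous ω).continuousOn)
  obtain ⟨Y', hY', h'⟩ := hF.exists_regularOn hab.le (X := Y)
    (fun t ht => measurable_limsup_real fun n => (hZ n).adapted t ht) hcont
  refine ⟨Y', hY', ?_⟩
  filter_upwards [h', hlim] with ω h1 h2 t ht
  rw [h1 t ht]
  exact h2 t ht

/-- The regular processes are complete for `normOne`. -/
theorem NullComplete.exists_tendsto_normOne (hF : NullComplete F P) {a b : ℝ} (hab : a < b)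
    {X : ℕ → ℝ → Ω → ℝ} (hX : ∀ n, RegularOn F a b (X n))
    (hc : ∀ ε : ℝ≥0∞, 0 < ε → ∃ N, ∀ n ≥ N, ∀ k ≥ N,
      normOne F P a b (fun t ω => X n t ω - X k t ω) ≤ ε) :
    ∃ Y, RegularOn F a b Y ∧
      Tendsto (fun n => normOne F P a b (fun t ω => X n t ω - Y t ω)) atTop (𝓝 0) := by
  choose! N hN using hc
  -- The maximum over `i ≤ k` is taken because the thresholds `N` need not increase as the tolerance
  -- decreases.
  set φ : ℕ → ℕ := fun k => (Finset.range (k + 1)).sup fun i => N (ENNReal.ofReal ((1 / 4) ^ i))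
  have hφ : ∀ i k, i ≤ k → N (ENNReal.ofReal ((1 / 4) ^ i)) ≤ φ k := fun i k hik =>
    Finset.le_sup (f := fun i => N (ENNReal.ofReal ((1 / 4) ^ i)))
      (Finset.mem_range.2 (Nat.lt_succ_of_le hik))
  have hpos : ∀ i : ℕ, 0 < ENNReal.ofReal ((1 / 4) ^ i) := fun i =>
    ENNReal.ofReal_pos.2 (by positivity)
  obtain ⟨Y, hY, hlim⟩ := hF.exists_tendsto_of_geometric hab (Z := fun k => X (φ k))
    (fun k => hX _) (fun k => hN _ (hpos k) _ (hφ _ _ (Nat.le_succ k)) _ (hφ _ _ le_rfl))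
  refine ⟨Y, hY, ENNReal.tendsto_nhds_zero.2 fun ε hε => ?_⟩
  have h0 : Tendsto (fun i : ℕ => ENNReal.ofReal ((1 / 4) ^ i)) atTop (𝓝 0) := by
    have := ENNReal.tendsto_ofReal (tendsto_pow_atTop_nhds_zero_of_lt_one (r := (1 / 4 : ℝ))
      (by norm_num) (by norm_num))
    simpa using this
  obtain ⟨i, hi⟩ := ((ENNReal.tendsto_nhds_zero.1 h0) ε hε).exists
  filter_upwards [eventually_ge_atTop (N (ENNReal.ofReal ((1 / 4) ^ i)))] with n hn
  -- At each stopping time, Fatou's lemma along the subsequence turns the Cauchy bound into a bound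
  -- for the distance to the limit.
  refine le_trans (normOne_le fun τ hτ => ?_) hi
  refine lintegral_enorm_le_of_tendsto (f := fun k ω => X n (τ ω) ω - X (φ k) (τ ω) ω)
    (fun k => (((hX n).sub (hX (φ k))).measurable_comp hτ.measurable).aemeasurable) ?_ ?_
  · filter_upwards [hlim, hτ.2] with ω h1 h2
    exact (h1 _ h2).const_sub _
  · refine Eventually.frequently ?_
    filter_upwards [eventually_ge_atTop i] with k hk
    exact (lintegral_le_normOne (fun t ω => X n t ω - X (φ k) t ω) hτ).trans
      (hN _ (hpos i) n hn _ (hφ i k hk))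

/-- A process with vanishing `normOne` is indistinguishable from zero. -/
theorem RegularOn.eq_zero_of_normOne {a b : ℝ} (hab : a < b) {X : ℝ → Ω → ℝ}
    (hX : RegularOn F a b X) (h : normOne F P a b X = 0) :
    ∀ᵐ ω ∂P, ∀ t ∈ Icc a b, X t ω = 0 := by
  have h1 : ∀ n : ℕ, ∀ᵐ ω ∂P, ∀ t ∈ Icc a b, |X t ω| ≤ 1 / ((n : ℝ) + 1) := by
    intro n
    have h2 := hX.maximal_inequality (P := P) hab (1 / ((n : ℝ) + 1))
    rw [h, nonpos_iff_eq_zero, mul_eq_zero] at h2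
    rcases h2 with h2 | h2
    · exact absurd h2 (ENNReal.ofReal_pos.2 (by positivity)).ne'
    · rw [ae_iff]
      convert h2 using 2
      ext ω
      simp [and_assoc]
  filter_upwards [ae_all_iff.2 h1] with ω hω t ht
  have := ge_of_tendsto' (tendsto_one_div_add_atTop_nhds_zero_nat (𝕜 := ℝ)) fun n => hω n t ht
  exact abs_eq_zero.1 (le_antisymm this (abs_nonneg _))

end Completeness

/-! ### Class (D) through tails in `‖·‖₁`. -/

section ClassD

variable {Ω : Type*} [m : MeasurableSpace Ω] {F : Filtration ℝ m} {P : Measure Ω}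

/-- The tails of `X` are small in `normOne`: a reformulation of class (D). -/
def ClassD (F : Filtration ℝ m) (P : Measure Ω) (a b : ℝ) (X : ℝ → Ω → ℝ) : Prop :=
  ∀ ε : ℝ≥0∞, 0 < ε → ∃ R : ℝ, 0 ≤ R ∧ normOne F P a b (fun t ω => max (|X t ω| - R) 0) ≤ ε

theorem abs_max_zero (x : ℝ) : |max x 0| = max x 0 := abs_of_nonneg (le_max_right _ _)

theorem ClassD.of_le {a b : ℝ} {X Y : ℝ → Ω → ℝ} (hY : ClassD F P a b Y)
    (h : ∀ᵐ ω ∂P, ∀ t ∈ Icc a b, |X t ω| ≤ |Y t ω|) : ClassD F P a b X := by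
  intro ε hε
  obtain ⟨R, hR, hY⟩ := hY ε hε
  refine ⟨R, hR, le_trans (normOne_mono_ae ?_) hY⟩
  filter_upwards [h] with ω hω t ht
  rw [abs_max_zero, abs_max_zero]
  exact max_le_max (sub_le_sub_right (hω t ht) _) le_rfl

theorem RegularOn.tail {a b : ℝ} {X : ℝ → Ω → ℝ} (hX : RegularOn F a b X) (R : ℝ) :
    RegularOn F a b fun t ω => max (|X t ω| - R) 0 :=
  hX.comp (φ := fun x => max (|x| - R) 0) (by fun_prop)

/-- Excesses are subadditive in value and level: `(y + z - (R + R'))⁺ ≤ (y - R)⁺ + (z - R')⁺`. -/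
theorem ClassD.of_le_add {a b : ℝ} {X Y Z : ℝ → Ω → ℝ} (hY : ClassD F P a b Y)
    (hZ : ClassD F P a b Z) (hYr : RegularOn F a b Y)
    (h : ∀ᵐ ω ∂P, ∀ t ∈ Icc a b, |X t ω| ≤ |Y t ω| + |Z t ω|) : ClassD F P a b X := by
  intro ε hε
  obtain ⟨R, hR, hY⟩ := hY (ε / 2) (ENNReal.half_pos hε.ne')
  obtain ⟨R', hR', hZ⟩ := hZ (ε / 2) (ENNReal.half_pos hε.ne')
  refine ⟨R + R', add_nonneg hR hR', ?_⟩
  rw [← ENNReal.add_halves ε]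
  refine (normOne_le_add (hYr.tail R) ?_).trans (add_le_add hY hZ)
  filter_upwards [h] with ω hω t ht
  simp only [abs_max_zero]
  have h1 := hω t ht
  have h2 := le_max_left (|Y t ω| - R) 0
  have h3 := le_max_left (|Z t ω| - R') 0
  have h4 := le_max_right (|Y t ω| - R) 0
  have h5 := le_max_right (|Z t ω| - R') 0
  exact max_le (by linarith) (by linarith)

/-- All tails are dominated by `(|ζ| - n)⁺`, whose mean tends to zero by dominated convergence. -/
theorem classD_of_integrable_bound {a b : ℝ} {X : ℝ → Ω → ℝ} {ζ : Ω → ℝ} (hζ : Integrable ζ P)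
    (h : ∀ᵐ ω ∂P, ∀ t ∈ Icc a b, |X t ω| ≤ ζ ω) : ClassD F P a b X := by
  intro ε hε
  have h1 : Tendsto (fun n : ℕ => ∫⁻ ω, ‖max (|ζ ω| - n) 0‖ₑ ∂P) atTop (𝓝 0) := by
    have := tendsto_lintegral_of_dominated_convergence' (μ := P) (F := fun (n : ℕ) ω =>
      ‖max (|ζ ω| - n) 0‖ₑ) (f := fun _ => 0) (fun ω => ‖ζ ω‖ₑ)
      (fun n => by
        have := hζ.aemeasurable
        fun_prop) (fun n => Eventually.of_forall fun ω => ?_) hζ.2.ne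
      (Eventually.of_forall fun ω => ?_)
    · simpa using this
    · simp only [Real.enorm_eq_ofReal_abs, abs_max_zero]
      exact ENNReal.ofReal_le_ofReal
        (max_le (sub_le_self _ (Nat.cast_nonneg _)) (abs_nonneg _))
    · refine tendsto_const_nhds.congr' ?_
      filter_upwards [eventually_ge_atTop ⌈|ζ ω|⌉₊] with n hn
      rw [max_eq_right, enorm_zero]
      exact sub_nonpos.2 ((Nat.le_ceil _).trans (Nat.cast_le.2 hn))
  obtain ⟨n, hn⟩ := ((ENNReal.tendsto_nhds_zero.1 h1) ε hε).exists
  refine ⟨n, Nat.cast_nonneg _, normOne_le fun τ hτ => le_trans (lintegral_mono_ae ?_) hn⟩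
  filter_upwards [h, hτ.2] with ω h2 h3
  rw [Real.enorm_eq_ofReal_abs, Real.enorm_eq_ofReal_abs, abs_max_zero, abs_max_zero]
  exact ENNReal.ofReal_le_ofReal
    (max_le_max (sub_le_sub_right ((h2 _ h3).trans (le_abs_self _)) _) le_rfl)

/-- The tail `x ↦ (|x| - R)⁺` is 1-Lipschitz, so class (D) is closed under limits in `‖·‖₁`. -/
theorem ClassD.of_normOne_sub {a b : ℝ} {X : ℕ → ℝ → Ω → ℝ} {Y : ℝ → Ω → ℝ}
    (hX : ∀ n, ClassD F P a b (X n)) (hXr : ∀ n, RegularOn F a b (X n))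
    (h : Tendsto (fun n => normOne F P a b (fun t ω => X n t ω - Y t ω)) atTop (𝓝 0)) :
    ClassD F P a b Y := by
  intro ε hε
  obtain ⟨n, hn⟩ := ((ENNReal.tendsto_nhds_zero.1 h) (ε / 2) (ENNReal.half_pos hε.ne')).exists
  obtain ⟨R, hR, hXn⟩ := hX n (ε / 2) (ENNReal.half_pos hε.ne')
  refine ⟨R, hR, ?_⟩
  rw [← ENNReal.add_halves ε]
  refine (normOne_le_add ((hXr n).tail R) (Eventually.of_forall fun ω t _ => ?_)).trans
    (add_le_add hXn hn)
  rw [abs_max_zero, abs_max_zero]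
  have h1 := le_max_left (|X n t ω| - R) 0
  have h2 := le_max_right (|X n t ω| - R) 0
  have h3 := abs_sub_abs_le_abs_sub (Y t ω) (X n t ω)
  rw [abs_sub_comm] at h3
  exact max_le (by linarith) (by positivity)

theorem ClassD.normOne_lt_top [IsProbabilityMeasure P] {a b : ℝ} {X : ℝ → Ω → ℝ}
    (hX : ClassD F P a b X) : normOne F P a b X < ∞ := by
  obtain ⟨R, hR, h⟩ := hX 1 one_pos
  have h1 : normOne F P a b (fun _ _ => R) ≤ ENNReal.ofReal R := normOne_le fun τ _ => by
    simp [Real.enorm_eq_ofReal_abs, abs_of_nonneg hR]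
  refine lt_of_le_of_lt ((normOne_le_add (Y := fun _ _ => R)
    (regularOn_of_deterministic continuous_const)
    (Eventually.of_forall fun ω t _ => ?_)).trans (add_le_add h1 h))
    (ENNReal.add_lt_top.2 ⟨ENNReal.ofReal_lt_top, ENNReal.one_lt_top⟩)
  rw [abs_of_nonneg hR, abs_max_zero]
  linarith [le_max_left (|X t ω| - R) 0]

theorem ClassD.uniformIntegrable [IsProbabilityMeasure P] {a b : ℝ} {X : ℝ → Ω → ℝ}
    (hX : ClassD F P a b X) (hXr : RegularOn F a b X) :
    UniformIntegrable (fun (τ : {τ : Ω → ℝ // IsStoppingTimeIn F P a b τ}) (ω : Ω) => X (τ.1 ω) ω)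
      1 P := by
  refine uniformIntegrable_of le_rfl ENNReal.one_ne_top
    (fun τ => (hXr.measurable_comp τ.2.measurable).aestronglyMeasurable) fun ε hε => ?_
  obtain ⟨R, hR, h⟩ := hX (ENNReal.ofReal (ε / 2)) (ENNReal.ofReal_pos.2 (half_pos hε))
  -- The level is `2 * R` because `|x| ≤ 2 (|x| - R)⁺` once `|x| ≥ 2 * R`; this also explains the
  -- tolerance `ε / 2`.
  refine ⟨(2 * R).toNNReal, fun τ => ?_⟩
  rw [eLpNorm_one_eq_lintegral_enorm]
  calc _ ≤ ∫⁻ ω, ENNReal.ofReal 2 * ‖max (|X (τ.1 ω) ω| - R) 0‖ₑ ∂P := by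
        refine lintegral_mono fun ω => ?_
        by_cases hω : (2 * R).toNNReal ≤ ‖X (τ.1 ω) ω‖₊
        · have hω' : 2 * R ≤ |X (τ.1 ω) ω| := by
            have := NNReal.coe_le_coe.2 hω
            rwa [Real.coe_toNNReal _ (by positivity), coe_nnnorm, Real.norm_eq_abs] at this
          rw [indicator_of_mem (by exact hω), Real.enorm_eq_ofReal_abs, Real.enorm_eq_ofReal_abs,
            abs_max_zero, ← ENNReal.ofReal_mul (by norm_num)]
          refine ENNReal.ofReal_le_ofReal ?_
          linarith [le_max_left (|X (τ.1 ω) ω| - R) 0]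
        · rw [indicator_of_notMem (by exact hω)]
          simp
    _ = ENNReal.ofReal 2 * ∫⁻ ω, ‖max (|X (τ.1 ω) ω| - R) 0‖ₑ ∂P :=
        lintegral_const_mul' _ _ ENNReal.ofReal_ne_top
    _ ≤ ENNReal.ofReal 2 * ENNReal.ofReal (ε / 2) :=
        mul_le_mul_right ((lintegral_le_normOne (fun t ω => max (|X t ω| - R) 0) τ.2).trans h) _
    _ = ENNReal.ofReal ε := by
        rw [← ENNReal.ofReal_mul (by norm_num)]; congr 1; ring

theorem ClassD.memClassD [IsProbabilityMeasure P] {a b : ℝ} {X : ℝ → Ω → ℝ}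
    (hX : ClassD F P a b X) (hXr : RegularOn F a b X) : MemClassD F P a b X where
  adapted := hXr.adapted
  continuous_paths := Eventually.of_forall fun ω => (hXr.continuous ω).continuousOn
  norm_lt_top := hX.normOne_lt_top
  uniformIntegrable := hX.uniformIntegrable hXr

/-- The excess `(|x| - C)⁺` is at most `|x|` on `{|x| ≥ C}` and vanishes elsewhere, so uniform
integrability controls the tails. -/
theorem MemClassD.classD {a b : ℝ} {X : ℝ → Ω → ℝ} (hX : MemClassD F P a b X) :
    ClassD F P a b X := by
  intro ε hε
  obtain ⟨δ, hδ, hδε⟩ : ∃ δ : ℝ, 0 < δ ∧ ENNReal.ofReal δ ≤ ε := by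
    by_cases h : ε = ∞
    · exact ⟨1, one_pos, by simp [h]⟩
    · exact ⟨ε.toReal, ENNReal.toReal_pos hε.ne' h, ENNReal.ofReal_toReal_le⟩
  obtain ⟨C, hC⟩ := hX.uniformIntegrable.spec one_ne_zero ENNReal.one_ne_top hδ
  refine ⟨C, C.2, normOne_le fun τ hτ => le_trans ?_ ((hC ⟨τ, hτ⟩).trans hδε)⟩
  rw [eLpNorm_one_eq_lintegral_enorm]
  refine lintegral_mono fun ω => ?_
  by_cases hω : C ≤ ‖X (τ ω) ω‖₊
  · rw [indicator_of_mem (by exact hω), Real.enorm_eq_ofReal_abs, Real.enorm_eq_ofReal_abs,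
      abs_max_zero]
    exact ENNReal.ofReal_le_ofReal (max_le (sub_le_self _ C.2) (abs_nonneg _))
  · rw [max_eq_right, enorm_zero]
    · exact zero_le
    · have := NNReal.coe_le_coe.2 (not_le.1 hω).le
      rw [coe_nnnorm, Real.norm_eq_abs] at this
      linarith

/-- Truncation at level `R` of a real number. -/
noncomputable def trunc (R x : ℝ) : ℝ := max (-R) (Min.min x R)

theorem continuous_trunc (R : ℝ) : Continuous (trunc R) := by
  unfold trunc; fun_prop

theorem trunc_mono (R : ℝ) : Monotone (trunc R) := fun _ _ h =>
  max_le_max le_rfl (min_le_min h le_rfl)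

theorem abs_trunc_le {R : ℝ} (hR : 0 ≤ R) (x : ℝ) : |trunc R x| ≤ R :=
  abs_le.2 ⟨le_max_left _ _, max_le (by linarith) (min_le_right _ _)⟩

theorem abs_sub_trunc_le {R : ℝ} (hR : 0 ≤ R) (x : ℝ) : |x - trunc R x| ≤ max (|x| - R) 0 := by
  unfold trunc
  rcases abs_cases x with ⟨h1, h2⟩ | ⟨h1, h2⟩ <;> rw [h1] <;>
    rcases le_total x R with h3 | h3 <;> rcases le_total (-R) x with h4 | h4 <;>
    simp only [min_eq_left h3, min_eq_right h3, max_eq_right h4, max_eq_left h4,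
      max_eq_right (by linarith : -R ≤ R), sub_self, abs_zero, le_max_right] <;>
    exact (abs_le.2 ⟨by linarith, by linarith⟩).trans (le_max_left _ _)

end ClassD

end MFDRBSDE

namespace MFDRBSDE

open Filter Topology

theorem measurableSet_le_real {Ω : Type*} {m : MeasurableSpace Ω} {f g : Ω → ℝ}
    (hf : Measurable[m] f) (hg : Measurable[m] g) : MeasurableSet[m] {ω | f ω ≤ g ω} :=
  measurableSet_le hf hg

/-! ### Essential suprema of conditional expectations over stopping times. -/

section EssSup

variable {Ω : Type*} [m : MeasurableSpace Ω] {F : Filtration ℝ m} {P : Measure Ω}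

/-- An almost surely increasing sequence with bounded integrals converges almost surely to an
integrable limit. -/
theorem exists_integrable_tendsto_of_monotone {f : ℕ → Ω → ℝ} (hf : ∀ n, Integrable (f n) P)
    (hm : ∀ n, f n ≤ᵐ[P] f (n + 1)) {C : ℝ} (hC : ∀ n, ∫ ω, f n ω ∂P ≤ C) :
    ∃ W, Integrable W P ∧ ∀ᵐ ω ∂P, Monotone (fun n => f n ω) ∧
      Tendsto (fun n => f n ω) atTop (𝓝 (W ω)) := by
  have hmono : ∀ᵐ ω ∂P, Monotone fun n => f n ω :=
    (ae_all_iff.2 hm).mono fun ω hω => monotone_nat_of_le_succ hω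
  have hm0 : ∀ n, f 0 ≤ᵐ[P] f n := fun n => hmono.mono fun ω hω => hω (Nat.zero_le n)
  set g : ℕ → Ω → ℝ≥0∞ := fun n ω => ENNReal.ofReal (f n ω - f 0 ω) with hg
  have hgm : ∀ n, AEMeasurable (g n) P := fun n =>
    ((hf n).sub (hf 0)).aemeasurable.ennreal_ofReal
  have hgmono : ∀ᵐ ω ∂P, Monotone fun n => g n ω := hmono.mono fun ω hω i j hij =>
    ENNReal.ofReal_le_ofReal (sub_le_sub_right (hω hij) _)
  have hgint : ∀ n, ∫⁻ ω, g n ω ∂P ≤ ENNReal.ofReal (C - ∫ ω, f 0 ω ∂P) := by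
    intro n
    have h1 := ofReal_integral_eq_lintegral_ofReal ((hf n).sub (hf 0))
      ((hm0 n).mono fun ω hω => sub_nonneg.2 hω)
    have h2 : ∫ ω, (f n - f 0) ω ∂P = ∫ ω, f n ω ∂P - ∫ ω, f 0 ω ∂P := integral_sub (hf n) (hf 0)
    rw [h2] at h1
    exact h1.symm.le.trans (ENNReal.ofReal_le_ofReal (sub_le_sub_right (hC n) _))
  have hsup : ∫⁻ ω, ⨆ n, g n ω ∂P ≤ ENNReal.ofReal (C - ∫ ω, f 0 ω ∂P) := by
    rw [lintegral_iSup' hgm hgmono]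
    exact iSup_le hgint
  have hfin : ∀ᵐ ω ∂P, ⨆ n, g n ω < ∞ :=
    ae_lt_top' (AEMeasurable.iSup hgm) (hsup.trans_lt ENNReal.ofReal_lt_top).ne
  set W : Ω → ℝ := fun ω => (⨆ n, g n ω).toReal + f 0 ω
  have hlim : ∀ᵐ ω ∂P, Tendsto (fun n => f n ω) atTop (𝓝 (W ω)) := by
    filter_upwards [hfin, hgmono, hmono] with ω h1 h2 h3
    have h4 := (ENNReal.tendsto_toReal h1.ne).comp (tendsto_atTop_iSup h2)
    have h5 := h4.add_const (f 0 ω)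
    refine h5.congr fun n => ?_
    simp [g, ENNReal.toReal_ofReal (sub_nonneg.2 (h3 (Nat.zero_le n)))]
  refine ⟨W, Integrable.add ?_ (hf 0), hmono.and hlim⟩
  exact integrable_toReal_of_lintegral_ne_top (AEMeasurable.iSup hgm)
    (hsup.trans_lt ENNReal.ofReal_lt_top).ne

/-- The essential supremum of a directed family with bounded integrals is the increasing limit of
a sequence in the family. -/
theorem exists_essSup_of_directed {ι : Type*} [Nonempty ι] {Z : ι → Ω → ℝ}
    (hZ : ∀ i, Integrable (Z i) P) (hd : ∀ i j, ∃ k, Z i ≤ᵐ[P] Z k ∧ Z j ≤ᵐ[P] Z k)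
    {C : ℝ} (hC : ∀ i, ∫ ω, Z i ω ∂P ≤ C) :
    ∃ (u : ℕ → ι) (W : Ω → ℝ), Integrable W P ∧
      (∀ᵐ ω ∂P, Monotone (fun n => Z (u n) ω) ∧ Tendsto (fun n => Z (u n) ω) atTop (𝓝 (W ω))) ∧
      ∀ i, Z i ≤ᵐ[P] W := by
  choose d hd1 hd2 using hd
  set s : ℝ := ⨆ i, ∫ ω, Z i ω ∂P
  have hbdd : BddAbove (range fun i => ∫ ω, Z i ω ∂P) := ⟨C, by rintro _ ⟨i, rfl⟩; exact hC i⟩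
  have hle : ∀ i, ∫ ω, Z i ω ∂P ≤ s := fun i => le_ciSup hbdd i
  have hv : ∀ n : ℕ, ∃ i, s - 1 / ((n : ℝ) + 1) < ∫ ω, Z i ω ∂P := fun n =>
    exists_lt_of_lt_ciSup (sub_lt_self _ (by positivity))
  choose v hv using hv
  -- Successive upper bounds of a maximizing sequence: increasing, with integrals still tending to
  -- the supremum `s`.
  set u : ℕ → ι := fun n => Nat.rec (v 0) (fun n i => d i (v (n + 1))) n with hu
  have hmono : ∀ n, Z (u n) ≤ᵐ[P] Z (u (n + 1)) := fun n => hd1 _ _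
  have hvu : ∀ n, Z (v n) ≤ᵐ[P] Z (u n) := by
    rintro (_ | n)
    · exact EventuallyLE.rfl
    · exact hd2 _ _
  have hlow : ∀ n : ℕ, s - 1 / ((n : ℝ) + 1) ≤ ∫ ω, Z (u n) ω ∂P := fun n =>
    (hv n).le.trans (integral_mono_ae (hZ _) (hZ _) (hvu n))
  obtain ⟨W, hW, hWlim⟩ := exists_integrable_tendsto_of_monotone (fun n => hZ (u n)) hmono
    (fun n => hC (u n))
  refine ⟨u, W, hW, hWlim, fun i => ?_⟩
  have hpos : Integrable (fun ω => max (Z i ω - W ω) 0) P := ((hZ i).sub hW).pos_part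
  -- A member above both `Z i` and `Z (u n)` has integral at most `s`, so the passage to it from `Z
  -- (u n)` gains at most `1 / (n + 1)`. The excess of `Z i` over `W` is part of this gain.
  have hsmall : ∀ n : ℕ, ∫ ω, max (Z i ω - W ω) 0 ∂P ≤ 1 / ((n : ℝ) + 1) := by
    intro n
    calc ∫ ω, max (Z i ω - W ω) 0 ∂P ≤ ∫ ω, (Z (d i (u n)) ω - Z (u n) ω) ∂P := by
          refine integral_mono_ae hpos ((hZ _).sub (hZ _)) ?_
          filter_upwards [hWlim, hd1 i (u n), hd2 i (u n)] with ω h1 h2 h3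
          have h4 := h1.1.ge_of_tendsto h1.2 n
          exact max_le (by linarith) (by linarith)
      _ = ∫ ω, Z (d i (u n)) ω ∂P - ∫ ω, Z (u n) ω ∂P := integral_sub (hZ _) (hZ _)
      _ ≤ _ := by linarith [hle (d i (u n)), hlow n]
  have hzero : ∫ ω, max (Z i ω - W ω) 0 ∂P = 0 := le_antisymm
    (ge_of_tendsto' (tendsto_one_div_add_atTop_nhds_zero_nat (𝕜 := ℝ)) hsmall)
    (integral_nonneg fun ω => le_max_right _ _)
  have h0 := (integral_eq_zero_iff_of_nonneg (fun ω => le_max_right _ _) hpos).1 hzero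
  filter_upwards [h0] with ω hω
  have h1 : max (Z i ω - W ω) 0 = 0 := hω
  linarith [le_max_left (Z i ω - W ω) 0]

-- Pasting `ρ` and `ρ'` along the `F t`-event where the first conditional expectation is the larger
-- one gives the maximum of the two. This is the directedness required by
-- `exists_essSup_of_directed`.
open Classical in
theorem NullComplete.exists_condExp_directed [IsFiniteMeasure P] (hF : NullComplete F P) {t b : ℝ}
    {G : ℝ → Ω → ℝ}
    (hG : ∀ ρ, IsStoppingTimeIn F P t b ρ → Integrable (fun ω => G (ρ ω) ω) P)
    {ρ ρ' : Ω → ℝ} (hρ : IsStoppingTimeIn F P t b ρ) (hρ' : IsStoppingTimeIn F P t b ρ') :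
    ∃ ρ'', IsStoppingTimeIn F P t b ρ'' ∧
      P[fun ω => G (ρ ω) ω | F t] ≤ᵐ[P] P[fun ω => G (ρ'' ω) ω | F t] ∧
      P[fun ω => G (ρ' ω) ω | F t] ≤ᵐ[P] P[fun ω => G (ρ'' ω) ω | F t] := by
  set f := P[fun ω => G (ρ ω) ω | F t]
  set f' := P[fun ω => G (ρ' ω) ω | F t]
  set A : Set Ω := {ω | f' ω ≤ f ω} with hAdef
  have hA : MeasurableSet[F t] A :=
    measurableSet_le_real stronglyMeasurable_condExp.measurable
      stronglyMeasurable_condExp.measurable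
  refine ⟨A.piecewise ρ ρ', hF.isStoppingTimeIn_piecewise hρ hρ' hA, ?_⟩
  have h1 : (fun ω => G (A.piecewise ρ ρ' ω) ω) =
      A.indicator (fun ω => G (ρ ω) ω) + Aᶜ.indicator fun ω => G (ρ' ω) ω := by
    ext ω
    by_cases hω : ω ∈ A <;> simp [hω]
  have h2 : P[fun ω => G (A.piecewise ρ ρ' ω) ω | F t] =ᵐ[P] A.indicator f + Aᶜ.indicator f' := by
    rw [h1]
    refine (condExp_add ((hG ρ hρ).indicator (F.le t _ hA))
      ((hG ρ' hρ').indicator (F.le t _ hA.compl)) _).trans ?_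
    exact (condExp_indicator (hG ρ hρ) hA).add (condExp_indicator (hG ρ' hρ') hA.compl)
  constructor <;> filter_upwards [h2] with ω hω <;> rw [hω]
  · by_cases h : ω ∈ A
    · simp [h]
    · simp only [Pi.add_apply, indicator_of_notMem h, indicator_of_mem (mem_compl h), zero_add]
      exact (not_le.1 h).le
  · by_cases h : ω ∈ A
    · simp only [Pi.add_apply, indicator_of_mem h, indicator_of_notMem (notMem_compl_iff.2 h),
        add_zero]
      exact h
    · simp [h]

/-- The essential supremum of the conditional expectations of `G_ρ`, over stopping times `ρ`. -/
theorem NullComplete.exists_essSup_condExp [IsFiniteMeasure P] (hF : NullComplete F P) {t b : ℝ}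
    (htb : t ≤ b) {G : ℝ → Ω → ℝ}
    (hG : ∀ ρ, IsStoppingTimeIn F P t b ρ → Integrable (fun ω => G (ρ ω) ω) P)
    {C : ℝ} (hC : ∀ ρ, IsStoppingTimeIn F P t b ρ → ∫ ω, G (ρ ω) ω ∂P ≤ C) :
    ∃ (u : ℕ → Ω → ℝ) (W : Ω → ℝ), (∀ n, IsStoppingTimeIn F P t b (u n)) ∧ Integrable W P ∧
      (∀ᵐ ω ∂P, Tendsto (fun n => (P[fun ω => G (u n ω) ω | F t]) ω) atTop (𝓝 (W ω))) ∧
      (∀ ρ, IsStoppingTimeIn F P t b ρ → P[fun ω => G (ρ ω) ω | F t] ≤ᵐ[P] W) ∧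
      ∀ A, MeasurableSet[F t] A →
        Tendsto (fun n => ∫ ω in A, G (u n ω) ω ∂P) atTop (𝓝 (∫ ω in A, W ω ∂P)) := by
  have : Nonempty {ρ : Ω → ℝ // IsStoppingTimeIn F P t b ρ} :=
    ⟨⟨_, isStoppingTimeIn_const ⟨le_rfl, htb⟩⟩⟩
  obtain ⟨u, W, hW, hlim, hdom⟩ := exists_essSup_of_directed (P := P)
    (Z := fun ρ : {ρ : Ω → ℝ // IsStoppingTimeIn F P t b ρ} => P[fun ω => G (ρ.1 ω) ω | F t])
    (fun ρ => integrable_condExp) (fun ρ ρ' => by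
      obtain ⟨ρ'', h, h'⟩ := hF.exists_condExp_directed hG ρ.2 ρ'.2
      exact ⟨⟨ρ'', h⟩, h'⟩) (C := C) (fun ρ => by
      rw [integral_condExp (F.le t)]
      exact hC ρ.1 ρ.2)
  refine ⟨fun n => (u n).1, W, fun n => (u n).2, hW, hlim.mono fun ω hω => hω.2,
    fun ρ hρ => hdom ⟨ρ, hρ⟩, fun A hA => ?_⟩
  have h1 := integral_tendsto_of_tendsto_of_monotone (μ := P.restrict A)
    (fun n => (integrable_condExp (m := F t) (μ := P) (f := fun ω => G ((u n).1 ω) ω)).restrict)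
    hW.restrict (ae_restrict_of_ae (hlim.mono fun ω hω => hω.1))
    (ae_restrict_of_ae (hlim.mono fun ω hω => hω.2))
  refine h1.congr fun n => ?_
  exact setIntegral_condExp (F.le t) (hG _ (u n).2) hA

/-- The essential supremum costs nothing in expectation: its integral is a limit of integrals of
members of the family. -/
theorem NullComplete.exists_condExp_le [IsFiniteMeasure P] (hF : NullComplete F P) {t b : ℝ}
    (htb : t ≤ b) {G : ℝ → Ω → ℝ}
    (hG : ∀ ρ, IsStoppingTimeIn F P t b ρ → Integrable (fun ω => G (ρ ω) ω) P)
    {C : ℝ} (hC : ∀ ρ, IsStoppingTimeIn F P t b ρ → ∫ ω, G (ρ ω) ω ∂P ≤ C) :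
    ∃ W : Ω → ℝ, Integrable W P ∧ ∫ ω, W ω ∂P ≤ C ∧
      ∀ ρ, IsStoppingTimeIn F P t b ρ → P[fun ω => G (ρ ω) ω | F t] ≤ᵐ[P] W := by
  obtain ⟨u, W, hu, hW, -, hdom, hint⟩ := hF.exists_essSup_condExp htb hG hC
  refine ⟨W, hW, ?_, hdom⟩
  have := hint univ MeasurableSet.univ
  simp only [setIntegral_univ] at this
  exact le_of_tendsto' this fun n => hC _ (hu n)

theorem IsStoppingTimeIn.measurableSet_eq {a b : ℝ} {τ : Ω → ℝ}
    (h : IsStoppingTimeIn F P a b τ) (v : ℝ) : MeasurableSet[F v] {ω | τ ω = v} := by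
  have := IsStoppingTime.measurableSet_eq h.1 v
  simpa using this

/-- If `|X_t|` is dominated by the essential supremum of `E[G_ρ | F_t]` over the stopping times
`ρ ≥ t`, for all `t`, then the norm of `X` is dominated by the supremum of `E[G_ρ]`. -/
theorem NullComplete.normOne_le_of_condExp_le [IsFiniteMeasure P] (hF : NullComplete F P)
    {a b : ℝ} (hab : a ≤ b) {X : ℝ → Ω → ℝ} (hX : RegularOn F a b X) {G : ℝ → Ω → ℝ}
    (hG : ∀ ρ, IsStoppingTimeIn F P a b ρ → Integrable (fun ω => G (ρ ω) ω) P)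
    {C : ℝ} (hC : ∀ ρ, IsStoppingTimeIn F P a b ρ → ∫ ω, G (ρ ω) ω ∂P ≤ C)
    (hXG : ∀ t ∈ Icc a b, ∀ W : Ω → ℝ, Integrable W P →
      (∀ ρ, IsStoppingTimeIn F P t b ρ → P[fun ω => G (ρ ω) ω | F t] ≤ᵐ[P] W) →
      ∀ᵐ ω ∂P, |X t ω| ≤ W ω) :
    normOne F P a b X ≤ ENNReal.ofReal C := by
  refine hX.normOne_le_of_finite_range hF hab fun θ hθ hθm hfin => ?_
  -- Maximizing sequences and essential suprema are chosen for all `t` at once, with dummy values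
  -- outside `[a,b]`; only the finitely many values of `θ` matter.
  have key : ∀ t : ℝ, ∃ (u : ℕ → Ω → ℝ) (W : Ω → ℝ), t ∈ Icc a b →
      (∀ n, IsStoppingTimeIn F P t b (u n)) ∧ Integrable W P ∧
      (∀ ρ, IsStoppingTimeIn F P t b ρ → P[fun ω => G (ρ ω) ω | F t] ≤ᵐ[P] W) ∧
      ∀ A, MeasurableSet[F t] A →
        Tendsto (fun n => ∫ ω in A, G (u n ω) ω ∂P) atTop (𝓝 (∫ ω in A, W ω ∂P)) := by
    intro t
    by_cases ht : t ∈ Icc a b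
    · obtain ⟨u, W, h1, h2, -, h3, h4⟩ := hF.exists_essSup_condExp ht.2
        (fun ρ hρ => hG ρ (hρ.mono ht.1 le_rfl)) (fun ρ hρ => hC ρ (hρ.mono ht.1 le_rfl))
      exact ⟨u, W, fun _ => ⟨h1, h2, h3, h4⟩⟩
    · exact ⟨fun _ _ => 0, fun _ => 0, fun h => absurd h ht⟩
  choose u W hkey using key
  set V : Finset ℝ := hfin.toFinset
  have hVθ : ∀ ω, θ ω ∈ V := fun ω => hfin.mem_toFinset.2 ⟨ω, rfl⟩
  have hV : ∀ v ∈ V, v ∈ Icc a b := by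
    intro v hv
    obtain ⟨ω, rfl⟩ := hfin.mem_toFinset.1 hv
    exact hθm ω
  set A : ℝ → Set Ω := fun v => {ω | θ ω = v}
  have hA : ∀ v, MeasurableSet[F v] (A v) := hθ.measurableSet_eq
  have hsum : ∀ K : ℝ → Ω → ℝ, (fun ω => K (θ ω) ω) = fun ω => ∑ v ∈ V, (A v).indicator (K v) ω := by
    intro K
    ext ω
    rw [Finset.sum_eq_single (θ ω)]
    · exact (indicator_of_mem (show ω ∈ A (θ ω) from rfl) (K (θ ω))).symm
    · intro v _ hv
      exact indicator_of_notMem (show ω ∉ A v from fun h => hv h.symm) _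
    · exact fun h => absurd (hVθ ω) h
  have hWint : Integrable (fun ω => W (θ ω) ω) P := by
    rw [hsum]
    exact integrable_finsetSum _ fun v hv =>
      (hkey v (hV v hv)).2.1.indicator (F.le v _ (hA v))
  have hXW : ∀ᵐ ω ∂P, |X (θ ω) ω| ≤ W (θ ω) ω := by
    have : ∀ᵐ ω ∂P, ∀ v ∈ V, |X v ω| ≤ W v ω := by
      rw [Filter.eventually_all_finset]
      exact fun v hv => hXG v (hV v hv) (W v) (hkey v (hV v hv)).2.1 (hkey v (hV v hv)).2.2.1
    filter_upwards [this] with ω hω using hω _ (hVθ ω)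
  -- The maximizing sequences are pasted over the events `{θ = v}`. Each `ρ n` is again a stopping
  -- time in `[a,b]`, and `E[G_{ρ n}]` converges to `E[W_θ]`, which is therefore at most `C`.
  set ρ : ℕ → Ω → ℝ := fun n ω => u (θ ω) n ω
  have hρ : ∀ n, IsStoppingTimeIn F P a b (ρ n) := by
    intro n
    have hmem : ∀ᵐ ω ∂P, ∀ v ∈ V, u v n ω ∈ Icc v b := by
      rw [Filter.eventually_all_finset]
      exact fun v hv => ((hkey v (hV v hv)).1 n).2
    refine isStoppingTimeIn_iff.2 ⟨fun s => ?_, ?_⟩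
    · have : {ω | ρ n ω ≤ s} = ⋃ v ∈ V, A v ∩ {ω | u v n ω ≤ s} := by
        ext ω
        simp only [mem_ofPred_eq, mem_iUnion, mem_inter_iff, A, ρ]
        constructor
        · exact fun h => ⟨θ ω, hVθ ω, rfl, h⟩
        · rintro ⟨v, -, h1, h2⟩
          rwa [h1]
      rw [this]
      refine Finset.measurableSet_biUnion _ fun v hv => ?_
      by_cases hvs : v ≤ s
      · exact (F.mono hvs _ (hA v)).inter (((hkey v (hV v hv)).1 n).measurableSet_le s)
      -- For `s < v` the event is null, since `u v n ≥ v` almost surely.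
      · refine hF s _ (measure_mono_null ?_ (ae_iff.1 ((hkey v (hV v hv)).1 n).2))
        rintro ω ⟨-, h⟩ hc
        exact hvs (hc.1.trans h)
    · filter_upwards [hmem] with ω hω
      exact ⟨(hV _ (hVθ ω)).1.trans (hω _ (hVθ ω)).1, (hω _ (hVθ ω)).2⟩
  have hint : ∀ K : ℝ → Ω → ℝ, (∀ v ∈ V, Integrable (K v) P) →
      ∫ ω, K (θ ω) ω ∂P = ∑ v ∈ V, ∫ ω in A v, K v ω ∂P := by
    intro K hK
    rw [hsum, integral_finsetSum _ fun v hv => (hK v hv).indicator (F.le v _ (hA v))]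
    exact Finset.sum_congr rfl fun v _ => integral_indicator (F.le v _ (hA v))
  have hlim : Tendsto (fun n => ∫ ω, G (ρ n ω) ω ∂P) atTop (𝓝 (∫ ω, W (θ ω) ω ∂P)) := by
    rw [hint W fun v hv => (hkey v (hV v hv)).2.1]
    have h1 : Tendsto (fun n => ∑ v ∈ V, ∫ ω in A v, G (u v n ω) ω ∂P) atTop
        (𝓝 (∑ v ∈ V, ∫ ω in A v, W v ω ∂P)) :=
      tendsto_finsetSum _ fun v hv => (hkey v (hV v hv)).2.2.2 _ (hA v)
    refine h1.congr fun n => ?_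
    exact (hint (fun v ω => G (u v n ω) ω) fun v hv =>
      hG _ (((hkey v (hV v hv)).1 n).mono (hV v hv).1 le_rfl)).symm
  calc ∫⁻ ω, ‖X (θ ω) ω‖ₑ ∂P ≤ ∫⁻ ω, ENNReal.ofReal (W (θ ω) ω) ∂P := by
        refine lintegral_mono_ae ?_
        filter_upwards [hXW] with ω hω
        rw [Real.enorm_eq_ofReal_abs]
        exact ENNReal.ofReal_le_ofReal hω
    _ = ENNReal.ofReal (∫ ω, W (θ ω) ω ∂P) :=
        (ofReal_integral_eq_lintegral_ofReal hWint
          (hXW.mono fun ω hω => (abs_nonneg _).trans hω)).symm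
    _ ≤ ENNReal.ofReal C :=
        ENNReal.ofReal_le_ofReal (le_of_tendsto' hlim fun n => hC _ (hρ n))

end EssSup

end MFDRBSDE

/-! ### Continuous versions of martingales: stability under sums and `L¹` limits. -/

namespace MFDRBSDE

open Filter Topology

/-- Induction principle for integrable functions: multiples of indicators, sums, limits. -/
theorem integrable_induction {Ω : Type*} {m : MeasurableSpace Ω} {μ : Measure Ω}
    {Q : (Ω → ℝ) → Prop}
    (ind : ∀ (c : ℝ) (A : Set Ω), MeasurableSet A → Q fun ω => c * A.indicator 1 ω)
    (hadd : ∀ f g, Q f → Q g → Q (f + g))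
    (lim : ∀ (f : ℕ → Ω → ℝ) (g : Ω → ℝ), (∀ n, Q (f n)) → Measurable g → Integrable g μ →
      Tendsto (fun n => ∫⁻ ω, ‖f n ω - g ω‖ₑ ∂μ) atTop (𝓝 0) → Q g)
    (ζ : Ω → ℝ) (hζm : Measurable ζ) (hζ : Integrable ζ μ) : Q ζ := by
  have hsimple : ∀ f : SimpleFunc Ω ℝ, Q f := by
    intro f
    induction f using SimpleFunc.induction with
    | const c hs =>
      convert ind c _ hs using 1
      ext ω
      simp [Set.piecewise, Set.indicator]
    | add _ hf hg => exact hadd _ _ hf hg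
  exact lim _ ζ (fun n => hsimple (SimpleFunc.approxOn ζ hζm (range ζ ∪ {0}) 0 (by simp) n)) hζm hζ
    (SimpleFunc.tendsto_approxOn_range_L1_enorm hζm hζ)

theorem measurable_const_mul_indicator {Ω : Type*} {m : MeasurableSpace Ω} (c : ℝ) {A : Set Ω}
    (hA : MeasurableSet[m] A) : Measurable[m] fun ω => c * A.indicator 1 ω :=
  (measurable_one.indicator hA).const_mul c

theorem lintegral_enorm_trim {Ω : Type*} {m0 m : MeasurableSpace Ω} {μ : Measure[m0] Ω}
    (hm : m ≤ m0) {f : Ω → ℝ} (hf : Measurable[m] f) :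
    ∫⁻ ω, ‖f ω‖ₑ ∂(μ.trim hm) = ∫⁻ ω, ‖f ω‖ₑ ∂μ :=
  lintegral_trim hm hf.enorm

section ContinuousVersion

variable {Ω : Type*} [m : MeasurableSpace Ω] {F : Filtration ℝ m} {P : Measure Ω}

/-- The martingale `E[ζ | F_t]` has a version with continuous paths on `[a,b]`. -/
def HasContinuousVersion (F : Filtration ℝ m) (P : Measure Ω) (a b : ℝ) (ζ : Ω → ℝ) : Prop :=
  ∃ M, RegularOn F a b M ∧ ∀ t ∈ Icc a b, M t =ᵐ[P] P[ζ | F t]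

theorem HasContinuousVersion.congr {a b : ℝ} {ζ η : Ω → ℝ}
    (h : HasContinuousVersion F P a b ζ) (hζ : ζ =ᵐ[P] η) : HasContinuousVersion F P a b η :=
  let ⟨M, hM, h⟩ := h
  ⟨M, hM, fun t ht => (h t ht).trans (condExp_congr_ae hζ)⟩

theorem HasContinuousVersion.add {a b : ℝ} {ζ η : Ω → ℝ} (h : HasContinuousVersion F P a b ζ)
    (h' : HasContinuousVersion F P a b η) (hζ : Integrable ζ P) (hη : Integrable η P) :
    HasContinuousVersion F P a b (ζ + η) :=
  let ⟨_, hM, h⟩ := h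
  let ⟨_, hM', h'⟩ := h'
  ⟨_, hM.add hM', fun t ht => ((h t ht).add (h' t ht)).trans (condExp_add hζ hη _).symm⟩

theorem HasContinuousVersion.const_mul {a b : ℝ} {ζ : Ω → ℝ}
    (h : HasContinuousVersion F P a b ζ) (c : ℝ) :
    HasContinuousVersion F P a b fun ω => c * ζ ω :=
  let ⟨M, hM, h⟩ := h
  ⟨fun t ω => c * M t ω, hM.comp (by fun_prop), fun t ht => by
    have h1 := condExp_smul (μ := P) c ζ (F t)
    filter_upwards [h t ht, h1] with ω h2 h3
    rw [h2]
    exact h3.symm⟩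

theorem hasContinuousVersion_const [IsFiniteMeasure P] (a b c : ℝ) :
    HasContinuousVersion F P a b fun _ => c :=
  ⟨fun _ _ => c, regularOn_of_deterministic continuous_const, fun t _ => by
    rw [condExp_const (F.le t)]⟩

theorem HasContinuousVersion.mono {a b a' b' : ℝ} {ζ : Ω → ℝ}
    (h : HasContinuousVersion F P a b ζ) (hI : Icc a' b' ⊆ Icc a b) :
    HasContinuousVersion F P a' b' ζ :=
  let ⟨M, hM, h⟩ := h
  ⟨M, hM.mono hI, fun t ht => h t (hI ht)⟩

/-- Doob's inequality in the norm `normOne`. -/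
theorem NullComplete.normOne_sub_le_of_condExp [IsFiniteMeasure P] (hF : NullComplete F P)
    {a b : ℝ} (hab : a ≤ b) {M N : ℝ → Ω → ℝ} (hM : RegularOn F a b M) (hN : RegularOn F a b N)
    {ζ η : Ω → ℝ} (hζ : Integrable ζ P) (hη : Integrable η P)
    (hMζ : ∀ t ∈ Icc a b, M t =ᵐ[P] P[ζ | F t]) (hNη : ∀ t ∈ Icc a b, N t =ᵐ[P] P[η | F t]) :
    normOne F P a b (fun t ω => M t ω - N t ω) ≤ ENNReal.ofReal (∫ ω, |ζ ω - η ω| ∂P) := by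
  -- Here `G` is constant in time, so every `E[G_ρ]` equals `E|ζ - η|`; the pointwise hypothesis is
  -- the conditional Jensen inequality.
  refine hF.normOne_le_of_condExp_le hab (hM.sub hN) (G := fun _ ω => |ζ ω - η ω|)
    (fun ρ _ => (hζ.sub hη).abs) (fun ρ _ => le_rfl) fun t ht W _ hW => ?_
  have h1 := hW (fun _ => t) (isStoppingTimeIn_const ⟨le_rfl, ht.2⟩)
  have h2 : P[fun ω => ζ ω - η ω | F t] =ᵐ[P] P[ζ | F t] - P[η | F t] := condExp_sub hζ hη _
  have h3 : |P[fun ω => ζ ω - η ω | F t]| ≤ᵐ[P] P[fun ω => |ζ ω - η ω| | F t] :=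
    abs_condExp_ae_le_condExp_abs _
  filter_upwards [h1, h2, h3, hMζ t ht, hNη t ht] with ω h1 h2 h3 h4 h5
  rw [Pi.abs_apply, h2, Pi.sub_apply] at h3
  rw [h4, h5]
  exact h3.trans h1

/-- Doob's inequality makes the continuous versions Cauchy in `‖·‖₁`, and completeness yields a
continuous limit. It is identified at each time because conditional expectation contracts `L¹`. -/
theorem NullComplete.hasContinuousVersion_of_tendsto [IsFiniteMeasure P] (hF : NullComplete F P)
    {a b : ℝ} (hab : a < b) {ζ : ℕ → Ω → ℝ} {η : Ω → ℝ} (hζ : ∀ n, Integrable (ζ n) P)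
    (hη : Integrable η P) (h : ∀ n, HasContinuousVersion F P a b (ζ n))
    (hlim : Tendsto (fun n => ∫ ω, |ζ n ω - η ω| ∂P) atTop (𝓝 0)) :
    HasContinuousVersion F P a b η := by
  choose M hM hMζ using h
  have hle : ∀ n k, ∫ ω, |ζ n ω - ζ k ω| ∂P ≤ ∫ ω, |ζ n ω - η ω| ∂P + ∫ ω, |ζ k ω - η ω| ∂P := by
    intro n k
    have h0 : ∫ ω, (|ζ n ω - η ω| + |ζ k ω - η ω|) ∂P = _ :=
      integral_add ((hζ n).sub hη).abs ((hζ k).sub hη).abs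
    refine le_trans ?_ h0.le
    refine integral_mono ((hζ n).sub (hζ k)).abs
      (((hζ n).sub hη).abs.add ((hζ k).sub hη).abs) fun ω => ?_
    have h1 := abs_sub_le (ζ n ω) (η ω) (ζ k ω)
    rwa [abs_sub_comm (η ω)] at h1
  obtain ⟨Y, hY, hYlim⟩ := hF.exists_tendsto_normOne hab hM fun ε hε => by
    obtain ⟨δ, hδ, hδε⟩ : ∃ δ : ℝ, 0 < δ ∧ ENNReal.ofReal δ ≤ ε := by
      by_cases h : ε = ∞
      · exact ⟨1, one_pos, by simp [h]⟩
      · exact ⟨ε.toReal, ENNReal.toReal_pos hε.ne' h, ENNReal.ofReal_toReal_le⟩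
    obtain ⟨N, hN⟩ := eventually_atTop.1 (hlim.eventually (gt_mem_nhds (half_pos hδ)))
    refine ⟨N, fun n hn k hk => ?_⟩
    refine (hF.normOne_sub_le_of_condExp hab.le (hM n) (hM k) (hζ n) (hζ k) (hMζ n) (hMζ k)).trans
      ((ENNReal.ofReal_le_ofReal ?_).trans hδε)
    linarith [hle n k, hN n hn, hN k hk]
  refine ⟨Y, hY, fun t ht => ?_⟩
  have hbound : ∀ n, ∫⁻ ω, ‖Y t ω - (P[η | F t]) ω‖ₑ ∂P ≤
      normOne F P a b (fun t ω => M n t ω - Y t ω) + ENNReal.ofReal (∫ ω, |ζ n ω - η ω| ∂P) := by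
    intro n
    have h1 : ∫⁻ ω, ‖M n t ω - (P[η | F t]) ω‖ₑ ∂P ≤ ENNReal.ofReal (∫ ω, |ζ n ω - η ω| ∂P) := by
      have h2 : (fun ω => M n t ω - (P[η | F t]) ω) =ᵐ[P] P[ζ n - η | F t] :=
        ((hMζ n t ht).sub EventuallyEq.rfl).trans (condExp_sub (hζ n) hη _).symm
      have h3 : ∫⁻ ω, ‖M n t ω - (P[η | F t]) ω‖ₑ ∂P = ∫⁻ ω, ‖(P[ζ n - η | F t]) ω‖ₑ ∂P :=
        lintegral_congr_ae (h2.fun_comp (fun x => ‖x‖ₑ))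
      rw [h3, ← ofReal_integral_norm_eq_lintegral_enorm integrable_condExp]
      exact ENNReal.ofReal_le_ofReal (integral_abs_condExp_le _)
    calc ∫⁻ ω, ‖Y t ω - (P[η | F t]) ω‖ₑ ∂P
        ≤ ∫⁻ ω, ‖M n t ω - Y t ω‖ₑ + ‖M n t ω - (P[η | F t]) ω‖ₑ ∂P := by
          refine lintegral_mono fun ω => ?_
          have : Y t ω - (P[η | F t]) ω =
              -(M n t ω - Y t ω) + (M n t ω - (P[η | F t]) ω) := by ring
          rw [this, ← enorm_neg (M n t ω - Y t ω)]
          exact enorm_add_le _ _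
      _ = ∫⁻ ω, ‖M n t ω - Y t ω‖ₑ ∂P + ∫⁻ ω, ‖M n t ω - (P[η | F t]) ω‖ₑ ∂P :=
          lintegral_add_left (((hM n).measurable t).sub (hY.measurable t)).enorm _
      _ ≤ _ := add_le_add (lintegral_le_normOne (fun t ω => M n t ω - Y t ω)
          (isStoppingTimeIn_const ht)) h1
  have h0 : ∫⁻ ω, ‖Y t ω - (P[η | F t]) ω‖ₑ ∂P = 0 := by
    have h4 := hYlim.add (ENNReal.tendsto_ofReal hlim)
    rw [ENNReal.ofReal_zero, add_zero] at h4
    exact le_antisymm (ge_of_tendsto' h4 hbound) zero_le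
  have h5 := (lintegral_eq_zero_iff' ((hY.measurable t).aemeasurable.sub
    integrable_condExp.aemeasurable).enorm).1 h0
  filter_upwards [h5] with ω hω
  exact sub_eq_zero.1 (enorm_eq_zero.1 hω)

/-- If the indicators of the sets in `F_b` have continuous martingales, so do all integrable
`F_b`-measurable functions. -/
theorem NullComplete.hasContinuousVersion_of_indicator [IsFiniteMeasure P] (hF : NullComplete F P)
    {a b : ℝ} (hab : a < b)
    (h : ∀ A, MeasurableSet[F b] A → HasContinuousVersion F P a b (A.indicator 1))
    {ζ : Ω → ℝ} (hζm : Measurable[F b] ζ) (hζ : Integrable ζ P) :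
    HasContinuousVersion F P a b ζ := by
  have hm := F.le b
  -- The induction runs over the trimmed measure, so that the approximating simple functions are `F
  -- b`-measurable.
  refine (integrable_induction (m := F b) (μ := P.trim hm)
    (Q := fun f => Measurable[F b] f ∧ Integrable f P ∧ HasContinuousVersion F P a b f)
    (fun c A hA => ⟨?_, ?_, (h A hA).const_mul c⟩)
    (fun f g hf hg => ⟨hf.1.add hg.1, hf.2.1.add hg.2.1, hf.2.2.add hg.2.2 hf.2.1 hg.2.1⟩)
    (fun f g hf hgm hgi hlim => ?_) ζ hζm (hζ.trim hm hζm.stronglyMeasurable)).2.2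
  · exact measurable_const_mul_indicator c hA
  · exact ((integrable_const (1 : ℝ)).indicator (F.le b _ hA)).const_mul c
  · have hg : Integrable g P := integrable_of_integrable_trim hm hgi
    refine ⟨hgm, hg, hF.hasContinuousVersion_of_tendsto hab (fun n => (hf n).2.1) hg
      (fun n => (hf n).2.2) ?_⟩
    have h1 : ∀ n, ∫ ω, |f n ω - g ω| ∂P = (∫⁻ ω, ‖f n ω - g ω‖ₑ ∂(P.trim hm)).toReal := by
      intro n
      have h2 : Measurable[F b] fun ω => f n ω - g ω := (hf n).1.sub hgm
      have h3 : ∫⁻ ω, ‖f n ω - g ω‖ₑ ∂(P.trim hm) = ∫⁻ ω, ‖f n ω - g ω‖ₑ ∂P :=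
        lintegral_enorm_trim hm h2
      have h4 := ofReal_integral_norm_eq_lintegral_enorm ((hf n).2.1.sub hg)
      rw [h3]
      refine (ENNReal.toReal_ofReal (integral_nonneg fun ω => abs_nonneg _)).symm.trans ?_
      exact congrArg ENNReal.toReal h4
    simp_rw [h1]
    exact (ENNReal.tendsto_toReal ENNReal.zero_ne_top).comp hlim

end ContinuousVersion

end MFDRBSDE

/-! ### The completed Brownian filtration and the independence of future increments. -/

namespace MFDRBSDE

open Filter Topology

theorem comap_le_of_isClosed {Ω E : Type*} [TopologicalSpace E] [MeasurableSpace E] [BorelSpace E]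
    {m : MeasurableSpace Ω} {f : Ω → E} (h : ∀ C, IsClosed C → MeasurableSet[m] (f ⁻¹' C)) :
    MeasurableSpace.comap f inferInstance ≤ m :=
  (measurable_of_isClosed h).comap_le

theorem indep_generateFrom_left {Ω : Type*} {m2 m0 : MeasurableSpace Ω} {μ : Measure Ω}
    [IsProbabilityMeasure μ] {p : Set (Set Ω)} (hpm : ∀ A ∈ p, MeasurableSet A)
    (hp : IsPiSystem p) (hm2 : m2 ≤ m0)
    (h : ∀ A ∈ p, ∀ D, MeasurableSet[m2] D → μ (A ∩ D) = μ A * μ D) :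
    Indep (MeasurableSpace.generateFrom p) m2 μ :=
  IndepSets.indep (p2 := {D | MeasurableSet[m2] D}) (MeasurableSpace.generateFrom_le hpm) hm2 hp
    (@MeasurableSpace.isPiSystem_measurableSet Ω m2) rfl
    (@MeasurableSpace.generateFrom_measurableSet Ω m2).symm ((IndepSets_iff _ _ _).2 fun A D hA hD =>
      h A hA D hD)

section Brownian

variable {Ω : Type*} [m : MeasurableSpace Ω] {P : Measure Ω} {T : ℝ} {d : ℕ}
  {B : Icc (0 : ℝ) T → Ω → (Fin d → ℝ)}

/-- The filtration is generated with measurable null sets only; completeness of `P` makes every null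
set one of these. -/
theorem nullComplete_completedFiltration [P.IsComplete] (hB : ∀ t, Measurable (B t)) :
    NullComplete (completedFiltration P B hB) P := fun _ N hN =>
  le_sup_right (a := ⨆ (s : Icc (0 : ℝ) T) (_ : (s : ℝ) ≤ _),
    MeasurableSpace.comap (B s) inferInstance) N
    (MeasurableSpace.measurableSet_generateFrom ⟨Measure.IsComplete.out' N hN, hN⟩)

theorem measurable_completedFiltration (hB : ∀ t, Measurable (B t)) {s : Icc (0 : ℝ) T} {t : ℝ}
    (hst : s ≤ t) : Measurable[completedFiltration P B hB t] (B s) :=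
  Measurable.of_comap_le (le_trans (le_iSup₂ (f := fun (s : Icc (0 : ℝ) T) (_ : (s : ℝ) ≤ t) =>
    MeasurableSpace.comap (B s) inferInstance) s hst) le_sup_left)

/-- The events determined, up to null sets, by the values of `B` in closed sets at finitely many
times before `t`. -/
def cylinders (P : Measure Ω) (B : Icc (0 : ℝ) T → Ω → (Fin d → ℝ)) (t : Icc (0 : ℝ) T) :
    Set (Set Ω) :=
  {A | MeasurableSet A ∧ ∃ (s : Finset (Icc (0 : ℝ) T)) (C : Icc (0 : ℝ) T → Set (Fin d → ℝ)),
    (∀ j ∈ s, j ≤ t) ∧ (∀ j, IsClosed (C j)) ∧ A =ᵐ[P] ⋂ j ∈ s, B j ⁻¹' C j}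

theorem isPiSystem_cylinders (t : Icc (0 : ℝ) T) : IsPiSystem (cylinders P B t) := by
  classical
  rintro A ⟨hA, s, C, hs, hC, hAC⟩ A' ⟨hA', s', C', hs', hC', hAC'⟩ -
  -- Times constrained by only one of the two cylinders receive the trivial constraint `univ` from
  -- the other.
  refine ⟨hA.inter hA', s ∪ s', fun j => (if j ∈ s then C j else univ) ∩
    (if j ∈ s' then C' j else univ), fun j hj => (Finset.mem_union.1 hj).elim (hs j) (hs' j),
    fun j => IsClosed.inter ?_ ?_, ?_⟩
  · split_ifs
    exacts [hC j, isClosed_univ]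
  · split_ifs
    exacts [hC' j, isClosed_univ]
  · refine (hAC.inter hAC').trans (Eventually.of_forall fun ω => propext ?_)
    change (ω ∈ (⋂ j ∈ s, B j ⁻¹' C j) ∩ ⋂ j ∈ s', B j ⁻¹' C' j) ↔ ω ∈ (⋂ j ∈ s ∪ s', _)
    simp only [mem_inter_iff, mem_iInter, mem_preimage, Finset.mem_union]
    constructor
    · rintro ⟨h1, h2⟩ j -
      refine ⟨?_, ?_⟩
      · split_ifs with h
        exacts [h1 j h, mem_univ _]
      · split_ifs with h
        exacts [h2 j h, mem_univ _]
    · intro h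
      refine ⟨fun j hj => ?_, fun j hj => ?_⟩
      · have := (h j (Or.inl hj)).1
        rwa [if_pos hj] at this
      · have := (h j (Or.inr hj)).2
        rwa [if_pos hj] at this

/-- Closed sets generate the Borel sets, and a null set is itself a cylinder, with the empty set as
constraint. -/
theorem completedFiltration_le_cylinders (hB : ∀ t, Measurable (B t)) (t : Icc (0 : ℝ) T) :
    completedFiltration P B hB t ≤ MeasurableSpace.generateFrom (cylinders P B t) := by
  refine sup_le (iSup₂_le fun s hs => ?_) (MeasurableSpace.generateFrom_le fun N hN => ?_)
  · refine comap_le_of_isClosed fun C hC => ?_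
    refine MeasurableSpace.measurableSet_generateFrom
      ⟨hB s hC.measurableSet, {s}, fun _ => C, fun j hj => ?_, fun _ => hC, ?_⟩
    · rw [Finset.mem_singleton.1 hj]; exact hs
    · simp only [Finset.mem_singleton, iInter_iInter_eq_left]; exact EventuallyEq.rfl
  · refine MeasurableSpace.measurableSet_generateFrom
      ⟨hN.1, {t}, fun _ => ∅, fun j hj => ?_, fun _ => isClosed_empty, ?_⟩
    · rw [Finset.mem_singleton.1 hj]
    · simpa using hN.2

/-- The increments of a Brownian motion after `t` are independent of the completed filtration. -/
theorem IsBrownianMotion.indep [IsProbabilityMeasure P] (hB : IsBrownianMotion P B)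
    {t u : Icc (0 : ℝ) T} (htu : t ≤ u) :
    Indep (completedFiltration P B hB.measurable t)
      (MeasurableSpace.comap (fun ω => B u ω - B t ω) inferInstance) P := by
  have hZ : Measurable fun ω => B u ω - B t ω := (hB.measurable u).sub (hB.measurable t)
  have key : ∀ A ∈ cylinders P B t, ∀ D, MeasurableSet D →
      P (A ∩ (fun ω => B u ω - B t ω) ⁻¹' D) = P A * P ((fun ω => B u ω - B t ω) ⁻¹' D) := by
    rintro A ⟨hA, s, C, hs, hC, hAC⟩ D hD
    have hT : (0 : ℝ) ≤ T := t.2.1.trans t.2.2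
    set zero : Icc (0 : ℝ) T := ⟨0, le_rfl, hT⟩
    -- Adding the times `0` and `t` makes every `B j - B 0`, `j ∈ s`, a sum of increments of the
    -- grid, none of which reaches beyond `t`.
    set S : Finset (Icc (0 : ℝ) T) := insert zero (insert t s)
    have hSt : ∀ j ∈ S, j ≤ t := by
      intro j hj
      rcases Finset.mem_insert.1 hj with rfl | hj
      · exact t.2.1
      rcases Finset.mem_insert.1 hj with rfl | hj
      exacts [le_rfl, hs j hj]
    obtain ⟨n, hn⟩ : ∃ n, S.card = n + 1 :=
      Nat.exists_eq_succ_of_ne_zero (Finset.card_pos.2 ⟨zero, Finset.mem_insert_self _ _⟩).ne'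
    set e := S.orderEmbOfFin hn
    have heS : ∀ i, e i ∈ S := fun i => S.orderEmbOfFin_mem hn i
    have hes : ∀ j ∈ S, ∃ i, e i = j := fun j hj => by
      have : j ∈ Set.range e := by rw [Finset.range_orderEmbOfFin]; exact hj
      exact this
    -- The grid in increasing order from `0` to `t`, followed by `u` forever. Increments with index
    -- below `n` describe the past, and the increment with index `n` is `B u - B t`.
    set τ : ℕ → Icc (0 : ℝ) T := fun k => if h : k < n + 1 then e ⟨k, h⟩ else u
    have hτmono : Monotone τ := by
      refine monotone_nat_of_le_succ fun k => ?_
      by_cases h1 : k + 1 < n + 1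
      · have h2 : k < n + 1 := by omega
        simp only [τ, h1, h2, dif_pos]
        exact e.monotone (Fin.mk_le_mk.2 (Nat.le_succ k))
      · by_cases h2 : k < n + 1
        · simp only [τ, h1, h2, dif_pos, dif_neg, not_false_eq_true]
          exact (hSt _ (heS _)).trans htu
        · simp only [τ, h1, h2, dif_neg, not_false_eq_true, le_refl]
    have hτ0 : τ 0 = zero := by
      obtain ⟨i, hi⟩ := hes zero (Finset.mem_insert_self _ _)
      have h1 : τ 0 = e 0 := by simp [τ]
      refine le_antisymm ?_ (Subtype.coe_le_coe.1 (τ 0).2.1)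
      rw [h1, ← hi]
      exact e.monotone (Fin.zero_le i)
    have hτn : τ n = t := by
      obtain ⟨i, hi⟩ := hes t (Finset.mem_insert_of_mem (Finset.mem_insert_self _ _))
      have h1 : τ n = e (Fin.last n) := by simp [τ, Fin.last]
      refine le_antisymm ?_ ?_
      · rw [h1]; exact hSt _ (heS _)
      · rw [h1, ← hi]; exact e.monotone (Fin.le_last i)
    have hτn1 : τ (n + 1) = u := by simp [τ]
    set mΔ : ℕ → MeasurableSpace Ω := fun i =>
      MeasurableSpace.comap (fun ω => B (τ (i + 1)) ω - B (τ i) ω) inferInstance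
    have hmΔ : ∀ i, mΔ i ≤ m := fun i =>
      ((hB.measurable _).sub (hB.measurable _)).comap_le
    have hind : iIndep mΔ P := (iIndepFun_iff_iIndep _ _ _).1 (hB.indep_increments.nat hτmono)
    have hdis : Disjoint (Set.Iio n) {n} := by simp
    have hind2 := indep_iSup_of_disjoint hmΔ hind hdis
    have hmeas : ∀ k ≤ n,
        Measurable[⨆ i ∈ Set.Iio n, mΔ i] fun ω => B (τ k) ω - B (τ 0) ω := by
      intro k
      induction k with
      | zero => intro _; simp only [sub_self]; exact measurable_const
      | succ k ih =>
        intro hk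
        have h1 : Measurable[⨆ i ∈ Set.Iio n, mΔ i] fun ω => B (τ (k + 1)) ω - B (τ k) ω :=
          Measurable.of_comap_le (le_iSup₂ (f := fun i (_ : i ∈ Set.Iio n) => mΔ i) k
            (Set.mem_Iio.2 (by omega)))
        convert h1.add (ih (by omega)) using 1
        ext ω : 1
        simp
    have hmeas' : ∀ j ∈ s, Measurable[⨆ i ∈ Set.Iio n, mΔ i] fun ω => B j ω - B (τ 0) ω := by
      intro j hj
      obtain ⟨i, hi⟩ := hes j (Finset.mem_insert_of_mem (Finset.mem_insert_of_mem hj))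
      have h1 : τ i = j := (dif_pos i.2).trans hi
      rw [← h1]
      exact hmeas i (Nat.lt_succ_iff.1 i.2)
    -- Since `B 0 = 0` almost surely, the cylinder agrees up to a null set with an event in the past
    -- increments.
    set A' : Set Ω := ⋂ j ∈ s, (fun ω => B j ω - B (τ 0) ω) ⁻¹' C j
    have hA' : MeasurableSet[⨆ i ∈ Set.Iio n, mΔ i] A' :=
      Finset.measurableSet_biInter _ fun j hj => hmeas' j hj (hC j).measurableSet
    have hAA' : A =ᵐ[P] A' := by
      refine hAC.trans ?_
      filter_upwards [hB.start_zero (τ 0) (by rw [hτ0])] with ω hω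
      refine propext ?_
      change ω ∈ (⋂ j ∈ s, B j ⁻¹' C j) ↔ ω ∈ A'
      simp [A', hω]
    have hD' : MeasurableSet[⨆ i ∈ ({n} : Set ℕ), mΔ i]
        ((fun ω => B u ω - B t ω) ⁻¹' D) := by
      refine le_iSup₂ (f := fun i (_ : i ∈ ({n} : Set ℕ)) => mΔ i) n rfl _ ⟨D, hD, ?_⟩
      rw [hτn1, hτn]
    have h2 : (A ∩ (fun ω => B u ω - B t ω) ⁻¹' D : Set Ω) =ᵐ[P]
        (A' ∩ (fun ω => B u ω - B t ω) ⁻¹' D : Set Ω) := hAA'.inter EventuallyEq.rfl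
    rw [measure_congr h2, measure_congr hAA']
    exact (Indep_iff _ _ _).1 hind2 _ _ hA' hD'
  refine indep_of_indep_of_le_left (indep_generateFrom_left (fun A hA => hA.1)
    (isPiSystem_cylinders t) hZ.comap_le fun A hA D' hD' => ?_)
    (completedFiltration_le_cylinders hB.measurable t)
  obtain ⟨D, hD, rfl⟩ := hD'
  exact key A hA D hD

end Brownian

end MFDRBSDE

/-! ### Markov property and continuous martingales for products of functions of `B`. -/

namespace MFDRBSDE

open Filter Topology

section BrownianMartingales

variable {Ω : Type*} [m : MeasurableSpace Ω] {P : Measure Ω} {T : ℝ} {d : ℕ}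
  {B : Icc (0 : ℝ) T → Ω → (Fin d → ℝ)}

/-- The mean of `φ (x + B_u - B_t)`. -/
noncomputable def shiftMean (P : Measure Ω) (B : Icc (0 : ℝ) T → Ω → (Fin d → ℝ))
    (φ : (Fin d → ℝ) → ℝ) (u t : Icc (0 : ℝ) T) (x : Fin d → ℝ) : ℝ :=
  ∫ ω, φ (x + (B u ω - B t ω)) ∂P

theorem norm_le_one_of_mem {x : ℝ} (hx : x ∈ Icc (0 : ℝ) 1) : ‖x‖ ≤ 1 := by
  rw [Real.norm_eq_abs, abs_le]; exact ⟨by linarith [hx.1], hx.2⟩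

/-- Dominated convergence along continuous paths. Joint continuity is what makes `t ↦ shiftMean P B
φ u t (B t)`, the candidate martingale, continuous. -/
theorem IsBrownianMotion.continuous_shiftMean [IsProbabilityMeasure P] (hB : IsBrownianMotion P B)
    {φ : (Fin d → ℝ) → ℝ} (hφ : Continuous φ) (hφ1 : ∀ x, φ x ∈ Icc (0 : ℝ) 1)
    (u : Icc (0 : ℝ) T) :
    Continuous fun p : Icc (0 : ℝ) T × (Fin d → ℝ) => shiftMean P B φ u p.1 p.2 := by
  refine continuous_of_dominated (bound := fun _ => 1) (fun p => ?_)
    (fun p => Eventually.of_forall fun ω => norm_le_one_of_mem (hφ1 _)) (integrable_const _) ?_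
  · have h1 := hB.measurable u
    have h2 := hB.measurable p.1
    exact (hφ.measurable.comp ((h1.sub h2).const_add p.2)).aestronglyMeasurable
  · filter_upwards [hB.continuous_paths] with ω hω
    exact hφ.comp (continuous_snd.add (continuous_const.sub (hω.comp continuous_fst)))

theorem shiftMean_mem [IsProbabilityMeasure P] (hB : IsBrownianMotion P B)
    {φ : (Fin d → ℝ) → ℝ} (hφ : Continuous φ) (hφ1 : ∀ x, φ x ∈ Icc (0 : ℝ) 1)
    (u t : Icc (0 : ℝ) T) (x : Fin d → ℝ) : shiftMean P B φ u t x ∈ Icc (0 : ℝ) 1 := by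
  refine ⟨integral_nonneg fun ω => (hφ1 _).1, ?_⟩
  have h : Integrable (fun ω => φ (x + (B u ω - B t ω))) P := by
    refine Integrable.of_bound
      (hφ.measurable.comp (((hB.measurable u).sub (hB.measurable t)).const_add x)).aestronglyMeasurable
      1 (Eventually.of_forall fun ω => norm_le_one_of_mem (hφ1 _))
  calc shiftMean P B φ u t x ≤ ∫ _, (1 : ℝ) ∂P :=
        integral_mono h (integrable_const _) fun ω => (hφ1 _).2
    _ = 1 := by simp

theorem shiftMean_self [IsProbabilityMeasure P] (φ : (Fin d → ℝ) → ℝ) (u : Icc (0 : ℝ) T)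
    (x : Fin d → ℝ) : shiftMean P B φ u u x = φ x := by
  simp [shiftMean]

theorem measurable_indicator_prodMk {Ω E : Type*} [MeasurableSpace E] {m : MeasurableSpace Ω}
    {A : Set Ω} (hA : MeasurableSet[m] A) {f : Ω → E} (hf : Measurable[m] f) :
    Measurable[m] fun ω => ((A.indicator 1 ω : ℝ), f ω) :=
  (measurable_one.indicator hA).prodMk hf

/-- The Markov property of Brownian motion. -/
theorem IsBrownianMotion.condExp_eq [IsProbabilityMeasure P] (hB : IsBrownianMotion P B)
    {φ : (Fin d → ℝ) → ℝ} (hφ : Continuous φ) (hφ1 : ∀ x, φ x ∈ Icc (0 : ℝ) 1)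
    {t u : Icc (0 : ℝ) T} (htu : t ≤ u) :
    (fun ω => shiftMean P B φ u t (B t ω)) =ᵐ[P]
      P[fun ω => φ (B u ω) | completedFiltration P B hB.measurable t] := by
  set F := completedFiltration P B hB.measurable
  have hw : Measurable (shiftMean P B φ u t) :=
    ((hB.continuous_shiftMean hφ hφ1 u).comp (Continuous.prodMk_right t)).measurable
  have hBt : Measurable[F t] (B t) := measurable_completedFiltration hB.measurable le_rfl
  have hwm : Measurable[F t] fun ω => shiftMean P B φ u t (B t ω) := hw.comp hBt
  have hφint : Integrable (fun ω => φ (B u ω)) P :=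
    Integrable.of_bound (hφ.measurable.comp (hB.measurable u)).aestronglyMeasurable
      1 (Eventually.of_forall fun ω => norm_le_one_of_mem (hφ1 _))
  have hwint : Integrable (fun ω => shiftMean P B φ u t (B t ω)) P :=
    Integrable.of_bound (hw.comp (hB.measurable t)).aestronglyMeasurable
      1 (Eventually.of_forall fun ω => norm_le_one_of_mem (shiftMean_mem hB hφ hφ1 _ _ _))
  refine ae_eq_condExp_of_forall_setIntegral_eq (F.le t) hφint (fun _ _ _ => hwint.integrableOn)
    (fun A hA _ => ?_) hwm.stronglyMeasurable.aestronglyMeasurable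
  have hA' := F.le t _ hA
  -- Recording the indicator of `A` next to `B t` makes a single independence statement enough: the
  -- integral over `A` becomes an integral for the product law of `X` and `Z`, and Fubini applies.
  set X : Ω → ℝ × (Fin d → ℝ) := fun ω => (A.indicator 1 ω, B t ω)
  set Z : Ω → (Fin d → ℝ) := fun ω => B u ω - B t ω
  have hX' : Measurable[F t] X := measurable_indicator_prodMk hA hBt
  have hX : Measurable X := hX'.mono (F.le t) le_rfl
  have hZ : Measurable Z := (hB.measurable u).sub (hB.measurable t)
  have hind : IndepFun X Z P := by
    rw [IndepFun_iff_Indep]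
    exact indep_of_indep_of_le_left (hB.indep htu) hX'.comap_le
  set g : (ℝ × (Fin d → ℝ)) × (Fin d → ℝ) → ℝ := fun p => p.1.1 * φ (p.1.2 + p.2)
  have hg : Measurable g := by
    have := hφ.measurable
    fun_prop
  have hXA : ∀ ω z, g (X ω, z) = A.indicator (fun ω => φ (B t ω + z)) ω := by
    intro ω z
    by_cases hω : ω ∈ A <;> simp [g, X, hω]
  have hgint : Integrable (fun ω => g (X ω, Z ω)) P := by
    refine Integrable.of_bound (hg.comp (hX.prodMk hZ)).aestronglyMeasurable 1
      (Eventually.of_forall fun ω => ?_)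
    rw [hXA]
    exact (norm_indicator_le_norm_self _ _).trans (norm_le_one_of_mem (hφ1 _))
  have hprod := hind.map_prod_eq_prod_map_map hX.aemeasurable hZ.aemeasurable
  have : IsProbabilityMeasure (P.map X) := Measure.isProbabilityMeasure_map hX.aemeasurable
  have : IsProbabilityMeasure (P.map Z) := Measure.isProbabilityMeasure_map hZ.aemeasurable
  have hgint' : Integrable g ((P.map X).prod (P.map Z)) := by
    rw [← hprod]
    exact (integrable_map_measure hg.aestronglyMeasurable (hX.prodMk hZ).aemeasurable).2 hgint
  calc ∫ ω in A, shiftMean P B φ u t (B t ω) ∂P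
      = ∫ ω, (∫ z, g (X ω, z) ∂(P.map Z)) ∂P := by
        rw [← integral_indicator hA']
        refine integral_congr_ae (Eventually.of_forall fun ω => ?_)
        have h1 : Measurable fun z => g (X ω, z) := hg.comp (measurable_const.prodMk measurable_id)
        have h2 := integral_map hZ.aemeasurable (h1.aestronglyMeasurable (μ := P.map Z))
        refine Eq.trans ?_ h2.symm
        by_cases hω : ω ∈ A <;> simp [hω, g, X, Z, shiftMean]
    _ = ∫ y, (∫ z, g (y, z) ∂(P.map Z)) ∂(P.map X) :=
        (integral_map hX.aemeasurable
          hg.stronglyMeasurable.integral_prod_right'.aestronglyMeasurable).symm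
    _ = ∫ p, g p ∂((P.map X).prod (P.map Z)) := (integral_prod g hgint').symm
    _ = ∫ ω, g (X ω, Z ω) ∂P := by
        rw [← hprod, integral_map (hX.prodMk hZ).aemeasurable hg.aestronglyMeasurable]
    _ = ∫ ω in A, φ (B u ω) ∂P := by
        rw [← integral_indicator hA']
        refine integral_congr_ae (Eventually.of_forall fun ω => ?_)
        by_cases hω : ω ∈ A <;> simp [hω, g, X, Z]

theorem IsBrownianMotion.condExp_mul_eq [IsProbabilityMeasure P] (hB : IsBrownianMotion P B)
    {φ : (Fin d → ℝ) → ℝ} (hφ : Continuous φ) (hφ1 : ∀ x, φ x ∈ Icc (0 : ℝ) 1)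
    {t u : Icc (0 : ℝ) T} (htu : t ≤ u) {ψ : Ω → ℝ}
    (hψ : Measurable[completedFiltration P B hB.measurable t] ψ)
    (hψ1 : ∀ ω, ψ ω ∈ Icc (0 : ℝ) 1) :
    (fun ω => ψ ω * shiftMean P B φ u t (B t ω)) =ᵐ[P]
      P[fun ω => ψ ω * φ (B u ω) | completedFiltration P B hB.measurable t] := by
  have hle := (completedFiltration P B hB.measurable).le t
  have hφint : Integrable (fun ω => φ (B u ω)) P :=
    Integrable.of_bound (hφ.measurable.comp (hB.measurable u)).aestronglyMeasurable
      1 (Eventually.of_forall fun ω => norm_le_one_of_mem (hφ1 _))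
  have h1 := condExp_mul_of_stronglyMeasurable_left (μ := P) hψ.stronglyMeasurable
    (g := fun ω => φ (B u ω)) (hφint.bdd_mul (hψ.mono hle le_rfl).aestronglyMeasurable
      (Eventually.of_forall fun ω => norm_le_one_of_mem (hψ1 ω))) hφint
  filter_upwards [h1, hB.condExp_eq hφ hφ1 htu] with ω h2 h3
  rw [h3]
  exact h2.symm

/-- By the Markov property the martingale closed by `ψ φ(B_u)` is `ψ · shiftMean(t, B_t)` on `[v,u]`
and constant afterwards. Before `v` it is the martingale closed by its value at `v`, for which a
continuous version is assumed. -/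
theorem IsBrownianMotion.hasContinuousVersion_mul [IsProbabilityMeasure P] [P.IsComplete]
    (hB : IsBrownianMotion P B)
    {φ : (Fin d → ℝ) → ℝ} (hφ : Continuous φ) (hφ1 : ∀ x, φ x ∈ Icc (0 : ℝ) 1)
    {v u : Icc (0 : ℝ) T} (hvu : v ≤ u) {ψ : Ω → ℝ}
    (hψ : Measurable[completedFiltration P B hB.measurable v] ψ)
    (hψ1 : ∀ ω, ψ ω ∈ Icc (0 : ℝ) 1)
    (h : HasContinuousVersion (completedFiltration P B hB.measurable) P 0 T
      fun ω => ψ ω * shiftMean P B φ u v (B v ω)) :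
    HasContinuousVersion (completedFiltration P B hB.measurable) P 0 T
      fun ω => ψ ω * φ (B u ω) := by
  set F := completedFiltration P B hB.measurable
  have hF : NullComplete F P := nullComplete_completedFiltration hB.measurable
  have hT : (0 : ℝ) ≤ T := u.2.1.trans u.2.2
  obtain ⟨N, hN, hNeq⟩ := h
  have hw := hB.continuous_shiftMean hφ hφ1 u
  -- The clock is stopped at `u`, where `shiftMean` reduces to `φ`; thus `Q` is constant after `u`.
  set r : ℝ → Icc (0 : ℝ) T := fun t => projIcc 0 T hT (min t u) with hr
  have hrc : Continuous r := continuous_projIcc.comp (continuous_id.min continuous_const)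
  have hr1 : ∀ t : Icc (0 : ℝ) T, t ≤ u → r t = t := fun t ht => by
    simp only [hr, min_eq_left (show (t : ℝ) ≤ u from ht), projIcc_val]
  have hr2 : ∀ t : ℝ, u ≤ t → r t = u := fun t ht => by
    simp only [hr, min_eq_right ht, projIcc_val]
  have hr3 : ∀ t : ℝ, 0 ≤ t → r t ≤ t := fun t ht => by
    simp only [hr, coe_projIcc]
    exact max_le ht ((min_le_right _ _).trans (min_le_left _ _))
  set Q : ℝ → Ω → ℝ := fun t ω => ψ ω * shiftMean P B φ u (r t) (B (r t) ω) with hQ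
  have hQm : ∀ t : ℝ, v ≤ t → Measurable[F t] (Q t) := fun t ht =>
    (hψ.mono (F.mono ht) le_rfl).mul
      (((hw.comp (Continuous.prodMk_right (r t))).measurable).comp
        (measurable_completedFiltration hB.measurable (hr3 t (v.2.1.trans ht))))
  have hQc : ∀ᵐ ω ∂P, Continuous fun t => Q t ω := by
    filter_upwards [hB.continuous_paths] with ω hω
    exact continuous_const.mul (hw.comp (hrc.prodMk (hω.comp hrc)))
  have hQv : Q v = fun ω => ψ ω * shiftMean P B φ u v (B v ω) := by
    ext ω; simp only [hQ, hr1 v hvu]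
  -- Gluing through the increment of `Q` after `v` gives continuity at `v`, although `N v = Q v`
  -- holds only almost surely.
  have hM : ∀ t ∈ Icc (0 : ℝ) T,
      Measurable[F t] fun ω => N (min t v) ω + (Q (max t v) ω - Q v ω) := by
    intro t ht
    have hmin : min t v ∈ Icc (0 : ℝ) T := ⟨le_min ht.1 v.2.1, (min_le_left _ _).trans ht.2⟩
    refine ((hN.adapted _ hmin).mono (F.mono (min_le_left _ _)) le_rfl).add ?_
    rcases le_total t v with htv | htv
    · simp only [max_eq_right htv, sub_self]
      exact measurable_const
    · simp only [max_eq_left htv]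
      exact (hQm t htv).sub ((hQm v le_rfl).mono (F.mono htv) le_rfl)
  obtain ⟨M, hMr, hMeq⟩ := hF.exists_regularOn hT hM (by
    filter_upwards [hQc] with ω hω
    exact (((hN.continuous ω).comp (continuous_id.min continuous_const)).add
      ((hω.comp (continuous_id.max continuous_const)).sub continuous_const)).continuousOn)
  refine ⟨M, hMr, fun t ht => ?_⟩
  have hMt : M t =ᵐ[P] fun ω => N (min t v) ω + (Q (max t v) ω - Q v ω) :=
    hMeq.mono fun ω hω => hω t ht
  refine hMt.trans ?_
  have hcond_v := hB.condExp_mul_eq hφ hφ1 hvu hψ hψ1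
  rcases le_total t v with htv | htv
  · simp only [min_eq_left htv, max_eq_right htv, sub_self, add_zero]
    exact ((hNeq t ht).trans (condExp_congr_ae hcond_v)).trans
      (condExp_condExp_of_le (F.mono htv) (F.le v))
  · have hint : Integrable (fun ω => ψ ω * shiftMean P B φ u v (B v ω)) P :=
      integrable_condExp.congr hcond_v.symm
    have hNv : N v =ᵐ[P] Q v := by
      have h1 := hNeq v v.2
      rw [hQv]
      have hm : Measurable[F v] fun ω => ψ ω * shiftMean P B φ u v (B v ω) := hQv ▸ hQm v le_rfl
      rwa [condExp_of_stronglyMeasurable (F.le v) hm.stronglyMeasurable hint] at h1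
    have h2 : (fun ω => N (min t v) ω + (Q (max t v) ω - Q v ω)) =ᵐ[P] Q t := by
      filter_upwards [hNv] with ω hω
      rw [min_eq_right htv, max_eq_left htv, hω]
      ring
    refine h2.trans ?_
    rcases le_total t u with htu | htu
    · have h3 := hB.condExp_mul_eq hφ hφ1 (t := ⟨t, ht⟩) htu (hψ.mono (F.mono htv) le_rfl) hψ1
      have h4 : r t = ⟨t, ht⟩ := hr1 ⟨t, ht⟩ htu
      simp only [hQ, h4]
      exact h3
    · have h4 : Q t = fun ω => ψ ω * φ (B u ω) := by
        ext ω; simp only [hQ, hr2 t htu, shiftMean_self]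
      have h5 : Integrable (fun ω => ψ ω * φ (B u ω)) P :=
        Integrable.of_bound ((hψ.mono (F.le v) le_rfl).mul
          (hφ.measurable.comp (hB.measurable u))).aestronglyMeasurable 1
          (Eventually.of_forall fun ω => norm_le_one_of_mem
            ⟨mul_nonneg (hψ1 ω).1 (hφ1 _).1, mul_le_one₀ (hψ1 ω).2 (hφ1 _).1 (hφ1 _).2⟩)
      rw [← h4] at h5 ⊢
      rw [condExp_of_stronglyMeasurable (F.le t) (hQm t htv).stronglyMeasurable h5]

theorem measurable_finset_prod_comp {Ω ι E : Type*} [MeasurableSpace E] {m : MeasurableSpace Ω}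
    {s : Finset ι} {f : ι → Ω → E} {φ : ι → E → ℝ} (hφ : ∀ j, Measurable (φ j))
    (hf : ∀ j ∈ s, Measurable[m] (f j)) : Measurable[m] fun ω => ∏ j ∈ s, φ j (f j ω) :=
  Finset.measurable_prod _ fun j hj => (hφ j).comp (hf j hj)

theorem finset_prod_mem_Icc {ι : Type*} (s : Finset ι) {f : ι → ℝ}
    (hf : ∀ j ∈ s, f j ∈ Icc (0 : ℝ) 1) : ∏ j ∈ s, f j ∈ Icc (0 : ℝ) 1 :=
  ⟨Finset.prod_nonneg fun j hj => (hf j hj).1,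
    Finset.prod_le_one (fun j hj => (hf j hj).1) fun j hj => (hf j hj).2⟩

/-- Induction on the latest time `u`: conditioning at the preceding time `v` replaces the factor at
`u` by a continuous function of `B v`, which is absorbed into the factor at `v`. -/
theorem IsBrownianMotion.hasContinuousVersion_prod [IsProbabilityMeasure P] [P.IsComplete]
    (hB : IsBrownianMotion P B) (s : Finset (Icc (0 : ℝ) T)) :
    ∀ φ : Icc (0 : ℝ) T → (Fin d → ℝ) → ℝ, (∀ j, Continuous (φ j)) →
      (∀ j x, φ j x ∈ Icc (0 : ℝ) 1) →
      HasContinuousVersion (completedFiltration P B hB.measurable) P 0 T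
        fun ω => ∏ j ∈ s, φ j (B j ω) := by
  classical
  induction s using Finset.induction_on_max with
  | empty =>
    intro φ _ _
    simpa using hasContinuousVersion_const (F := completedFiltration P B hB.measurable)
      (P := P) 0 T 1
  | insert u s hs ih =>
    intro φ hφ hφ1
    have hus : u ∉ s := fun h => lt_irrefl _ (hs u h)
    have hprod : (fun ω => ∏ j ∈ insert u s, φ j (B j ω)) =
        fun ω => (∏ j ∈ s, φ j (B j ω)) * φ u (B u ω) := by
      ext ω; rw [Finset.prod_insert hus, mul_comm]
    rw [hprod]
    rcases s.eq_empty_or_nonempty with rfl | hne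
    · have hT : (0 : ℝ) ≤ T := u.2.1.trans u.2.2
      set z : Icc (0 : ℝ) T := ⟨0, le_rfl, hT⟩
      simp only [Finset.prod_empty]
      -- With a single time left, one conditions at time `0`, where `B` vanishes almost surely and
      -- the conditional mean is a constant.
      refine hB.hasContinuousVersion_mul (hφ u) (hφ1 u) (v := z) u.2.1 (ψ := fun _ => 1)
        measurable_const (fun _ => ⟨zero_le_one, le_rfl⟩) ?_
      refine (hasContinuousVersion_const 0 T (shiftMean P B (φ u) u z 0)).congr ?_
      filter_upwards [hB.start_zero z rfl] with ω hω
      rw [hω, one_mul]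
    · set v := s.max' hne
      have hvs : v ∈ s := s.max'_mem hne
      refine hB.hasContinuousVersion_mul (hφ u) (hφ1 u) (v := v) (hs v hvs).le
        (ψ := fun ω => ∏ j ∈ s, φ j (B j ω)) ?_
        (fun ω => finset_prod_mem_Icc s fun j _ => hφ1 j _) ?_
      · exact measurable_finset_prod_comp (fun j => (hφ j).measurable) fun j hj =>
          measurable_completedFiltration hB.measurable (s.le_max' j hj)
      · set w := shiftMean P B (φ u) u v
        have hw : Continuous w :=
          (hB.continuous_shiftMean (hφ u) (hφ1 u) u).comp (Continuous.prodMk_right v)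
        have hw1 : ∀ x, w x ∈ Icc (0 : ℝ) 1 := shiftMean_mem hB (hφ u) (hφ1 u) u v
        convert ih (Function.update φ v fun x => φ v x * w x) (fun j => ?_) (fun j x => ?_) using 2
          with ω
        · rw [← Finset.mul_prod_erase s _ hvs, ← Finset.mul_prod_erase s _ hvs]
          rw [Function.update_self, mul_right_comm]
          congr 1
          refine Finset.prod_congr rfl fun j hj => ?_
          rw [Function.update_of_ne (Finset.ne_of_mem_erase hj)]
        · by_cases hj : j = v
          · subst hj; rw [Function.update_self]; exact (hφ _).mul hw
          · rw [Function.update_of_ne hj]; exact hφ j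
        · by_cases hj : j = v
          · subst hj; rw [Function.update_self]
            exact ⟨mul_nonneg (hφ1 _ x).1 (hw1 x).1, mul_le_one₀ (hφ1 _ x).2 (hw1 x).1 (hw1 x).2⟩
          · rw [Function.update_of_ne hj]; exact hφ1 j x

end BrownianMartingales

end MFDRBSDE

/-! ### From cylinders to all martingales of the Brownian filtration. -/

namespace MFDRBSDE

open Filter Topology

theorem indicator_one_mem_Icc {Ω : Type*} (A : Set Ω) (ω : Ω) :
    A.indicator (1 : Ω → ℝ) ω ∈ Icc (0 : ℝ) 1 := by
  by_cases h : ω ∈ A <;> simp [h]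

section BrownianIndicators

variable {Ω : Type*} [m : MeasurableSpace Ω] {P : Measure Ω} {T : ℝ} {d : ℕ}
  {B : Icc (0 : ℝ) T → Ω → (Fin d → ℝ)}

theorem NullComplete.hasContinuousVersion_of_tendsto_ae [IsFiniteMeasure P]
    {F : Filtration ℝ m} (hF : NullComplete F P)
    {a b : ℝ} (hab : a < b) {ζ : ℕ → Ω → ℝ} {η : Ω → ℝ} (hζm : ∀ n, Measurable (ζ n))
    (hηm : Measurable η) (hζ : ∀ n ω, ζ n ω ∈ Icc (0 : ℝ) 1) (hη : ∀ ω, η ω ∈ Icc (0 : ℝ) 1)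
    (h : ∀ n, HasContinuousVersion F P a b (ζ n))
    (hlim : ∀ ω, Tendsto (fun n => ζ n ω) atTop (𝓝 (η ω))) :
    HasContinuousVersion F P a b η := by
  have hi : ∀ f : Ω → ℝ, Measurable f → (∀ ω, f ω ∈ Icc (0 : ℝ) 1) → Integrable f P :=
    fun f hf hf1 => Integrable.of_bound hf.aestronglyMeasurable 1
      (Eventually.of_forall fun ω => by
        rw [Real.norm_eq_abs, abs_le]; exact ⟨by linarith [(hf1 ω).1], (hf1 ω).2⟩)
  refine hF.hasContinuousVersion_of_tendsto hab (fun n => hi _ (hζm n) (hζ n)) (hi _ hηm hη) h ?_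
  have h1 := tendsto_integral_of_dominated_convergence (μ := P)
    (F := fun n ω => |ζ n ω - η ω|) (f := fun _ => 0) (fun _ => (1 : ℝ))
    (fun n => ((hζm n).sub hηm).abs.aestronglyMeasurable) (integrable_const _)
    (fun n => Eventually.of_forall fun ω => by
      rw [Real.norm_eq_abs, abs_abs, abs_le]
      exact ⟨by linarith [(hζ n ω).1, (hη ω).2], by linarith [(hζ n ω).2, (hη ω).1]⟩)
    (Eventually.of_forall fun ω => by
      have := ((hlim ω).sub_const (η ω)).abs
      simpa using this)
  simpa using h1

/-- The indicator of a closed set is the pointwise limit of continuous thickened indicators, so the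
product case passes to cylinders by bounded convergence. -/
theorem IsBrownianMotion.hasContinuousVersion_cylinder [IsProbabilityMeasure P] [P.IsComplete]
    (hB : IsBrownianMotion P B) (hT : 0 < T) (t : Icc (0 : ℝ) T) {A : Set Ω}
    (hA : A ∈ cylinders P B t) :
    HasContinuousVersion (completedFiltration P B hB.measurable) P 0 T (A.indicator 1) := by
  obtain ⟨-, s, C, -, hC, hAC⟩ := hA
  have hF := nullComplete_completedFiltration (P := P) hB.measurable
  set A' : Set Ω := ⋂ j ∈ s, B j ⁻¹' C j
  have hA' : MeasurableSet A' :=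
    Finset.measurableSet_biInter _ fun j _ => hB.measurable j (hC j).measurableSet
  refine HasContinuousVersion.congr (ζ := A'.indicator 1) ?_
    (indicator_ae_eq_of_ae_eq_set hAC.symm)
  have hδ : ∀ n : ℕ, (0 : ℝ) < 1 / ((n : ℝ) + 1) := fun n => by positivity
  set φ : ℕ → Icc (0 : ℝ) T → (Fin d → ℝ) → ℝ := fun n j x =>
    (thickenedIndicator (hδ n) (C j) x : ℝ)
  have hφ : ∀ n j, Continuous (φ n j) := fun n j =>
    NNReal.continuous_coe.comp (thickenedIndicator (hδ n) (C j)).continuous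
  have hφ1 : ∀ n j x, φ n j x ∈ Icc (0 : ℝ) 1 := fun n j x =>
    ⟨NNReal.coe_nonneg _, NNReal.coe_le_one.2 (thickenedIndicator_le_one _ _ _)⟩
  have hφlim : ∀ j x, Tendsto (fun n => φ n j x) atTop (𝓝 ((C j).indicator 1 x)) := by
    intro j x
    have h1 := (tendsto_pi_nhds.1 (thickenedIndicator_tendsto_indicator_closure hδ
      tendsto_one_div_add_atTop_nhds_zero_nat (C j))) x
    rw [(hC j).closure_eq] at h1
    have h2 := (NNReal.continuous_coe.tendsto _).comp h1
    have h3 : (((C j).indicator (fun _ => (1 : ℝ≥0)) x : ℝ≥0) : ℝ) = (C j).indicator 1 x := by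
      by_cases hx : x ∈ C j <;> simp [hx]
    rw [← h3]
    exact h2
  refine hF.hasContinuousVersion_of_tendsto_ae hT (ζ := fun n ω => ∏ j ∈ s, φ n j (B j ω))
    (fun n => measurable_finset_prod_comp (fun j => (hφ n j).measurable) fun j _ => hB.measurable j)
    (measurable_one.indicator hA') (fun n ω => finset_prod_mem_Icc s fun j _ => hφ1 n j _)
    (indicator_one_mem_Icc A') (fun n => hB.hasContinuousVersion_prod s _ (hφ n) (hφ1 n))
    fun ω => ?_
  have h3 : A'.indicator (1 : Ω → ℝ) ω = ∏ j ∈ s, (C j).indicator (1 : (Fin d → ℝ) → ℝ) (B j ω) := by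
    by_cases hω : ω ∈ A'
    · rw [indicator_of_mem hω]
      refine (Finset.prod_eq_one fun j hj => ?_).symm
      exact indicator_of_mem (show B j ω ∈ C j from mem_iInter₂.1 hω j hj) _
    · rw [indicator_of_notMem hω]
      obtain ⟨j, hj⟩ : ∃ j, j ∈ s ∧ B j ω ∉ C j := by
        by_contra hc
        refine hω (mem_iInter₂.2 fun j hj => ?_)
        by_contra hjC
        exact hc ⟨j, hj, hjC⟩
      exact (Finset.prod_eq_zero hj.1 (indicator_of_notMem hj.2 _)).symm
  rw [h3]
  exact tendsto_finsetProd _ fun j _ => hφlim j (B j ω)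

/-- A π-λ argument: events with a continuous martingale are stable under complements and countable
disjoint unions. -/
theorem IsBrownianMotion.hasContinuousVersion_indicator [IsProbabilityMeasure P] [P.IsComplete]
    (hB : IsBrownianMotion P B) (hT : 0 < T) (t : Icc (0 : ℝ) T) (A : Set Ω)
    (hA : MeasurableSet[MeasurableSpace.generateFrom (cylinders P B t)] A) :
    HasContinuousVersion (completedFiltration P B hB.measurable) P 0 T (A.indicator 1) := by
  have hF := nullComplete_completedFiltration (P := P) hB.measurable
  have hle : MeasurableSpace.generateFrom (cylinders P B t) ≤ m :=
    MeasurableSpace.generateFrom_le fun A hA => hA.1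
  have hint : ∀ {A : Set Ω}, MeasurableSet A → Integrable (A.indicator (1 : Ω → ℝ)) P :=
    fun hA => (integrable_const (1 : ℝ)).indicator hA
  induction A, hA using MeasurableSpace.induction_on_inter (m := .generateFrom (cylinders P B t))
    (s := cylinders P B t) rfl (isPiSystem_cylinders t) with
  | empty =>
    simpa using! hasContinuousVersion_const (F := completedFiltration P B hB.measurable)
      (P := P) 0 T 0
  | basic A hA => exact hB.hasContinuousVersion_cylinder hT t hA
  | compl A hA ih =>
    have h1 := (hasContinuousVersion_const (F := completedFiltration P B hB.measurable)
      (P := P) 0 T 1).add (ih.const_mul (-1)) (integrable_const _)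
      ((hint (hle _ hA)).const_mul _)
    convert h1 using 1
    ext ω
    by_cases hω : ω ∈ A <;> simp [hω]
  | iUnion f hd hf ih =>
    set E : ℕ → Set Ω := fun n => ⋃ i ∈ Finset.range n, f i
    have hEm : ∀ n, MeasurableSet (E n) := fun n =>
      Finset.measurableSet_biUnion _ fun i _ => hle _ (hf i)
    have hE : ∀ n, HasContinuousVersion (completedFiltration P B hB.measurable) P 0 T
        ((E n).indicator 1) := by
      intro n
      induction n with
      | zero =>
        simpa [E] using hasContinuousVersion_const (F := completedFiltration P B hB.measurable)
          (P := P) 0 T 0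
      | succ n ihn =>
        have h1 : E (n + 1) = E n ∪ f n := by
          simp only [E, Finset.range_add_one, Finset.set_biUnion_insert]
          exact union_comm _ _
        have h2 : Disjoint (E n) (f n) := by
          rw [disjoint_iUnion₂_left]
          exact fun i hi => hd (Finset.mem_range.1 hi).ne
        rw [h1, indicator_union_of_disjoint h2]
        exact ihn.add (ih n) (hint (hEm n)) (hint (hle _ (hf n)))
    refine hF.hasContinuousVersion_of_tendsto_ae hT (ζ := fun n => (E n).indicator 1)
      (fun n => measurable_one.indicator (hEm n))
      (measurable_one.indicator (MeasurableSet.iUnion fun i => hle _ (hf i)))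
      (fun n => indicator_one_mem_Icc _) (indicator_one_mem_Icc _) hE fun ω => ?_
    refine tendsto_const_nhds.congr' ?_
    by_cases hω : ω ∈ ⋃ i, f i
    · obtain ⟨i, hi⟩ := mem_iUnion.1 hω
      filter_upwards [eventually_gt_atTop i] with n hn
      rw [indicator_of_mem hω, indicator_of_mem]
      exact mem_iUnion₂.2 ⟨i, Finset.mem_range.2 hn, hi⟩
    · filter_upwards with n
      rw [indicator_of_notMem hω, indicator_of_notMem]
      exact fun h => hω (iUnion₂_subset (fun i _ => subset_iUnion f i) h)

/-- Martingales of the completed Brownian filtration have continuous versions. -/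
theorem IsBrownianMotion.hasContinuousVersion [IsProbabilityMeasure P] [P.IsComplete]
    (hB : IsBrownianMotion P B) (hT : 0 < T) {ζ : Ω → ℝ}
    (hζm : Measurable[completedFiltration P B hB.measurable T] ζ) (hζ : Integrable ζ P) :
    HasContinuousVersion (completedFiltration P B hB.measurable) P 0 T ζ :=
  (nullComplete_completedFiltration hB.measurable).hasContinuousVersion_of_indicator hT
    (fun A hA => hB.hasContinuousVersion_indicator hT ⟨T, hT.le, le_rfl⟩ A
      (completedFiltration_le_cylinders hB.measurable ⟨T, hT.le, le_rfl⟩ A hA)) hζm hζ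

end BrownianIndicators

end MFDRBSDE

/-! ### Optional stopping for continuous martingales. -/

namespace MFDRBSDE

open Filter Topology

section OptionalStopping

variable {Ω : Type*} [m : MeasurableSpace Ω] {F : Filtration ℝ m} {P : Measure Ω}

/-- An inequality between continuous processes that holds almost surely at each time holds almost
surely at all times simultaneously. -/
theorem ae_forall_le_of_forall_ae_le {a b : ℝ} (hab : a ≤ b) {f g : ℝ → Ω → ℝ}
    (hf : ∀ ω, Continuous fun t => f t ω) (hg : ∀ ω, Continuous fun t => g t ω)
    (h : ∀ t ∈ Icc a b, f t ≤ᵐ[P] g t) : ∀ᵐ ω ∂P, ∀ t ∈ Icc a b, f t ω ≤ g t ω := by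
  have : Nonempty (Icc a b) := ⟨⟨a, left_mem_Icc.2 hab⟩⟩
  have h1 : ∀ᵐ ω ∂P, ∀ n, f (TopologicalSpace.denseSeq (Icc a b) n) ω ≤
      g (TopologicalSpace.denseSeq (Icc a b) n) ω := ae_all_iff.2 fun n => h _ (Subtype.prop _)
  filter_upwards [h1] with ω hω t ht
  have hcl : IsClosed {s : Icc a b | f s ω ≤ g s ω} :=
    isClosed_le ((hf ω).comp continuous_subtype_val) ((hg ω).comp continuous_subtype_val)
  have hsub : range (TopologicalSpace.denseSeq (Icc a b)) ⊆ {s : Icc a b | f s ω ≤ g s ω} := by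
    rintro _ ⟨n, rfl⟩
    exact hω n
  have h2 := hcl.closure_subset_iff.2 hsub
  rw [(TopologicalSpace.denseRange_denseSeq (Icc a b)).closure_range] at h2
  exact h2 (mem_univ (⟨t, ht⟩ : Icc a b))

/-- On each event `A ∩ {ρ = v}`, which lies in `F v`, this is the defining property of `E[ζ | F v]`;
the finitely many pieces are summed. -/
theorem setIntegral_eq_of_finite_range [IsFiniteMeasure P] {a b : ℝ} {M : ℝ → Ω → ℝ} {ζ : Ω → ℝ}
    (hζ : Integrable ζ P) (hM : ∀ t ∈ Icc a b, M t =ᵐ[P] P[ζ | F t]) {t : ℝ} (ht : t ∈ Icc a b)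
    {ρ : Ω → ℝ} (hρ : IsStoppingTimeIn F P t b ρ) (hρm : ∀ ω, ρ ω ∈ Icc t b)
    (hfin : (range ρ).Finite) {A : Set Ω} (hA : MeasurableSet[F t] A) :
    ∫ ω in A, M (ρ ω) ω ∂P = ∫ ω in A, ζ ω ∂P := by
  set V : Finset ℝ := hfin.toFinset
  have hVρ : ∀ ω, ρ ω ∈ V := fun ω => hfin.mem_toFinset.2 ⟨ω, rfl⟩
  have hV : ∀ v ∈ V, v ∈ Icc t b := by
    intro v hv
    obtain ⟨ω, rfl⟩ := hfin.mem_toFinset.1 hv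
    exact hρm ω
  set E : ℝ → Set Ω := fun v => A ∩ {ω | ρ ω = v}
  have hE : ∀ v ∈ V, MeasurableSet[F v] (E v) := fun v hv =>
    (F.mono (hV v hv).1 _ hA).inter (hρ.measurableSet_eq v)
  have hMi : ∀ v ∈ V, Integrable (M v) P := fun v hv =>
    integrable_condExp.congr (hM v (Icc_subset_Icc ht.1 le_rfl (hV v hv))).symm
  have hsum : ∀ K : ℝ → Ω → ℝ, (A.indicator fun ω => K (ρ ω) ω) =
      fun ω => ∑ v ∈ V, (E v).indicator (K v) ω := by
    intro K
    ext ω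
    rw [Finset.sum_eq_single (ρ ω)]
    · by_cases hω : ω ∈ A
      · rw [indicator_of_mem hω, indicator_of_mem (show ω ∈ E (ρ ω) from ⟨hω, rfl⟩)]
      · rw [indicator_of_notMem hω, indicator_of_notMem (show ω ∉ E (ρ ω) from fun h => hω h.1)]
    · intro v _ hv
      exact indicator_of_notMem (show ω ∉ E v from fun h => hv h.2.symm) _
    · exact fun h => absurd (hVρ ω) h
  have hint : ∀ K : ℝ → Ω → ℝ, (∀ v ∈ V, Integrable (K v) P) →
      ∫ ω in A, K (ρ ω) ω ∂P = ∑ v ∈ V, ∫ ω in E v, K v ω ∂P := by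
    intro K hK
    rw [← integral_indicator (F.le t _ hA), hsum,
      integral_finsetSum _ fun v hv => (hK v hv).indicator (F.le v _ (hE v hv))]
    exact Finset.sum_congr rfl fun v hv => integral_indicator (F.le v _ (hE v hv))
  rw [hint M hMi, hint (fun _ => ζ) fun _ _ => hζ]
  refine Finset.sum_congr rfl fun v hv => ?_
  have h1 := hM v (Icc_subset_Icc ht.1 le_rfl (hV v hv))
  rw [integral_congr_ae (ae_restrict_of_ae h1), setIntegral_condExp (F.le v) hζ (hE v hv)]

/-- Optional stopping for bounded continuous martingales. -/
theorem NullComplete.condExp_stopped [IsFiniteMeasure P] (hF : NullComplete F P) {a b : ℝ}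
    {M : ℝ → Ω → ℝ} (hMr : RegularOn F a b M) {ζ : Ω → ℝ} (hζ : Integrable ζ P)
    (hM : ∀ t ∈ Icc a b, M t =ᵐ[P] P[ζ | F t]) {C : ℝ}
    (hC : ∀ᵐ ω ∂P, ∀ t ∈ Icc a b, |M t ω| ≤ C) {t : ℝ} (ht : t ∈ Icc a b)
    {ρ : Ω → ℝ} (hρ : IsStoppingTimeIn F P t b ρ) :
    M t =ᵐ[P] P[fun ω => M (ρ ω) ω | F t] := by
  have hMi : ∀ σ, IsStoppingTimeIn F P t b σ → Integrable (fun ω => M (σ ω) ω) P := fun σ hσ =>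
    Integrable.of_bound (hMr.measurable_comp hσ.measurable).aestronglyMeasurable C (by
      filter_upwards [hC, hσ.2] with ω h1 h2
      exact h1 _ (Icc_subset_Icc ht.1 le_rfl h2))
  refine ae_eq_condExp_of_forall_setIntegral_eq (F.le t) (hMi ρ hρ)
    (fun _ _ _ => (hMi _ (isStoppingTimeIn_const ⟨le_rfl, ht.2⟩)).integrableOn) (fun A hA _ => ?_)
    (hMr.adapted t ht).stronglyMeasurable.aestronglyMeasurable
  obtain ⟨σ, hσ, hσm, hσρ⟩ := hF.exists_clamp ht.2 hρ
  have h1 : ∫ ω in A, M (ρ ω) ω ∂P = ∫ ω in A, M (σ ω) ω ∂P :=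
    integral_congr_ae (ae_restrict_of_ae (hσρ.mono fun ω hω => by simp only [hω]))
  -- Boundedness of `M` allows dominated convergence along the discretized stopping times, for which
  -- the identity is already known.
  have h2 : Tendsto (fun n => ∫ ω in A, M (roundUp b n (σ ω)) ω ∂P) atTop
      (𝓝 (∫ ω in A, M (σ ω) ω ∂P)) := by
    refine tendsto_integral_of_dominated_convergence (fun _ => C)
      (fun n => (hMr.measurable_comp (hσ.roundUp n).measurable).aestronglyMeasurable)
      (integrable_const _) (fun n => ae_restrict_of_ae ?_) (Eventually.of_forall fun ω => ?_)
    · filter_upwards [hC] with ω hω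
      exact hω _ (Icc_subset_Icc ht.1 le_rfl (roundUp_mem n (hσm ω)))
    · exact ((hMr.continuous ω).tendsto _).comp (tendsto_roundUp (hσm ω).2)
  have h3 : ∀ n, ∫ ω in A, M (roundUp b n (σ ω)) ω ∂P = ∫ ω in A, ζ ω ∂P := fun n =>
    setIntegral_eq_of_finite_range hζ hM ht (hσ.roundUp n) (fun ω => roundUp_mem n (hσm ω))
      (finite_range_roundUp n hσm) hA
  simp_rw [h3] at h2
  rw [h1, ← tendsto_nhds_unique tendsto_const_nhds h2,
    integral_congr_ae (ae_restrict_of_ae (hM t ht)), setIntegral_condExp (F.le t) hζ hA]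

end OptionalStopping

/-! ### Linear interpolation of jumps. -/

section Ramp

/-- The piecewise linear function that increases from `0` at `s` to `1` at `s + h`. -/
noncomputable def ramp (h s t : ℝ) : ℝ := max 0 (min 1 ((t - s) / h))

theorem continuous_ramp (h s : ℝ) : Continuous (ramp h s) := by
  unfold ramp; fun_prop

theorem ramp_nonneg (h s t : ℝ) : 0 ≤ ramp h s t := le_max_left _ _

theorem ramp_le_one (h s t : ℝ) : ramp h s t ≤ 1 := max_le zero_le_one (min_le_left _ _)

theorem ramp_mono {h : ℝ} (hh : 0 < h) (s : ℝ) : Monotone (ramp h s) := fun _ _ hxy =>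
  max_le_max le_rfl (min_le_min le_rfl (div_le_div_of_nonneg_right (sub_le_sub_right hxy _) hh.le))

theorem ramp_of_le {h s t : ℝ} (hh : 0 < h) (ht : t ≤ s) : ramp h s t = 0 :=
  max_eq_left ((min_le_right _ _).trans (div_nonpos_of_nonpos_of_nonneg (by linarith) hh.le))

theorem ramp_of_ge {h s t : ℝ} (hh : 0 < h) (ht : s + h ≤ t) : ramp h s t = 1 := by
  have : 1 ≤ (t - s) / h := by rw [le_div_iff₀ hh]; linarith
  rw [ramp, min_eq_left this, max_eq_right zero_le_one]

end Ramp

/-! ### A one-sided submartingale estimate up to the first contact with an obstacle. -/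

section OneSided

variable {Ω : Type*} [m : MeasurableSpace Ω] {F : Filtration ℝ m} {P : Measure Ω}

/-- The process `M - ∑ D_k c_k` is almost a submartingale up to the first grid time `s_k` at which
the event `A_k` occurs, if `D_k ≤ 0` outside `A_{k+1}`. -/
theorem NullComplete.exists_stoppingTime_submartingale [IsFiniteMeasure P] (hF : NullComplete F P)
    {a b : ℝ} {M X : ℝ → Ω → ℝ} (hMr : RegularOn F a b M) (hXr : RegularOn F a b X)
    {ζ : Ω → ℝ} (hζ : Integrable ζ P) (hM : ∀ t ∈ Icc a b, M t =ᵐ[P] P[ζ | F t]) {C : ℝ}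
    (hC : ∀ᵐ ω ∂P, ∀ t ∈ Icc a b, |M t ω| ≤ C) (hXC : ∀ᵐ ω ∂P, ∀ t ∈ Icc a b, |X t ω| ≤ C)
    {N : ℕ} {h : ℝ} (hh : 0 < h) {D : ℕ → Ω → ℝ} {w : Ω → ℝ} (hw : Integrable w P)
    (hw0 : ∀ᵐ ω ∂P, 0 ≤ w ω)
    (hX : ∀ t ω, X t ω = M t ω - ∑ k ∈ Finset.range N, D k ω * ramp h (b - (k + 1) * h) t)
    {A : ℕ → Set Ω} (hA : ∀ k ≤ N, MeasurableSet[F (b - k * h)] (A k))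
    (hDA : ∀ k < N, ∀ ω, ω ∉ A (k + 1) → D k ω ≤ 0)
    (hDw : ∀ k < N, ∀ᵐ ω ∂P, D k ω ≤ w ω) {t : ℝ} (ht : t ∈ Icc a b) :
    ∃ τ, IsStoppingTimeIn F P t b τ ∧
      (∀ ω, τ ω = b ∨ ∃ k ≤ N, τ ω = b - k * h ∧ ω ∈ A k) ∧
      ∀ σ, IsStoppingTimeIn F P t b σ →
        X t ≤ᵐ[P] P[fun ω => X (min (σ ω) (τ ω)) ω + w ω | F t] := by
  classical
  -- Grid times are counted backwards from the horizon. The candidate stopping time is the first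
  -- grid time not before `t` at which its event occurs.
  set s : ℕ → ℝ := fun k => b - k * h with hs
  set G : Finset ℝ := ((Finset.range (N + 1)).image s).filter (t ≤ ·) with hG
  set E : ℝ → Set Ω := fun r => ⋃ k ∈ (Finset.range (N + 1)).filter (fun k => s k = r), A k with hE
  have hGmem : ∀ r ∈ G, r ∈ Icc t b := by
    intro r hr
    obtain ⟨h1, h2⟩ := Finset.mem_filter.1 hr
    obtain ⟨k, -, rfl⟩ := Finset.mem_image.1 h1
    refine ⟨h2, ?_⟩
    simp only [hs]
    nlinarith [Nat.cast_nonneg (α := ℝ) k]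
  have hEm : ∀ r ∈ G, MeasurableSet[F r] (E r) := fun r _ =>
    Finset.measurableSet_biUnion _ fun k hk => by
      obtain ⟨h1, rfl⟩ := Finset.mem_filter.1 hk
      exact hA k (Nat.lt_succ_iff.1 (Finset.mem_range.1 h1))
  set τ := firstTime b G E
  have hτ : IsStoppingTimeIn F P t b τ := isStoppingTimeIn_firstTime ht.2 hGmem hEm
  have hτA : ∀ ω, τ ω = b ∨ ∃ k ≤ N, τ ω = b - k * h ∧ ω ∈ A k := by
    intro ω
    rcases firstTime_eq_or (b := b) (D := G) (A := E) (ω := ω) with h1 | ⟨-, h1⟩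
    · exact Or.inl h1
    · right
      obtain ⟨k, hk, hωk⟩ := mem_iUnion₂.1 h1
      obtain ⟨h2, h3⟩ := Finset.mem_filter.1 hk
      exact ⟨k, Nat.lt_succ_iff.1 (Finset.mem_range.1 h2), h3.symm, hωk⟩
  have hτle : ∀ ω, ∀ k ≤ N, t ≤ s k → ω ∈ A k → τ ω ≤ s k := by
    intro ω k hk htk hω
    refine firstTime_le_iff.2 (Or.inr ⟨s k, Finset.mem_filter.2 ⟨Finset.mem_image_of_mem _
      (Finset.mem_range.2 (Nat.lt_succ_of_le hk)), htk⟩, ?_, le_rfl⟩)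
    exact mem_iUnion₂.2 ⟨k, Finset.mem_filter.2 ⟨Finset.mem_range.2 (Nat.lt_succ_of_le hk), rfl⟩, hω⟩
  have hDw' : ∀ᵐ ω ∂P, ∀ k < N, D k ω ≤ w ω := by
    have : ∀ᵐ ω ∂P, ∀ k ∈ Finset.range N, D k ω ≤ w ω := by
      rw [Filter.eventually_all_finset]
      exact fun k hk => hDw k (Finset.mem_range.1 hk)
    exact this.mono fun ω hω k hk => hω k (Finset.mem_range.2 hk)
  have hpath : ∀ᵐ ω ∂P, ∀ r, t ≤ r → r ≤ τ ω →
      ∑ k ∈ Finset.range N, D k ω * (ramp h (b - (k + 1) * h) r - ramp h (b - (k + 1) * h) t)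
        ≤ w ω := by
    filter_upwards [hDw', hw0] with ω hω hω0 r htr hrτ
    -- The `k`-th ramp moves only on `[s (k + 1), s k]`. If this interval starts at or after `t` and
    -- has been entered by time `r ≤ τ`, then `A (k + 1)` has not occurred and `D k ≤ 0`. A positive
    -- contribution is possible only from the interval containing `t` in its interior, hence from
    -- one `k` at most, and it is at most `w`.
    have hterm : ∀ k ∈ Finset.range N,
        D k ω * (ramp h (b - (k + 1) * h) r - ramp h (b - (k + 1) * h) t) ≤
          if s (k + 1) < t ∧ t < s k then w ω else 0 := by
      intro k hk
      have hkN := Finset.mem_range.1 hk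
      have hk1 : s (k + 1) = b - (k + 1) * h := by simp only [hs]; push_cast; ring
      have hinc : 0 ≤ ramp h (b - (k + 1) * h) r - ramp h (b - (k + 1) * h) t :=
        sub_nonneg.2 (ramp_mono hh _ htr)
      split_ifs with hc
      · refine (mul_le_mul_of_nonneg_right (hω k hkN) hinc).trans
          (mul_le_of_le_one_right hω0 ?_)
        linarith [ramp_le_one h (b - (k + 1) * h) r, ramp_nonneg h (b - (k + 1) * h) t]
      · by_cases h1 : s (k + 1) < t
        · have h2 : s k ≤ t := not_lt.1 fun h2 => hc ⟨h1, h2⟩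
          have h3 : b - (k + 1) * h + h ≤ t := by
            have : b - (k + 1) * h + h = s k := by simp only [hs]; ring
            rw [this]; exact h2
          rw [ramp_of_ge hh h3, ramp_of_ge hh (h3.trans htr), sub_self, mul_zero]
        · by_cases h2 : r ≤ s (k + 1)
          · rw [hk1] at h2
            rw [ramp_of_le hh h2, ramp_of_le hh (htr.trans h2), sub_self, mul_zero]
          · have h3 : ω ∉ A (k + 1) := fun h4 =>
              h2 (hrτ.trans (hτle ω (k + 1) hkN (not_lt.1 h1) h4))
            exact mul_nonpos_of_nonpos_of_nonneg (hDA k hkN ω h3) hinc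
    refine (Finset.sum_le_sum hterm).trans ?_
    rw [← Finset.sum_filter, Finset.sum_const]
    have hcard : ((Finset.range N).filter fun k => s (k + 1) < t ∧ t < s k).card ≤ 1 := by
      refine Finset.card_le_one.2 fun i hi j hj => ?_
      obtain ⟨-, hi1, hi2⟩ := Finset.mem_filter.1 hi
      obtain ⟨-, hj1, hj2⟩ := Finset.mem_filter.1 hj
      simp only [hs] at hi1 hi2 hj1 hj2
      push_cast at hi1 hj1
      have h1 : (i : ℝ) < j + 1 := lt_of_mul_lt_mul_right (a := h) (by linarith) hh.le
      have h2 : (j : ℝ) < i + 1 := lt_of_mul_lt_mul_right (a := h) (by linarith) hh.le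
      have h1' : i < j + 1 := by exact_mod_cast h1
      have h2' : j < i + 1 := by exact_mod_cast h2
      omega
    rw [nsmul_eq_mul]
    exact mul_le_of_le_one_left hω0 (by exact_mod_cast hcard)
  refine ⟨τ, hτ, hτA, fun σ hσ => ?_⟩
  have hρ : IsStoppingTimeIn F P t b fun ω => min (σ ω) (τ ω) := hσ.min hτ
  have hbd : ∀ {Z : ℝ → Ω → ℝ}, RegularOn F a b Z → (∀ᵐ ω ∂P, ∀ t ∈ Icc a b, |Z t ω| ≤ C) →
      ∀ ρ, IsStoppingTimeIn F P t b ρ → Integrable (fun ω => Z (ρ ω) ω) P := fun hZ hZC ρ hρ =>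
    Integrable.of_bound (hZ.measurable_comp hρ.measurable).aestronglyMeasurable C (by
      filter_upwards [hZC, hρ.2] with ω h1 h2
      exact h1 _ (Icc_subset_Icc ht.1 le_rfl h2))
  have htc : IsStoppingTimeIn F P t b fun _ => t := isStoppingTimeIn_const ⟨le_rfl, ht.2⟩
  have hMρ := hF.condExp_stopped hMr hζ hM hC ht hρ
  -- The correction accumulated by time `t` is `F t`-measurable, so it may be subtracted inside the
  -- optional stopping identity for `M`.
  set S : Ω → ℝ := fun ω => M t ω - X t ω with hS
  have hSi : Integrable S P := (hbd hMr hC _ htc).sub (hbd hXr hXC _ htc)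
  have hSm : Measurable[F t] S := (hMr.adapted t ht).sub (hXr.adapted t ht)
  have h1 : P[(fun ω => M (min (σ ω) (τ ω)) ω) - S | F t] =ᵐ[P]
      P[fun ω => M (min (σ ω) (τ ω)) ω | F t] - P[S | F t] :=
    condExp_sub (hbd hMr hC _ hρ) hSi _
  rw [condExp_of_stronglyMeasurable (F.le t) hSm.stronglyMeasurable hSi] at h1
  have h2 : P[(fun ω => M (min (σ ω) (τ ω)) ω) - S | F t] ≤ᵐ[P]
      P[fun ω => X (min (σ ω) (τ ω)) ω + w ω | F t] := by
    refine condExp_mono ((hbd hMr hC _ hρ).sub hSi) ((hbd hXr hXC _ hρ).add hw) ?_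
    filter_upwards [hpath, hρ.2] with ω h3 h4
    have h5 := h3 _ h4.1 (min_le_right _ _)
    simp only [mul_sub, Finset.sum_sub_distrib] at h5
    have h6 := hX (min (σ ω) (τ ω)) ω
    have h7 := hX t ω
    simp only [Pi.sub_apply, hS]
    linarith
  filter_upwards [h1, h2, hMρ] with ω h3 h4 h5
  rw [h3, Pi.sub_apply, ← h5] at h4
  simp only [hS] at h4
  linarith

end OneSided

end MFDRBSDE

/-! ### Backward induction for a bounded Dynkin game. -/

namespace MFDRBSDE

open Filter Topology

theorem measurableSet_eq_real {Ω : Type*} {m : MeasurableSpace Ω} {f g : Ω → ℝ}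
    (hf : Measurable[m] f) (hg : Measurable[m] g) : MeasurableSet[m] {ω | f ω = g ω} :=
  measurableSet_eq_fun hf hg

section BoundedGame

variable {Ω : Type*} [m : MeasurableSpace Ω] {F : Filtration ℝ m} {P : Measure Ω}

/-- The value of the discrete-time Dynkin game `k` steps of length `h` before the horizon `b`. -/
noncomputable def backward (F : Filtration ℝ m) (P : Measure Ω) (b h : ℝ) (L U : ℝ → Ω → ℝ)
    (ξ : Ω → ℝ) : ℕ → Ω → ℝ
  | 0 => ξ
  | k + 1 => fun ω => max (L (b - (k + 1) * h) ω) (min (U (b - (k + 1) * h) ω)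
      ((P[backward F P b h L U ξ k | F (b - (k + 1) * h)]) ω))

theorem backward_spec {a b h : ℝ} (hh : 0 < h) {L U : ℝ → Ω → ℝ} (hL : RegularOn F a b L)
    (hU : RegularOn F a b U) (hLU : ∀ t ∈ Icc a b, ∀ ω, L t ω ≤ U t ω) {ξ : Ω → ℝ}
    (hξ : Measurable[F b] ξ) (hξ1 : ∀ ω, L b ω ≤ ξ ω ∧ ξ ω ≤ U b ω) {k : ℕ}
    (hk : a ≤ b - k * h) :
    Measurable[F (b - k * h)] (backward F P b h L U ξ k) ∧
      ∀ ω, L (b - k * h) ω ≤ backward F P b h L U ξ k ω ∧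
        backward F P b h L U ξ k ω ≤ U (b - k * h) ω := by
  cases k with
  | zero =>
    have h0 : b - ((0 : ℕ) : ℝ) * h = b := by simp
    rw [h0]
    exact ⟨hξ, hξ1⟩
  | succ k =>
    rw [Nat.cast_add_one] at hk ⊢
    have hmem : b - ((k : ℝ) + 1) * h ∈ Icc a b :=
      ⟨hk, sub_le_self _ (by positivity)⟩
    refine ⟨(hL.adapted _ hmem).max ((hU.adapted _ hmem).min
      stronglyMeasurable_condExp.measurable), fun ω => ⟨le_max_left _ _, ?_⟩⟩
    exact max_le (hLU _ hmem ω) (min_le_left _ _)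

/-- Approximate solution of a bounded Dynkin game by backward induction on a time grid. -/
theorem NullComplete.exists_approx_game [IsProbabilityMeasure P] (hF : NullComplete F P) {a b : ℝ}
    (hab : a < b)
    (hCM : ∀ ζ : Ω → ℝ, Measurable[F b] ζ → Integrable ζ P → HasContinuousVersion F P a b ζ)
    {L U : ℝ → Ω → ℝ} (hL : RegularOn F a b L) (hU : RegularOn F a b U) {R : ℝ}
    (hLR : ∀ t ∈ Icc a b, ∀ ω, |L t ω| ≤ R) (hUR : ∀ t ∈ Icc a b, ∀ ω, |U t ω| ≤ R)
    (hLU : ∀ t ∈ Icc a b, ∀ ω, L t ω ≤ U t ω) {ξ : Ω → ℝ}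
    (hξ : Measurable[F b] ξ) (hξ1 : ∀ ω, L b ω ≤ ξ ω ∧ ξ ω ≤ U b ω)
    {N : ℕ} {h : ℝ} (hh : 0 < h) (hN : b - N * h = a) {w : Ω → ℝ} (hw : Integrable w P)
    (hw0 : ∀ᵐ ω ∂P, 0 ≤ w ω)
    (hUw : ∀ t ∈ Icc a b, ∀ r ∈ Icc t b, r - t ≤ h → P[U r | F t] ≤ᵐ[P] fun ω => U t ω + w ω)
    (hLw : ∀ t ∈ Icc a b, ∀ r ∈ Icc t b, r - t ≤ h → (fun ω => L t ω - w ω) ≤ᵐ[P] P[L r | F t]) :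
    ∃ X, RegularOn F a b X ∧ (∃ C, ∀ᵐ ω ∂P, ∀ t ∈ Icc a b, |X t ω| ≤ C) ∧ X b =ᵐ[P] ξ ∧
      (∀ᵐ ω ∂P, ∀ t ∈ Icc a b, L t ω - 2 * w ω ≤ X t ω ∧ X t ω ≤ U t ω + 2 * w ω) ∧
      ∀ t ∈ Icc a b,
        (∃ τ, IsStoppingTimeIn F P t b τ ∧ (∀ᵐ ω ∂P, τ ω < b → X (τ ω) ω = L (τ ω) ω) ∧
          ∀ σ, IsStoppingTimeIn F P t b σ →
            X t ≤ᵐ[P] P[fun ω => X (min (σ ω) (τ ω)) ω + w ω | F t]) ∧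
        (∃ σ, IsStoppingTimeIn F P t b σ ∧ (∀ᵐ ω ∂P, σ ω < b → X (σ ω) ω = U (σ ω) ω) ∧
          ∀ τ, IsStoppingTimeIn F P t b τ →
            P[fun ω => X (min (τ ω) (σ ω)) ω - w ω | F t] ≤ᵐ[P] X t) := by
  set y := backward F P b h L U ξ with hydef
  set s : ℕ → ℝ := fun k => b - k * h with hs
  have hs1 : ∀ k, s (k + 1) = b - (k + 1) * h := fun k => by simp only [hs]; push_cast; ring
  have hs1' : ∀ k, s (k + 1) + h = s k := fun k => by rw [hs1]; simp only [hs]; ring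
  have hs_anti : ∀ {i j : ℕ}, i ≤ j → s j ≤ s i := fun hij =>
    sub_le_sub_left (mul_le_mul_of_nonneg_right (Nat.cast_le.2 hij) hh.le) _
  have hs0 : s 0 = b := by simp [hs]
  have hsN : s N = a := hN
  have hsmem : ∀ k ≤ N, s k ∈ Icc a b := fun k hk =>
    ⟨hsN ▸ hs_anti hk, hs0 ▸ hs_anti (Nat.zero_le k)⟩
  have hspec := fun k (hk : k ≤ N) => backward_spec (P := P) hh hL hU hLU hξ hξ1 (hsmem k hk).1
  have hym : ∀ k ≤ N, Measurable[F (s k)] (y k) := fun k hk => (hspec k hk).1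
  have hyL : ∀ k ≤ N, ∀ ω, L (s k) ω ≤ y k ω := fun k hk ω => ((hspec k hk).2 ω).1
  have hyU : ∀ k ≤ N, ∀ ω, y k ω ≤ U (s k) ω := fun k hk ω => ((hspec k hk).2 ω).2
  have hR0 : 0 ≤ R := by
    obtain ⟨ω⟩ : Nonempty Ω := nonempty_of_isProbabilityMeasure P
    exact (abs_nonneg _).trans (hLR a (left_mem_Icc.2 hab.le) ω)
  have hyR : ∀ k ≤ N, ∀ ω, |y k ω| ≤ R := fun k hk ω => abs_le.2
    ⟨(abs_le.1 (hLR _ (hsmem k hk) ω)).1.trans (hyL k hk ω),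
      (hyU k hk ω).trans (abs_le.1 (hUR _ (hsmem k hk) ω)).2⟩
  have hyi : ∀ k ≤ N, Integrable (y k) P := fun k hk =>
    Integrable.of_bound ((hym k hk).mono (F.le _) le_rfl).aestronglyMeasurable R
      (Eventually.of_forall (hyR k hk))
  have hbdi : ∀ {Z : ℝ → Ω → ℝ}, RegularOn F a b Z → (∀ t ∈ Icc a b, ∀ ω, |Z t ω| ≤ R) →
      ∀ t ∈ Icc a b, Integrable (Z t) P := fun hZ hZR t ht =>
    Integrable.of_bound (hZ.measurable t).aestronglyMeasurable R (Eventually.of_forall (hZR t ht))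
  have hcU : ∀ k < N, ∀ t ∈ Icc (s (k + 1)) (s k),
      P[y k | F t] ≤ᵐ[P] fun ω => U t ω + w ω := by
    intro k hk t ht
    have htab : t ∈ Icc a b := ⟨(hsmem (k + 1) hk).1.trans ht.1, ht.2.trans (hsmem k hk.le).2⟩
    exact (condExp_mono (hyi k hk.le) (hbdi hU hUR _ (hsmem k hk.le))
      (Eventually.of_forall (hyU k hk.le))).trans (hUw t htab (s k) ⟨ht.2, (hsmem k hk.le).2⟩
        (by linarith [hs1' k, ht.1]))
  have hcL : ∀ k < N, ∀ t ∈ Icc (s (k + 1)) (s k),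
      (fun ω => L t ω - w ω) ≤ᵐ[P] P[y k | F t] := by
    intro k hk t ht
    have htab : t ∈ Icc a b := ⟨(hsmem (k + 1) hk).1.trans ht.1, ht.2.trans (hsmem k hk.le).2⟩
    exact (hLw t htab (s k) ⟨ht.2, (hsmem k hk.le).2⟩ (by linarith [hs1' k, ht.1])).trans
      (condExp_mono (hbdi hL hLR _ (hsmem k hk.le)) (hyi k hk.le)
        (Eventually.of_forall (hyL k hk.le)))
  set p : ℕ → Ω → ℝ := fun k => P[y k | F (s (k + 1))]
  -- The correction forced by the obstacles in one step: it can be positive only where the lower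
  -- obstacle is attained and negative only where the upper one is.
  set D : ℕ → Ω → ℝ := fun k ω => y (k + 1) ω - p k ω with hD
  have hysucc : ∀ k ω, y (k + 1) ω = max (L (s (k + 1)) ω) (min (U (s (k + 1)) ω) (p k ω)) := by
    intro k ω
    simp only [hydef, backward, p, hs1]
  have hDm : ∀ k < N, Measurable[F (s (k + 1))] (D k) := fun k hk =>
    (hym (k + 1) hk).sub stronglyMeasurable_condExp.measurable
  have hDi : ∀ k < N, Integrable (D k) P := fun k hk => (hyi (k + 1) hk).sub integrable_condExp
  have hDR : ∀ k < N, ∀ᵐ ω ∂P, |D k ω| ≤ 2 * R := by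
    intro k hk
    filter_upwards [ae_bdd_abs_condExp_of_ae_bdd_abs (m := F (s (k + 1)))
      (Eventually.of_forall (hyR k hk.le) : ∀ᵐ ω ∂P, |y k ω| ≤ R)] with ω hω
    have := abs_sub (y (k + 1) ω) (p k ω)
    have h1 := hyR (k + 1) hk ω
    have h2 : |p k ω| ≤ R := hω
    simp only [hD]
    linarith
  -- One step of conditioning leaves the interval `[L, U]` by at most `w`, so projecting back onto
  -- it moves the value by at most `w`.
  have hDw : ∀ k < N, ∀ᵐ ω ∂P, |D k ω| ≤ w ω := by
    intro k hk
    have hle : s (k + 1) ≤ s k := hs_anti (Nat.le_succ k)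
    filter_upwards [hcU k hk _ ⟨le_rfl, hle⟩, hcL k hk _ ⟨le_rfl, hle⟩, hw0] with ω h1 h2 h3
    have h1' : p k ω ≤ U (s (k + 1)) ω + w ω := h1
    have h2' : L (s (k + 1)) ω - w ω ≤ p k ω := h2
    have h4 := hLU _ (hsmem (k + 1) hk) ω
    simp only [hD, hysucc]
    rcases le_total (U (s (k + 1)) ω) (p k ω) with h5 | h5
    · rw [min_eq_left h5, max_eq_right h4, abs_le]
      constructor <;> linarith
    · rw [min_eq_right h5]
      rcases le_total (L (s (k + 1)) ω) (p k ω) with h6 | h6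
      · rw [max_eq_right h6, sub_self, abs_zero]; exact h3
      · rw [max_eq_left h6, abs_le]
        constructor <;> linarith
  have hDL : ∀ k < N, ∀ ω, y (k + 1) ω ≠ L (s (k + 1)) ω → D k ω ≤ 0 := by
    intro k _ ω hne
    simp only [hD]
    rw [hysucc] at hne ⊢
    rcases le_total (L (s (k + 1)) ω) (min (U (s (k + 1)) ω) (p k ω)) with h5 | h5
    · rw [max_eq_right h5]
      linarith [min_le_right (U (s (k + 1)) ω) (p k ω)]
    · exact absurd (max_eq_left h5) hne
  have hDU : ∀ k < N, ∀ ω, y (k + 1) ω ≠ U (s (k + 1)) ω → 0 ≤ D k ω := by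
    intro k hk ω hne
    have h4 := hLU _ (hsmem (k + 1) hk) ω
    simp only [hD]
    rw [hysucc] at hne ⊢
    rcases le_total (U (s (k + 1)) ω) (p k ω) with h5 | h5
    · rw [min_eq_left h5, max_eq_right h4] at hne
      exact absurd rfl hne
    · rw [min_eq_right h5]
      linarith [le_max_right (L (s (k + 1)) ω) (p k ω)]
  -- Doob decomposition: restoring the corrections to `ξ` gives a variable whose conditional
  -- expectation at the grid time `s k` is `y k`.
  set ζ : ℕ → Ω → ℝ := fun k ω => ξ ω + ∑ j ∈ Finset.range k, D j ω with hζdef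
  have hy0 : y 0 = ξ := rfl
  have hζi : ∀ k ≤ N, Integrable (ζ k) P := fun k hk =>
    (hy0 ▸ hyi 0 (Nat.zero_le N)).add (integrable_finsetSum _ fun j hj =>
      hDi j ((Finset.mem_range.1 hj).trans_le hk))
  have hζm : Measurable[F b] (ζ N) :=
    hξ.add (Finset.measurable_sum _ fun j hj => (hDm j (Finset.mem_range.1 hj)).mono
      (F.mono (hsmem _ (Finset.mem_range.1 hj)).2) le_rfl)
  have hζy : ∀ k ≤ N, P[ζ k | F (s k)] =ᵐ[P] y k := by
    intro k
    induction k with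
    | zero =>
      intro _
      have h1 : ζ 0 = ξ := by ext ω; simp [hζdef]
      rw [h1, ← hy0, condExp_of_stronglyMeasurable (F.le _)
        ((hym 0 (Nat.zero_le N)).stronglyMeasurable) (hyi 0 (Nat.zero_le N))]
    | succ k ih =>
      intro hk
      have h1 : ζ (k + 1) = ζ k + D k := by
        ext ω; simp only [hζdef, Finset.sum_range_succ, Pi.add_apply]; ring
      have h2 : P[ζ (k + 1) | F (s (k + 1))] =ᵐ[P] P[ζ k | F (s (k + 1))] + D k := by
        rw [h1]
        refine (condExp_add (hζi k (Nat.le_of_succ_le hk)) (hDi k hk) _).trans ?_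
        rw [condExp_of_stronglyMeasurable (F.le _) (hDm k hk).stronglyMeasurable (hDi k hk)]
      have h3 : P[ζ k | F (s (k + 1))] =ᵐ[P] p k :=
        (condExp_condExp_of_le (F.mono (hs_anti (Nat.le_succ k))) (F.le _)).symm.trans
          (condExp_congr_ae (ih (Nat.le_of_succ_le hk)))
      filter_upwards [h2, h3] with ω h4 h5
      rw [h4, Pi.add_apply, h5]
      simp only [hD]; ring
  obtain ⟨M, hMr, hMζ⟩ := hCM (ζ N) hζm (hζi N le_rfl)
  -- The correction `D k` is already known at `s (k + 1)` and is removed linearly over `[s (k + 1),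
  -- s k]`. The interpolation is thus both adapted and continuous.
  set X : ℝ → Ω → ℝ := fun t ω =>
    M t ω - ∑ k ∈ Finset.range N, D k ω * ramp h (b - (k + 1) * h) t with hXdef
  have hXr : RegularOn F a b X := by
    refine hMr.sub ⟨fun ω => continuous_finsetSum _ fun k _ =>
      continuous_const.mul (continuous_ramp _ _), fun t _ => Finset.measurable_sum _ fun k hk => ?_,
      fun t => Finset.measurable_sum _ fun k hk =>
        ((hDm k (Finset.mem_range.1 hk)).mono (F.le _) le_rfl).mul_const _⟩
    rw [← hs1]
    rcases le_total t (s (k + 1)) with h1 | h1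
    · rw [ramp_of_le hh h1]
      simp only [mul_zero]
      exact measurable_const
    · exact ((hDm k (Finset.mem_range.1 hk)).mono (F.mono h1) le_rfl).mul_const _
  have hDR' : ∀ᵐ ω ∂P, ∀ k ∈ Finset.range N, |D k ω| ≤ 2 * R := by
    rw [Filter.eventually_all_finset]
    exact fun k hk => hDR k (Finset.mem_range.1 hk)
  have hMC : ∀ᵐ ω ∂P, ∀ t ∈ Icc a b, |M t ω| ≤ R + N * (2 * R) := by
    have hζC : ∀ᵐ ω ∂P, |ζ N ω| ≤ R + N * (2 * R) := by
      filter_upwards [hDR'] with ω hω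
      refine (abs_add_le _ _).trans (add_le_add (hyR 0 (Nat.zero_le N) ω) ?_)
      refine (Finset.abs_sum_le_sum_abs _ _).trans ((Finset.sum_le_sum hω).trans ?_)
      rw [Finset.sum_const, Finset.card_range, nsmul_eq_mul]
    refine ae_forall_le_of_forall_ae_le hab.le (fun ω => (hMr.continuous ω).abs)
      (g := fun _ _ => R + N * (2 * R)) (fun ω => continuous_const) fun t ht => ?_
    filter_upwards [hMζ t ht, ae_bdd_abs_condExp_of_ae_bdd_abs (m := F t) hζC] with ω h1 h2
    rw [h1]; exact h2
  -- This bound grows with the number of grid points, but only its finiteness is needed.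
  set C : ℝ := R + N * (2 * R) + N * (2 * R) with hC
  have hN0 : (0 : ℝ) ≤ N * (2 * R) := by positivity
  have hMC' : ∀ᵐ ω ∂P, ∀ t ∈ Icc a b, |M t ω| ≤ C := hMC.mono fun ω hω t ht =>
    (hω t ht).trans (by linarith)
  have hXC : ∀ᵐ ω ∂P, ∀ t ∈ Icc a b, |X t ω| ≤ C := by
    filter_upwards [hMC, hDR'] with ω h1 h2 t ht
    refine (abs_sub _ _).trans (add_le_add (h1 t ht) ?_)
    refine (Finset.abs_sum_le_sum_abs _ _).trans ((Finset.sum_le_sum (g := fun _ => 2 * R)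
      fun k hk => ?_).trans ?_)
    · rw [abs_mul, abs_of_nonneg (ramp_nonneg _ _ _)]
      exact (mul_le_of_le_one_right (abs_nonneg _) (ramp_le_one _ _ _)).trans (h2 k hk)
    · rw [Finset.sum_const, Finset.card_range, nsmul_eq_mul]
  -- At time `t` the later ramps have not started and the earlier ones are complete, so only `D k`
  -- remains. This gives `X (s k) = y k` on the grid and keeps `X` within `2 * w` of the obstacles
  -- between grid points.
  have hXt : ∀ k < N, ∀ t ∈ Icc (s (k + 1)) (s k),
      X t =ᵐ[P] fun ω => (P[y k | F t]) ω + D k ω * (1 - ramp h (s (k + 1)) t) := by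
    intro k hk t ht
    have htab : t ∈ Icc a b := ⟨(hsmem (k + 1) hk).1.trans ht.1, ht.2.trans (hsmem k hk.le).2⟩
    set E : Ω → ℝ := fun ω => ∑ j ∈ Finset.Ico k N, D j ω with hE
    have hEm : Measurable[F t] E := Finset.measurable_sum _ fun j hj =>
      (hDm j (Finset.mem_Ico.1 hj).2).mono
        (F.mono ((hs_anti (Nat.succ_le_succ (Finset.mem_Ico.1 hj).1)).trans ht.1)) le_rfl
    have hEi : Integrable E P := integrable_finsetSum _ fun j hj => hDi j (Finset.mem_Ico.1 hj).2
    have h1 : ζ N = ζ k + E := by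
      ext ω
      simp only [hζdef, hE, Pi.add_apply, add_assoc]
      rw [Finset.sum_range_add_sum_Ico _ hk.le]
    have h2 : P[ζ N | F t] =ᵐ[P] P[ζ k | F t] + E := by
      rw [h1]
      refine (condExp_add (hζi k hk.le) hEi _).trans ?_
      rw [condExp_of_stronglyMeasurable (F.le _) hEm.stronglyMeasurable hEi]
    have h3 : P[ζ k | F t] =ᵐ[P] P[y k | F t] :=
      (condExp_condExp_of_le (F.mono ht.2) (F.le _)).symm.trans (condExp_congr_ae (hζy k hk.le))
    filter_upwards [hMζ t htab, h2, h3] with ω h4 h5 h6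
    simp only [hXdef]
    rw [h4, h5, Pi.add_apply, h6]
    have h7 : ∑ j ∈ Finset.range N, D j ω * ramp h (b - (j + 1) * h) t =
        ∑ j ∈ Finset.Ico k N, D j ω * ramp h (b - (j + 1) * h) t := by
      rw [← Finset.sum_range_add_sum_Ico _ hk.le, add_eq_right]
      refine Finset.sum_eq_zero fun j hj => ?_
      rw [← hs1, ramp_of_le hh (ht.2.trans (hs_anti (Finset.mem_range.1 hj))), mul_zero]
    have h8 : ∑ j ∈ Finset.Ico (k + 1) N, D j ω * ramp h (b - (j + 1) * h) t =
        ∑ j ∈ Finset.Ico (k + 1) N, D j ω := by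
      refine Finset.sum_congr rfl fun j hj => ?_
      rw [← hs1, ramp_of_ge hh, mul_one]
      rw [hs1']
      exact (hs_anti (Finset.mem_Ico.1 hj).1).trans ht.1
    rw [h7, Finset.sum_eq_sum_Ico_succ_bot hk, h8]
    simp only [hE]
    rw [Finset.sum_eq_sum_Ico_succ_bot hk, hs1]
    ring
  have hXb : X b =ᵐ[P] ξ := by
    have h1 := hMζ b (right_mem_Icc.2 hab.le)
    rw [condExp_of_stronglyMeasurable (F.le _) hζm.stronglyMeasurable (hζi N le_rfl)] at h1
    filter_upwards [h1] with ω hω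
    simp only [hXdef, hω, hζdef]
    rw [add_sub_assoc, ← Finset.sum_sub_distrib, Finset.sum_eq_zero, add_zero]
    intro j _
    rw [ramp_of_ge hh, mul_one, sub_self]
    rw [← hs1, hs1', ← hs0]
    exact hs_anti (Nat.zero_le j)
  have hXs : ∀ k ≤ N, X (s k) =ᵐ[P] y k := by
    rintro (_ | k) hk
    · rw [hs0]; exact hXb
    · have h1 := hXt k hk (s (k + 1)) ⟨le_rfl, hs_anti (Nat.le_succ k)⟩
      filter_upwards [h1] with ω hω
      rw [hω, ramp_of_le hh le_rfl]
      simp only [hD, p]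
      ring
  have hXs' : ∀ᵐ ω ∂P, ∀ k ≤ N, X (s k) ω = y k ω := by
    have : ∀ᵐ ω ∂P, ∀ k ∈ Finset.range (N + 1), X (s k) ω = y k ω := by
      rw [Filter.eventually_all_finset]
      exact fun k hk => hXs k (Nat.lt_succ_iff.1 (Finset.mem_range.1 hk))
    exact this.mono fun ω hω k hk => hω k (Finset.mem_range.2 (Nat.lt_succ_of_le hk))
  have hgrid : ∀ t ∈ Icc a b, ∃ k < N, t ∈ Icc (s (k + 1)) (s k) := by
    intro t ht
    have hNpos : 0 < N := by
      rcases Nat.eq_zero_or_pos N with h0 | h0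
      · rw [h0] at hN; simp at hN; linarith
      · exact h0
    set k := Nat.find (⟨N, hsN.le.trans ht.1⟩ : ∃ k, s k ≤ t) with hk
    have h1 : s k ≤ t := Nat.find_spec (⟨N, hsN.le.trans ht.1⟩ : ∃ k, s k ≤ t)
    have h2 : k ≤ N := Nat.find_min' _ (hsN.le.trans ht.1)
    rcases Nat.eq_zero_or_pos k with h3 | h3
    · refine ⟨0, hNpos, (hs_anti (Nat.le_succ 0)).trans (h3 ▸ h1), hs0 ▸ ht.2⟩
    · obtain ⟨j, hj⟩ := Nat.exists_eq_succ_of_ne_zero h3.ne'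
      have h4 : ¬ s j ≤ t := Nat.find_min (⟨N, hsN.le.trans ht.1⟩ : ∃ k, s k ≤ t) (by omega)
      refine ⟨j, by omega, ?_, (not_le.1 h4).le⟩
      rw [← Nat.succ_eq_add_one, ← hj]
      exact h1
  have hXLU : ∀ᵐ ω ∂P, ∀ t ∈ Icc a b, L t ω - 2 * w ω ≤ X t ω ∧ X t ω ≤ U t ω + 2 * w ω := by
    have h1 : ∀ t ∈ Icc a b, ∀ᵐ ω ∂P, L t ω - 2 * w ω ≤ X t ω ∧ X t ω ≤ U t ω + 2 * w ω := by
      intro t ht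
      obtain ⟨k, hk, htk⟩ := hgrid t ht
      filter_upwards [hXt k hk t htk, hcU k hk t htk, hcL k hk t htk, hDw k hk] with ω h1 h2 h3 h4
      have h5 : |D k ω * (1 - ramp h (s (k + 1)) t)| ≤ w ω := by
        rw [abs_mul, abs_of_nonneg (sub_nonneg.2 (ramp_le_one _ _ _))]
        exact (mul_le_of_le_one_right (abs_nonneg _)
          (by linarith [ramp_nonneg h (s (k + 1)) t])).trans h4
      have h6 := abs_le.1 h5
      rw [h1]
      constructor <;> linarith
    filter_upwards [ae_forall_le_of_forall_ae_le (P := P) (f := fun t ω => L t ω - 2 * w ω)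
      (g := X) hab.le (fun ω => (hL.continuous ω).sub continuous_const) hXr.continuous
      fun t ht => (h1 t ht).mono fun ω hω => hω.1,
      ae_forall_le_of_forall_ae_le (P := P) (f := X) (g := fun t ω => U t ω + 2 * w ω)
      hab.le hXr.continuous (fun ω => (hU.continuous ω).add continuous_const)
      fun t ht => (h1 t ht).mono fun ω hω => hω.2] with ω h2 h3 t ht
    exact ⟨h2 t ht, h3 t ht⟩
  refine ⟨X, hXr, ⟨C, hXC⟩, hXb, hXLU, fun t ht => ⟨?_, ?_⟩⟩
  · obtain ⟨τ, hτ, hτA, hτσ⟩ := hF.exists_stoppingTime_submartingale hMr hXr (hζi N le_rfl) hMζ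
      hMC' hXC hh (D := D) hw hw0 (fun t ω => rfl) (A := fun k => {ω | y k ω = L (s k) ω})
      (fun k hk => measurableSet_eq_real (hym k hk) (hL.adapted _ (hsmem k hk)))
      (fun k hk ω hω => hDL k hk ω hω) (fun k hk => (hDw k hk).mono fun ω hω =>
        (le_abs_self _).trans hω) ht
    refine ⟨τ, hτ, ?_, hτσ⟩
    filter_upwards [hXs'] with ω hω hlt
    rcases hτA ω with h1 | ⟨k, hk, h1, h2⟩
    · exact absurd h1 hlt.ne
    · rw [h1]
      exact (hω k hk).trans h2
  · have hneg : ∀ {Z : ℝ → Ω → ℝ}, RegularOn F a b Z → RegularOn F a b fun t ω => -Z t ω :=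
      fun hZ => hZ.comp continuous_neg
    -- The minimizing player is handled by symmetry: the same estimate for `-X` with corrections
    -- `-D`.
    obtain ⟨σ, hσ, hσA, hστ⟩ := hF.exists_stoppingTime_submartingale (hneg hMr) (hneg hXr)
      (ζ := fun ω => -ζ N ω) (hζi N le_rfl).neg
      (fun t ht => ((hMζ t ht).fun_comp Neg.neg).trans (condExp_neg (ζ N) (F t)).symm)
      (C := C) (by simpa only [abs_neg] using hMC') (by simpa only [abs_neg] using hXC) hh
      (D := fun k ω => -D k ω) hw hw0
      (fun t ω => by simp only [hXdef, neg_mul, Finset.sum_neg_distrib]; ring)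
      (A := fun k => {ω | y k ω = U (s k) ω})
      (fun k hk => measurableSet_eq_real (hym k hk) (hU.adapted _ (hsmem k hk)))
      (fun k hk ω hω => neg_nonpos.2 (hDU k hk ω hω)) (fun k hk => (hDw k hk).mono fun ω hω =>
        (neg_le_abs _).trans hω) ht
    refine ⟨σ, hσ, ?_, fun τ hτ => ?_⟩
    · filter_upwards [hXs'] with ω hω hlt
      rcases hσA ω with h1 | ⟨k, hk, h1, h2⟩
      · exact absurd h1 hlt.ne
      · rw [h1]
        exact (hω k hk).trans h2
    · have h1 := condExp_neg (μ := P) (fun ω => X (min (τ ω) (σ ω)) ω - w ω) (F t)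
      have h2 : -(fun ω => X (min (τ ω) (σ ω)) ω - w ω) =
          fun ω => -X (min (τ ω) (σ ω)) ω + w ω := by
        ext ω; simp only [Pi.neg_apply]; ring
      rw [h2] at h1
      filter_upwards [hστ τ hτ, h1] with ω h3 h4
      rw [h4, Pi.neg_apply] at h3
      linarith

end BoundedGame

end MFDRBSDE

/-! ### Approximate saddle points of bounded games. -/

namespace MFDRBSDE

open Filter Topology

theorem measurableSet_lt_abs_sub {Ω : Type*} {m : MeasurableSpace Ω} {f g : Ω → ℝ}
    (hf : Measurable[m] f) (hg : Measurable[m] g) (ε : ℝ) :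
    MeasurableSet[m] {ω | ε < |f ω - g ω|} :=
  measurableSet_lt measurable_const (hf.sub hg).abs

section ApproxSaddle

variable {Ω : Type*} [m : MeasurableSpace Ω] {F : Filtration ℝ m} {P : Measure Ω}

/-- The paths of a continuous process are uniformly equicontinuous off a set of small measure. -/
theorem RegularOn.exists_modulus [IsFiniteMeasure P] {a b : ℝ} (hab : a ≤ b) {Z : ℝ → Ω → ℝ}
    (hZ : RegularOn F a b Z) {ε η : ℝ} (hε : 0 < ε) (hη : 0 < η) :
    ∃ h : ℝ, 0 < h ∧ ∃ B, MeasurableSet[F b] B ∧ P B ≤ ENNReal.ofReal η ∧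
      ∀ ω ∉ B, ∀ s ∈ Icc a b, ∀ r ∈ Icc a b, |s - r| ≤ h → |Z s ω - Z r ω| ≤ ε := by
  set p : ℝ → ℝ := fun x => max a (min x b) with hp
  have hpc : Continuous p := by fun_prop
  have hpm : ∀ x, p x ∈ Icc a b := fun x => ⟨le_max_left _ _, max_le hab (min_le_right _ _)⟩
  have hpe : ∀ x ∈ Icc a b, p x = x := fun x hx => by
    simp only [hp]; rw [min_eq_left hx.2, max_eq_right hx.1]
  -- Rational pairs, clamped to `[a,b]` by `p`, make these events measurable. They decrease to the
  -- empty set because each path is uniformly continuous on `[a,b]`.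
  set B : ℕ → Set Ω := fun n => ⋃ q : ℚ × ℚ, ⋃ (_ : |(q.1 : ℝ) - q.2| < 1 / ((n : ℝ) + 1)),
    {ω | ε < |Z (p q.1) ω - Z (p q.2) ω|} with hB
  have hZm : ∀ x, Measurable[F b] (Z (p x)) := fun x =>
    (hZ.adapted _ (hpm x)).mono (F.mono (hpm x).2) le_rfl
  have hBm : ∀ n, MeasurableSet[F b] (B n) := fun n =>
    MeasurableSet.iUnion fun q => MeasurableSet.iUnion fun _ =>
      measurableSet_lt_abs_sub (hZm _) (hZm _) ε
  have hanti : Antitone B := by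
    intro i j hij
    refine iUnion_mono fun q => iUnion_mono' fun h => ⟨h.trans_le ?_, subset_rfl⟩
    gcongr
  have hemp : ⋂ n, B n = ∅ := by
    refine eq_empty_iff_forall_notMem.2 fun ω hω => ?_
    have huc : UniformContinuous fun x : Icc a b => Z x ω :=
      CompactSpace.uniformContinuous_of_continuous ((hZ.continuous ω).comp continuous_subtype_val)
    obtain ⟨δ, hδ, h⟩ := Metric.uniformContinuous_iff.1 huc ε hε
    obtain ⟨n, hn⟩ := exists_nat_one_div_lt hδ
    obtain ⟨q, hq⟩ := mem_iUnion.1 (mem_iInter.1 hω n)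
    obtain ⟨hq1, hq2⟩ := mem_iUnion.1 hq
    have h1 : |p q.1 - p q.2| ≤ |(q.1 : ℝ) - q.2| := by
      refine (abs_max_sub_max_le_max _ _ _ _).trans ?_
      rw [sub_self, abs_zero, max_eq_right (abs_nonneg _)]
      refine (abs_min_sub_min_le_max _ _ _ _).trans ?_
      rw [sub_self, abs_zero, max_eq_left (abs_nonneg _)]
    have h2 := h (a := ⟨p q.1, hpm _⟩) (b := ⟨p q.2, hpm _⟩)
      (by rw [Subtype.dist_eq, Real.dist_eq]; exact (h1.trans_lt hq1).trans hn)
    rw [Real.dist_eq] at h2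
    exact lt_asymm h2 hq2
  have hlim := tendsto_measure_iInter_atTop (μ := P)
    (fun n => ((F.le b _ (hBm n))).nullMeasurableSet) hanti ⟨0, measure_ne_top _ _⟩
  rw [hemp, measure_empty] at hlim
  obtain ⟨n, hn⟩ := ((ENNReal.tendsto_nhds_zero.1 hlim) _ (ENNReal.ofReal_pos.2 hη)).exists
  -- A mesh strictly below `1 / (n + 1)` puts a violating pair in an open set, which then contains a
  -- rational pair.
  refine ⟨1 / ((n : ℝ) + 2), by positivity, B n, hBm n, hn, fun ω hω s hs r hr hsr => ?_⟩
  by_contra! hlt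
  have hopen : IsOpen {x : ℝ × ℝ | |x.1 - x.2| < 1 / ((n : ℝ) + 1) ∧
      ε < |Z (p x.1) ω - Z (p x.2) ω|} := by
    have hc := hZ.continuous ω
    have h1 : Continuous fun x : ℝ × ℝ => |Z (p x.1) ω - Z (p x.2) ω| := by fun_prop
    have h2 : Continuous fun x : ℝ × ℝ => |x.1 - x.2| := by fun_prop
    exact (isOpen_lt h2 continuous_const).inter (isOpen_lt continuous_const h1)
  obtain ⟨q, hq⟩ := (DenseRange.prodMap Rat.denseRange_cast Rat.denseRange_cast).exists_mem_open
    hopen ⟨(s, r), hsr.trans_lt (by gcongr; norm_num), by rwa [hpe s hs, hpe r hr]⟩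
  exact hω (mem_iUnion.2 ⟨q, mem_iUnion.2 ⟨hq.1, hq.2⟩⟩)

/-- The payoff of the Dynkin game with obstacles `L`, `U` and terminal value `ξ` when the players
stop at the times `x` and `y`. -/
noncomputable def gamePayoff (b : ℝ) (L U : ℝ → Ω → ℝ) (ξ : Ω → ℝ) (x y : ℝ) (ω : Ω) : ℝ :=
  if y < x then U y ω else if x < b then L x ω else ξ ω

theorem measurable_gamePayoff {b : ℝ} {L U : ℝ → Ω → ℝ}
    (hL : Measurable fun p : ℝ × Ω => L p.1 p.2) (hU : Measurable fun p : ℝ × Ω => U p.1 p.2)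
    {ξ : Ω → ℝ} (hξ : Measurable ξ) {τ σ : Ω → ℝ} (hτ : Measurable τ)
    (hσ : Measurable σ) : Measurable fun ω => gamePayoff b L U ξ (τ ω) (σ ω) ω :=
  Measurable.ite (measurableSet_lt hσ hτ) (hU.comp (hσ.prodMk measurable_id))
    (Measurable.ite (measurableSet_lt hτ measurable_const) (hL.comp (hτ.prodMk measurable_id)) hξ)

theorem abs_gamePayoff_le {Ω : Type*} (b : ℝ) (L U : ℝ → Ω → ℝ) (ξ : Ω → ℝ) (x y : ℝ) (ω : Ω) :
    |gamePayoff b L U ξ x y ω| ≤ |L x ω| + |U y ω| + |ξ ω| := by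
  unfold gamePayoff
  split_ifs <;> linarith [abs_nonneg (L x ω), abs_nonneg (U y ω), abs_nonneg (ξ ω)]

theorem integrable_gamePayoff {a b : ℝ} {L U : ℝ → Ω → ℝ} (hL : RegularOn F a b L)
    (hU : RegularOn F a b U) (hLn : normOne F P a b L < ∞) (hUn : normOne F P a b U < ∞)
    {ξ : Ω → ℝ} (hξ : Measurable ξ) (hξi : Integrable ξ P) {τ σ : Ω → ℝ}
    (hτ : IsStoppingTimeIn F P a b τ) (hσ : IsStoppingTimeIn F P a b σ) :
    Integrable (fun ω => gamePayoff b L U ξ (τ ω) (σ ω) ω) P :=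
  (((hL.integrable_comp hLn hτ).abs.add (hU.integrable_comp hUn hσ).abs).add hξi.abs).mono'
    (measurable_gamePayoff hL.measurable_uncurry hU.measurable_uncurry hξ hτ.measurable
      hσ.measurable).aestronglyMeasurable
    (Eventually.of_forall fun _ => abs_gamePayoff_le _ _ _ _ _ _ _)

/-- A bounded Dynkin game has approximate saddle points, with a continuous approximate value. -/
theorem NullComplete.exists_approx_saddle_of_bounded [IsProbabilityMeasure P]
    (hF : NullComplete F P) {a b : ℝ} (hab : a < b)
    (hCM : ∀ ζ : Ω → ℝ, Measurable[F b] ζ → Integrable ζ P → HasContinuousVersion F P a b ζ)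
    {L U : ℝ → Ω → ℝ} (hL : RegularOn F a b L) (hU : RegularOn F a b U) {R : ℝ}
    (hLR : ∀ t ∈ Icc a b, ∀ ω, |L t ω| ≤ R) (hUR : ∀ t ∈ Icc a b, ∀ ω, |U t ω| ≤ R)
    (hLU : ∀ t ∈ Icc a b, ∀ ω, L t ω ≤ U t ω) {ξ : Ω → ℝ}
    (hξ : Measurable[F b] ξ) (hξ1 : ∀ ω, L b ω ≤ ξ ω ∧ ξ ω ≤ U b ω) {ε : ℝ} (hε : 0 < ε) :
    ∃ X w, RegularOn F a b X ∧ (∃ C, ∀ᵐ ω ∂P, ∀ t ∈ Icc a b, |X t ω| ≤ C) ∧ X b =ᵐ[P] ξ ∧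
      Integrable w P ∧ (∀ᵐ ω ∂P, 0 ≤ w ω) ∧ ∫ ω, w ω ∂P ≤ ε ∧
      ∀ t ∈ Icc a b,
        (∃ τ, IsStoppingTimeIn F P t b τ ∧ ∀ σ, IsStoppingTimeIn F P t b σ →
          X t ≤ᵐ[P] P[fun ω => gamePayoff b L U ξ (τ ω) (σ ω) ω + w ω | F t]) ∧
        (∃ σ, IsStoppingTimeIn F P t b σ ∧ ∀ τ, IsStoppingTimeIn F P t b τ →
          P[fun ω => gamePayoff b L U ξ (τ ω) (σ ω) ω - w ω | F t] ≤ᵐ[P] X t) := by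
  have hR0 : 0 ≤ R := by
    obtain ⟨ω⟩ : Nonempty Ω := nonempty_of_isProbabilityMeasure P
    exact (abs_nonneg _).trans (hLR b ⟨hab.le, le_rfl⟩ ω)
  -- Below, `∫ w ≤ e (1 + 2R) + 2R · 2e = e (1 + 6R) = ε / 3`. The final error is `3 * w`: twice `w`
  -- from the obstacles and once from the submartingale estimate.
  set e : ℝ := ε / (3 * (1 + 6 * R)) with he
  have he0 : 0 < e := by positivity
  obtain ⟨h1, hh1, B1, hB1, hPB1, hmod1⟩ := hL.exists_modulus (P := P) hab.le he0
    (show 0 < e ^ 2 by positivity)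
  obtain ⟨h2, hh2, B2, hB2, hPB2, hmod2⟩ := hU.exists_modulus (P := P) hab.le he0
    (show 0 < e ^ 2 by positivity)
  obtain ⟨N, hNpos, hN⟩ : ∃ N : ℕ, 0 < N ∧ (b - a) / N ≤ min h1 h2 := by
    obtain ⟨N, hN⟩ := exists_nat_gt ((b - a) / min h1 h2)
    have hm : 0 < min h1 h2 := lt_min hh1 hh2
    have hN0 : (0 : ℝ) < N := lt_of_le_of_lt (div_nonneg (by linarith) hm.le) hN
    refine ⟨N, Nat.cast_pos.1 hN0, ?_⟩
    rw [div_lt_iff₀ hm] at hN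
    rw [div_le_iff₀ hN0]
    linarith
  have hN0 : (0 : ℝ) < N := Nat.cast_pos.2 hNpos
  set h : ℝ := (b - a) / N with hh
  have hh0 : 0 < h := div_pos (by linarith) hN0
  set B := B1 ∪ B2 with hBdef
  have hBm : MeasurableSet[F b] B := hB1.union hB2
  have hBm' : MeasurableSet B := F.le b _ hBm
  have hBi : Integrable (B.indicator (1 : Ω → ℝ)) P := (integrable_const 1).indicator hBm'
  have hPB : P.real B ≤ 2 * e ^ 2 := by
    refine ENNReal.toReal_le_of_le_ofReal (by positivity) ((measure_union_le _ _).trans ?_)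
    rw [two_mul, ENNReal.ofReal_add (by positivity) (by positivity)]
    exact add_le_add hPB1 hPB2
  -- `M` is a continuous version of the conditional probability of the bad event `B`. As `P B ≤ 2
  -- e²`, the maximal inequality keeps `|M|` below `e` at all times outside an event of probability
  -- at most `2 e`.
  obtain ⟨M, hMr, hMB⟩ := hCM (B.indicator 1)
    ((measurable_const.indicator hBm : Measurable[F b] (B.indicator (fun _ => (1 : ℝ))))) hBi
  have hMn : normOne F P a b M ≤ ENNReal.ofReal (2 * e ^ 2) := by
    have := hF.normOne_sub_le_of_condExp hab.le hMr
      (regularOn_of_deterministic (φ := fun _ => 0) continuous_const) hBi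
      (integrable_const 0) hMB (fun t _ => by
        show (fun _ => (0 : ℝ)) =ᵐ[P] P[fun _ => (0 : ℝ) | F t]
        rw [condExp_const (F.le t)])
    simp only [sub_zero] at this
    refine this.trans (ENNReal.ofReal_le_ofReal ?_)
    have h3 : (fun ω => |B.indicator (1 : Ω → ℝ) ω|) = B.indicator 1 := by
      ext ω; by_cases hω : ω ∈ B <;> simp [hω]
    rw [h3, integral_indicator_one hBm']
    exact hPB
  set S : Set Ω := toMeasurable P {ω | ∃ t ∈ Icc a b, e < |M t ω|} with hS
  have hSm : MeasurableSet S := measurableSet_toMeasurable _ _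
  have hPS : P.real S ≤ 2 * e := by
    have h3 := (hMr.maximal_inequality (P := P) hab e).trans hMn
    rw [← measure_toMeasurable, show 2 * e ^ 2 = e * (2 * e) by ring,
      ENNReal.ofReal_mul he0.le] at h3
    exact ENNReal.toReal_le_of_le_ofReal (by positivity)
      ((ENNReal.mul_le_mul_iff_right (ENNReal.ofReal_pos.2 he0).ne' ENNReal.ofReal_ne_top).1 h3)
  -- A time-independent bound for `e + 2R M_t`: off `S` one has `M_t ≤ e`, and on `S` the bound `M_t
  -- ≤ 1` is enough.
  set w : Ω → ℝ := fun ω => e * (1 + 2 * R) + 2 * R * S.indicator 1 ω with hw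
  have hSi : Integrable (S.indicator (1 : Ω → ℝ)) P := (integrable_const 1).indicator hSm
  have hwi : Integrable w P := (integrable_const _).add (hSi.const_mul _)
  have hw0 : ∀ ω, 0 ≤ w ω := fun ω => by
    have : 0 ≤ S.indicator (1 : Ω → ℝ) ω := indicator_nonneg (fun _ _ => zero_le_one) ω
    simp only [hw]; positivity
  have hwint : ∫ ω, w ω ∂P ≤ ε / 3 := by
    have h3 : ∫ ω, w ω ∂P = e * (1 + 2 * R) + 2 * R * P.real S := by
      rw [hw, integral_add (integrable_const _) (hSi.const_mul _), integral_const_mul (2 * R),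
        integral_indicator_one hSm]
      simp
    rw [h3]
    have h4 : e * (1 + 6 * R) = ε / 3 := by rw [he]; field_simp
    nlinarith
  have hMw : ∀ t ∈ Icc a b, ∀ᵐ ω ∂P, e + 2 * R * M t ω ≤ w ω := by
    intro t ht
    have h3 : P[B.indicator (1 : Ω → ℝ) | F t] ≤ᵐ[P] P[fun _ => (1 : ℝ) | F t] :=
      condExp_mono hBi (integrable_const _) (Eventually.of_forall fun ω => by
        by_cases hω : ω ∈ B <;> simp [hω])
    rw [condExp_const (F.le t)] at h3
    filter_upwards [hMB t ht, h3] with ω h4 h5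
    by_cases hω : ω ∈ S
    · simp only [hw, indicator_of_mem hω, Pi.one_apply]
      rw [← h4] at h5
      nlinarith
    · have h6 : |M t ω| ≤ e := by
        by_contra! hlt
        exact hω (subset_toMeasurable _ _ ⟨t, ht, hlt⟩)
      simp only [hw, indicator_of_notMem hω]
      nlinarith [le_abs_self (M t ω)]
  have hcond : ∀ Z : ℝ → Ω → ℝ, RegularOn F a b Z → (∀ t ∈ Icc a b, ∀ ω, |Z t ω| ≤ R) →
      (∀ ω ∉ B, ∀ s ∈ Icc a b, ∀ r ∈ Icc a b, |s - r| ≤ h → |Z s ω - Z r ω| ≤ e) →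
      ∀ t ∈ Icc a b, ∀ r ∈ Icc t b, r - t ≤ h →
        P[Z r | F t] ≤ᵐ[P] fun ω => Z t ω + w ω := by
    intro Z hZ hZR hmod t ht r hr hrt
    have hr' : r ∈ Icc a b := ⟨ht.1.trans hr.1, hr.2⟩
    have hZi : ∀ s ∈ Icc a b, Integrable (Z s) P := fun s hs =>
      Integrable.of_bound (hZ.measurable s).aestronglyMeasurable R
        (Eventually.of_forall (hZR s hs))
    -- Off `B` the oscillation over one step is at most `e`, and on `B` it is at most `2 * R`;
    -- conditioning turns the indicator into `M t`.
    have h3 : Z r ≤ᵐ[P] Z t + fun ω => e + 2 * R * B.indicator 1 ω := by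
      refine Eventually.of_forall fun ω => ?_
      simp only [Pi.add_apply]
      by_cases hω : ω ∈ B
      · rw [indicator_of_mem hω]
        have h4 := abs_le.1 (hZR r hr' ω)
        have h5 := abs_le.1 (hZR t ht ω)
        simp only [Pi.one_apply]
        linarith
      · rw [indicator_of_notMem hω]
        have := abs_le.1 (hmod ω hω r hr' t ht (by rwa [abs_of_nonneg (by linarith [hr.1])]))
        linarith
    have hBi' : Integrable (fun ω => e + 2 * R * B.indicator (1 : Ω → ℝ) ω) P :=
      (integrable_const _).add (hBi.const_mul _)
    have h4 := condExp_mono (m := F t) (hZi r hr') ((hZi t ht).add hBi') h3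
    have h5 := condExp_add (hZi t ht) hBi' (F t)
    have h6 : P[fun ω => e + 2 * R * B.indicator (1 : Ω → ℝ) ω | F t] =ᵐ[P]
        fun ω => e + 2 * R * (P[B.indicator (1 : Ω → ℝ) | F t]) ω := by
      refine (condExp_add (integrable_const e) (hBi.const_mul _) (F t)).trans ?_
      filter_upwards [condExp_smul (μ := P) (2 * R) (B.indicator (1 : Ω → ℝ)) (F t)] with ω h7
      rw [Pi.add_apply, condExp_const (F.le t)]
      exact congrArg _ h7
    rw [condExp_of_stronglyMeasurable (F.le t) (hZ.adapted t ht).stronglyMeasurable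
      (hZi t ht)] at h5
    filter_upwards [h4, h5, h6, hMB t ht, hMw t ht] with ω h7 h8 h9 h10 h11
    rw [h8, Pi.add_apply, h9, ← h10] at h7
    linarith
  have hmodL : ∀ ω ∉ B, ∀ s ∈ Icc a b, ∀ r ∈ Icc a b, |s - r| ≤ h → |L s ω - L r ω| ≤ e :=
    fun ω hω s hs r hr hsr => hmod1 ω (fun h => hω (Or.inl h)) s hs r hr
      ((hsr.trans hN).trans (min_le_left _ _))
  have hmodU : ∀ ω ∉ B, ∀ s ∈ Icc a b, ∀ r ∈ Icc a b, |s - r| ≤ h → |U s ω - U r ω| ≤ e :=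
    fun ω hω s hs r hr hsr => hmod2 ω (fun h => hω (Or.inr h)) s hs r hr
      ((hsr.trans hN).trans (min_le_right _ _))
  have hLw : ∀ t ∈ Icc a b, ∀ r ∈ Icc t b, r - t ≤ h →
      (fun ω => L t ω - w ω) ≤ᵐ[P] P[L r | F t] := by
    intro t ht r hr hrt
    have h3 := hcond (fun s ω => -L s ω) (hL.comp continuous_neg)
      (fun s hs ω => by rw [abs_neg]; exact hLR s hs ω)
      (fun ω hω s hs r hr hsr => by
        rw [neg_sub_neg, abs_sub_comm]; exact hmodL ω hω s hs r hr hsr) t ht r hr hrt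
    filter_upwards [h3, condExp_neg (μ := P) (L r) (F t)] with ω h4 h5
    have h6 : (P[fun ω => -L r ω | F t]) ω = -(P[L r | F t]) ω := h5
    rw [h6] at h4
    linarith
  obtain ⟨X, hXr, hXb, hXξ, hXLU, hgame⟩ := hF.exists_approx_game hab hCM hL hU hLR hUR hLU hξ hξ1
    (N := N) hh0 (by rw [hh]; field_simp; ring) hwi (Eventually.of_forall hw0)
    (hcond U hU hUR hmodU) hLw
  have hLn : normOne F P a b L < ∞ := (classD_of_integrable_bound (integrable_const R)
    (Eventually.of_forall fun ω t ht => hLR t ht ω)).normOne_lt_top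
  have hUn : normOne F P a b U < ∞ := (classD_of_integrable_bound (integrable_const R)
    (Eventually.of_forall fun ω t ht => hUR t ht ω)).normOne_lt_top
  have hξi : Integrable ξ P := by
    refine Integrable.of_bound (hξ.mono (F.le b) le_rfl).aestronglyMeasurable R
      (Eventually.of_forall fun ω => abs_le.2 ?_)
    have hbm : b ∈ Icc a b := ⟨hab.le, le_rfl⟩
    exact ⟨(abs_le.1 (hLR b hbm ω)).1.trans (hξ1 ω).1,
      (hξ1 ω).2.trans (abs_le.1 (hUR b hbm ω)).2⟩
  have hXn : normOne F P a b X < ∞ := by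
    obtain ⟨C, hC⟩ := hXb
    exact (classD_of_integrable_bound (integrable_const C) hC).normOne_lt_top
  refine ⟨X, fun ω => 3 * w ω, hXr, hXb, hXξ, hwi.const_mul _,
    Eventually.of_forall fun ω => mul_nonneg (by norm_num) (hw0 ω), ?_, fun t ht => ?_⟩
  · rw [integral_const_mul]; linarith
  obtain ⟨⟨τ, hτ, hτL, hτσ⟩, ⟨σ, hσ, hσU, hστ⟩⟩ := hgame t ht
  have hJi : ∀ {τ σ : Ω → ℝ}, IsStoppingTimeIn F P t b τ → IsStoppingTimeIn F P t b σ →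
      Integrable (fun ω => gamePayoff b L U ξ (τ ω) (σ ω) ω) P := fun hτ hσ =>
    integrable_gamePayoff hL hU hLn hUn (hξ.mono (F.le b) le_rfl) hξi (hτ.mono ht.1 le_rfl)
      (hσ.mono ht.1 le_rfl)
  have hXi : ∀ {τ σ : Ω → ℝ}, IsStoppingTimeIn F P t b τ → IsStoppingTimeIn F P t b σ →
      Integrable (fun ω => X (min (τ ω) (σ ω)) ω) P := fun hτ hσ =>
    hXr.integrable_comp hXn ((hτ.min hσ).mono ht.1 le_rfl)
  refine ⟨⟨τ, hτ, fun σ' hσ' => (hτσ σ' hσ').trans (condExp_mono ((hXi hσ' hτ).add hwi)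
    ((hJi hτ hσ').add (hwi.const_mul 3)) ?_)⟩, ⟨σ, hσ, fun τ' hτ' => EventuallyLE.trans (condExp_mono
    ((hJi hτ' hσ).sub (hwi.const_mul 3)) ((hXi hτ' hσ).sub hwi) ?_) (hστ τ' hτ')⟩⟩
  -- If the opponent stops strictly first, the payoff is `U`, which is at least `X - 2 * w`.
  -- Otherwise `X` equals the payoff: `L` at a stop before `b`, `ξ` at `b`.
  · filter_upwards [hτL, hτ.2, hσ'.2, hXLU, hXξ] with ω h3 h4 h5 h6 h7
    simp only [gamePayoff]
    have h8 := hw0 ω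
    split_ifs with h9 h10
    · rw [min_eq_left h9.le]
      have := (h6 _ ⟨ht.1.trans h5.1, h5.2⟩).2
      linarith
    · rw [min_eq_right (not_lt.1 h9), h3 h10]
      linarith
    · rw [min_eq_right (not_lt.1 h9), le_antisymm h4.2 (not_lt.1 h10), h7]
      linarith
  · filter_upwards [hσU, hτ'.2, hσ.2, hXLU, hXξ] with ω h3 h4 h5 h6 h7
    simp only [Pi.sub_apply, gamePayoff]
    have h8 := hw0 ω
    split_ifs with h9 h10
    · rw [min_eq_right h9.le, h3 (h9.trans_le h4.2)]
      linarith
    · rw [min_eq_left (not_lt.1 h9)]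
      have := (h6 _ ⟨ht.1.trans h4.1, h4.2⟩).1
      linarith
    · rw [min_eq_left (not_lt.1 h9), le_antisymm h4.2 (not_lt.1 h10), h7]
      linarith

end ApproxSaddle

end MFDRBSDE

/-! ### The value of a game with obstacles of class (D). -/

namespace MFDRBSDE

open Filter Topology

section GameValue

variable {Ω : Type*} [m : MeasurableSpace Ω] {F : Filtration ℝ m} {P : Measure Ω}

theorem integral_le_of_lintegral_enorm_le {f : Ω → ℝ} {ε : ℝ} (hε : 0 ≤ ε) (h : ∫⁻ ω, ‖f ω‖ₑ ∂P ≤ ENNReal.ofReal ε) : ∫ ω, f ω ∂P ≤ ε := by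
  refine (le_abs_self _).trans ((norm_integral_le_lintegral_norm f).trans ?_)
  refine ENNReal.toReal_le_of_le_ofReal hε ?_
  simpa [← Real.enorm_eq_ofReal_abs] using h

theorem integral_abs_le_normOne {a b : ℝ} {X : ℝ → Ω → ℝ} (hX : normOne F P a b X < ∞)
    {τ : Ω → ℝ} (hτ : IsStoppingTimeIn F P a b τ) :
    ∫ ω, |X (τ ω) ω| ∂P ≤ (normOne F P a b X).toReal := by
  refine integral_le_of_lintegral_enorm_le ENNReal.toReal_nonneg ?_
  rw [ENNReal.ofReal_toReal hX.ne]
  simpa using lintegral_le_normOne X hτ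

/-- Whichever obstacle is paid, it is paid at the smaller of the two times. Errors are thus
controlled by one process at one stopping time, as the essential supremum estimates require. -/
theorem abs_gamePayoff_sub_le {Ω : Type*} {b ρ x y : ℝ} {L U L' U' : ℝ → Ω → ℝ} {ξ ξ' : Ω → ℝ} {ω : Ω}
    (hρ : ρ = min x y) :
    |gamePayoff b L U ξ x y ω - gamePayoff b L' U' ξ' x y ω| ≤
      |L ρ ω - L' ρ ω| + |U ρ ω - U' ρ ω| + |ξ ω - ξ' ω| := by
  have h1 := abs_nonneg (L ρ ω - L' ρ ω)
  have h2 := abs_nonneg (U ρ ω - U' ρ ω)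
  have h3 := abs_nonneg (ξ ω - ξ' ω)
  unfold gamePayoff
  split_ifs with h h'
  · rw [min_eq_right h.le] at hρ
    subst hρ
    linarith
  · rw [min_eq_left (not_lt.1 h)] at hρ
    subst hρ
    linarith
  · linarith

/-- A Dynkin game with obstacles of class (D) has approximate saddle points, with a continuous
approximate value. -/
theorem NullComplete.exists_approx_saddle [IsProbabilityMeasure P]
    (hF : NullComplete F P) {a b : ℝ} (hab : a < b)
    (hCM : ∀ ζ : Ω → ℝ, Measurable[F b] ζ → Integrable ζ P → HasContinuousVersion F P a b ζ)
    {L U : ℝ → Ω → ℝ} (hL : RegularOn F a b L) (hU : RegularOn F a b U)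
    (hLD : ClassD F P a b L) (hUD : ClassD F P a b U)
    (hLU : ∀ᵐ ω ∂P, ∀ t ∈ Icc a b, L t ω ≤ U t ω) {ξ : Ω → ℝ}
    (hξ : Measurable[F b] ξ) (hξi : Integrable ξ P) (hξ1 : ∀ᵐ ω ∂P, L b ω ≤ ξ ω ∧ ξ ω ≤ U b ω)
    {ε : ℝ} (hε : 0 < ε) :
    ∃ X G : ℝ → Ω → ℝ, RegularOn F a b X ∧ ClassD F P a b X ∧
      (∀ ρ, IsStoppingTimeIn F P a b ρ → Integrable (fun ω => G (ρ ω) ω) P ∧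
        ∫ ω, G (ρ ω) ω ∂P ≤ ε) ∧ (∀ᵐ ω ∂P, ∀ t ∈ Icc a b, 0 ≤ G t ω) ∧
      (∀ᵐ ω ∂P, |X b ω - ξ ω| ≤ G b ω) ∧
      ∀ t ∈ Icc a b,
        (∃ τ, IsStoppingTimeIn F P t b τ ∧ ∀ σ, IsStoppingTimeIn F P t b σ →
          X t ≤ᵐ[P] P[fun ω => gamePayoff b L U ξ (τ ω) (σ ω) ω | F t]
            + P[fun ω => G (min (τ ω) (σ ω)) ω | F t]) ∧
        (∃ σ, IsStoppingTimeIn F P t b σ ∧ ∀ τ, IsStoppingTimeIn F P t b τ →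
          P[fun ω => gamePayoff b L U ξ (τ ω) (σ ω) ω | F t]
            - P[fun ω => G (min (τ ω) (σ ω)) ω | F t] ≤ᵐ[P] X t) := by
  -- Four errors are added: the tails of `L`, `U` and `ξ`, and the error `w` of the bounded game.
  set e : ℝ := ε / 4 with he
  have he0 : 0 < e := by positivity
  obtain ⟨R1, hR1, hLR⟩ := hLD (ENNReal.ofReal e) (ENNReal.ofReal_pos.2 he0)
  obtain ⟨R2, hR2, hUR⟩ := hUD (ENNReal.ofReal e) (ENNReal.ofReal_pos.2 he0)
  obtain ⟨R3, hR3, hξR⟩ := classD_of_integrable_bound (F := F) (P := P) (a := a) (b := b)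
    (X := fun _ => ξ) hξi.abs (Eventually.of_forall fun ω t _ => le_rfl)
    (ENNReal.ofReal e) (ENNReal.ofReal_pos.2 he0)
  set R := max R1 (max R2 R3) with hR
  have hR0 : 0 ≤ R := hR1.trans (le_max_left _ _)
  have hbm : b ∈ Icc a b := ⟨hab.le, le_rfl⟩
  have htail : ∀ (Z : ℝ → Ω → ℝ) (r : ℝ), r ≤ R → normOne F P a b (fun t ω => max (|Z t ω| - R) 0)
      ≤ normOne F P a b (fun t ω => max (|Z t ω| - r) 0) := fun Z r hr =>
    normOne_mono_ae (Eventually.of_forall fun ω t _ => by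
      rw [abs_max_zero, abs_max_zero]
      exact max_le_max (sub_le_sub_left hr _) le_rfl)
  replace hLR := (htail L R1 (le_max_left _ _)).trans hLR
  replace hUR := (htail U R2 ((le_max_left _ _).trans (le_max_right _ _))).trans hUR
  replace hξR := (htail (fun _ => ξ) R3 ((le_max_right _ _).trans (le_max_right _ _))).trans hξR
  set L' : ℝ → Ω → ℝ := fun t ω => trunc R (L t ω) with hL'
  -- The bounded game requires ordered obstacles for every `ω`, while `L ≤ U` holds almost surely;
  -- the maximum, and the analogous clamping of `ξ'`, change nothing outside a null set.
  set U' : ℝ → Ω → ℝ := fun t ω => max (trunc R (L t ω)) (trunc R (U t ω)) with hU'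
  set ξ' : Ω → ℝ := fun ω => max (L' b ω) (min (U' b ω) (trunc R (ξ ω))) with hξ'
  have hL'r : RegularOn F a b L' := hL.comp (continuous_trunc R)
  have hU'r : RegularOn F a b U' :=
    ⟨fun ω => (hL'r.continuous ω).max ((hU.comp (continuous_trunc R)).continuous ω),
      fun t ht => (hL'r.adapted t ht).max ((hU.comp (continuous_trunc R)).adapted t ht),
      fun t => (hL'r.measurable t).max ((hU.comp (continuous_trunc R)).measurable t)⟩
  have hξ'm : Measurable[F b] ξ' := (hL'r.adapted b hbm).max ((hU'r.adapted b hbm).min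
    ((continuous_trunc R).measurable.comp hξ))
  have hLU' : ∀ t ∈ Icc a b, ∀ ω, L' t ω ≤ U' t ω := fun t _ ω => le_max_left _ _
  obtain ⟨X, w, hXr, ⟨C, hXC⟩, hXξ, hwi, hw0, hwint, hgame⟩ :=
    hF.exists_approx_saddle_of_bounded hab hCM hL'r hU'r (R := R)
      (fun t _ ω => abs_trunc_le hR0 _)
      (fun t _ ω => abs_max_le_max_abs_abs.trans (max_le (abs_trunc_le hR0 _) (abs_trunc_le hR0 _)))
      hLU' hξ'm
      (fun ω => ⟨le_max_left _ _, max_le (hLU' b hbm ω) (min_le_left _ _)⟩) he0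
  have hξ'e : ∀ᵐ ω ∂P, ξ' ω = trunc R (ξ ω) := by
    filter_upwards [hξ1] with ω hω
    simp only [hξ', hU', hL']
    rw [min_eq_right ((trunc_mono R hω.2).trans (le_max_right _ _)),
      max_eq_right (trunc_mono R hω.1)]
  set G : ℝ → Ω → ℝ := fun t ω =>
    max (|L t ω| - R) 0 + max (|U t ω| - R) 0 + max (|ξ ω| - R) 0 + w ω with hG
  have hLi : ∀ ρ, IsStoppingTimeIn F P a b ρ → Integrable (fun ω => max (|L (ρ ω) ω| - R) 0) P :=
    fun ρ hρ => (hL.tail R).integrable_comp (hLR.trans_lt ENNReal.ofReal_lt_top) hρ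
  have hUi : ∀ ρ, IsStoppingTimeIn F P a b ρ → Integrable (fun ω => max (|U (ρ ω) ω| - R) 0) P :=
    fun ρ hρ => (hU.tail R).integrable_comp (hUR.trans_lt ENNReal.ofReal_lt_top) hρ
  have hξi' : Integrable (fun ω => max (|ξ ω| - R) 0) P :=
    (hξi.abs.sub (integrable_const R)).pos_part
  have hGi : ∀ ρ, IsStoppingTimeIn F P a b ρ → Integrable (fun ω => G (ρ ω) ω) P := fun ρ hρ =>
    (((hLi ρ hρ).add (hUi ρ hρ)).add hξi').add hwi
  have hGint : ∀ ρ, IsStoppingTimeIn F P a b ρ → ∫ ω, G (ρ ω) ω ∂P ≤ ε := by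
    intro ρ hρ
    have h0 : ∫ ω, G (ρ ω) ω ∂P = ∫ ω, max (|L (ρ ω) ω| - R) 0 ∂P + ∫ ω, max (|U (ρ ω) ω| - R) 0 ∂P
        + ∫ ω, max (|ξ ω| - R) 0 ∂P + ∫ ω, w ω ∂P := by
      simp only [hG]
      have h1 := integral_add ((hLi ρ hρ).add (hUi ρ hρ)) hξi'
      have h2 := integral_add (((hLi ρ hρ).add (hUi ρ hρ)).add hξi') hwi
      have h3 := integral_add (hLi ρ hρ) (hUi ρ hρ)
      simp only [Pi.add_apply] at h1 h2 h3
      rw [h2, h1, h3]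
    have h1 := integral_le_of_lintegral_enorm_le (P := P) he0.le
      ((lintegral_le_normOne _ hρ).trans hLR)
    have h2 := integral_le_of_lintegral_enorm_le (P := P) he0.le
      ((lintegral_le_normOne _ hρ).trans hUR)
    have h3 := integral_le_of_lintegral_enorm_le (P := P) he0.le
      ((lintegral_le_normOne _ hρ).trans hξR)
    rw [h0]
    linarith
  have hclose : ∀ᵐ ω ∂P, ∀ t ∈ Icc a b,
      |L t ω - L' t ω| + |U t ω - U' t ω| + |ξ ω - ξ' ω| + w ω ≤ G t ω := by
    filter_upwards [hξ'e, hLU] with ω h1 h2 t ht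
    have h3 := abs_sub_trunc_le hR0 (L t ω)
    have h4 := abs_sub_trunc_le hR0 (U t ω)
    have h5 := abs_sub_trunc_le hR0 (ξ ω)
    have h6 : U' t ω = trunc R (U t ω) := max_eq_right (trunc_mono R (h2 t ht))
    rw [h6, h1]
    simp only [hG]
    linarith
  have hLn := hLD.normOne_lt_top
  have hUn := hUD.normOne_lt_top
  have hξm : Measurable ξ := hξ.mono (F.le b) le_rfl
  have hξ'mm : Measurable ξ' := hξ'm.mono (F.le b) le_rfl
  have hξ'i : Integrable ξ' P := by
    refine (hξi.abs.add ((hGi _ (isStoppingTimeIn_const hbm)).sub hwi)).mono'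
      hξ'mm.aestronglyMeasurable ?_
    filter_upwards [hclose] with ω h1
    have h2 := h1 b hbm
    have h3 := abs_nonneg (L b ω - L' b ω)
    have h4 := abs_nonneg (U b ω - U' b ω)
    have h5 := abs_sub_abs_le_abs_sub (ξ' ω) (ξ ω)
    rw [abs_sub_comm] at h5
    simp only [Real.norm_eq_abs, Pi.add_apply, Pi.sub_apply]
    linarith
  have hL'n : normOne F P a b L' < ∞ := (classD_of_integrable_bound (integrable_const R)
    (Eventually.of_forall fun ω t _ => abs_trunc_le hR0 _)).normOne_lt_top
  have hU'n : normOne F P a b U' < ∞ := (classD_of_integrable_bound (integrable_const R)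
    (Eventually.of_forall fun ω t _ => abs_max_le_max_abs_abs.trans
      (max_le (abs_trunc_le hR0 _) (abs_trunc_le hR0 _)))).normOne_lt_top
  refine ⟨X, G, hXr, classD_of_integrable_bound (integrable_const C) hXC,
    fun ρ hρ => ⟨hGi ρ hρ, hGint ρ hρ⟩, ?_, ?_, fun t ht => ?_⟩
  · filter_upwards [hw0] with ω h1 t _
    have h2 := le_max_right (|L t ω| - R) 0
    have h3 := le_max_right (|U t ω| - R) 0
    have h4 := le_max_right (|ξ ω| - R) 0
    simp only [hG]
    linarith
  · filter_upwards [hXξ, hclose, hw0] with ω h1 h2 h3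
    have h4 := h2 b hbm
    rw [h1, abs_sub_comm]
    linarith [abs_nonneg (L b ω - L' b ω), abs_nonneg (U b ω - U' b ω)]
  obtain ⟨⟨τ, hτ, hτσ⟩, ⟨σ, hσ, hστ⟩⟩ := hgame t ht
  have hJi : ∀ {τ σ : Ω → ℝ}, IsStoppingTimeIn F P t b τ → IsStoppingTimeIn F P t b σ →
      Integrable (fun ω => gamePayoff b L U ξ (τ ω) (σ ω) ω) P := fun hτ hσ =>
    integrable_gamePayoff hL hU hLn hUn hξm hξi (hτ.mono ht.1 le_rfl) (hσ.mono ht.1 le_rfl)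
  have hJi' : ∀ {τ σ : Ω → ℝ}, IsStoppingTimeIn F P t b τ → IsStoppingTimeIn F P t b σ →
      Integrable (fun ω => gamePayoff b L' U' ξ' (τ ω) (σ ω) ω) P := fun hτ hσ =>
    integrable_gamePayoff hL'r hU'r hL'n hU'n hξ'mm hξ'i (hτ.mono ht.1 le_rfl)
      (hσ.mono ht.1 le_rfl)
  have hGi' : ∀ {τ σ : Ω → ℝ}, IsStoppingTimeIn F P t b τ → IsStoppingTimeIn F P t b σ →
      Integrable (fun ω => G (min (τ ω) (σ ω)) ω) P := fun hτ hσ =>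
    hGi _ ((hτ.min hσ).mono ht.1 le_rfl)
  have hcmp : ∀ {τ σ : Ω → ℝ}, IsStoppingTimeIn F P t b τ → IsStoppingTimeIn F P t b σ →
      ∀ᵐ ω ∂P, |gamePayoff b L U ξ (τ ω) (σ ω) ω - gamePayoff b L' U' ξ' (τ ω) (σ ω) ω| + w ω
        ≤ G (min (τ ω) (σ ω)) ω := by
    intro τ σ hτ hσ
    filter_upwards [hclose, (hτ.min hσ).2] with ω h1 h2
    have h3 := h1 _ ⟨ht.1.trans h2.1, h2.2⟩
    have h4 := abs_gamePayoff_sub_le (b := b) (L := L) (U := U) (L' := L') (U' := U') (ξ := ξ)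
      (ξ' := ξ') (ω := ω) (rfl : min (τ ω) (σ ω) = _)
    linarith
  refine ⟨⟨τ, hτ, fun σ' hσ' => ?_⟩, ⟨σ, hσ, fun τ' hτ' => ?_⟩⟩
  · refine (hτσ σ' hσ').trans (EventuallyLE.trans ?_
      (condExp_add (hJi hτ hσ') (hGi' hτ hσ') (F t)).le)
    refine condExp_mono ((hJi' hτ hσ').add hwi) ((hJi hτ hσ').add (hGi' hτ hσ')) ?_
    filter_upwards [hcmp hτ hσ'] with ω h1
    simp only [Pi.add_apply]
    have := neg_abs_le (gamePayoff b L U ξ (τ ω) (σ' ω) ω - gamePayoff b L' U' ξ' (τ ω) (σ' ω) ω)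
    linarith
  · refine EventuallyLE.trans ?_ (hστ τ' hτ')
    refine EventuallyLE.trans (condExp_sub (hJi hτ' hσ) (hGi' hτ' hσ) (F t)).symm.le ?_
    refine condExp_mono ((hJi hτ' hσ).sub (hGi' hτ' hσ)) ((hJi' hτ' hσ).sub hwi) ?_
    filter_upwards [hcmp hτ' hσ] with ω h1
    simp only [Pi.sub_apply]
    have := le_abs_self (gamePayoff b L U ξ (τ' ω) (σ ω) ω - gamePayoff b L' U' ξ' (τ' ω) (σ ω) ω)
    linarith

/-- If `f ≤ g n` almost surely and `g n → g` in `L¹`, then `f ≤ g` almost surely. -/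
theorem ae_le_of_tendsto_lintegral {f g : Ω → ℝ} {u : ℕ → Ω → ℝ} (hf : AEMeasurable f P)
    (hg : AEMeasurable g P) (hfu : ∀ n, f ≤ᵐ[P] u n)
    (h : Tendsto (fun n => ∫⁻ ω, ‖u n ω - g ω‖ₑ ∂P) atTop (𝓝 0)) : f ≤ᵐ[P] g := by
  have h1 : ∫⁻ ω, ENNReal.ofReal (f ω - g ω) ∂P = 0 := by
    refine le_antisymm (ge_of_tendsto' h fun n => lintegral_mono_ae ?_) zero_le
    filter_upwards [hfu n] with ω hω
    rw [Real.enorm_eq_ofReal_abs]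
    exact ENNReal.ofReal_le_ofReal ((sub_le_sub_right hω _).trans (le_abs_self _))
  have h2 := (lintegral_eq_zero_iff' (hf.sub hg).ennreal_ofReal).1 h1
  filter_upwards [h2] with ω hω
  simpa using hω

/-- A Dynkin game with obstacles of class (D) has a value, which is a continuous process of
class (D). -/
theorem NullComplete.exists_game_value [IsProbabilityMeasure P]
    (hF : NullComplete F P) {a b : ℝ} (hab : a < b)
    (hCM : ∀ ζ : Ω → ℝ, Measurable[F b] ζ → Integrable ζ P → HasContinuousVersion F P a b ζ)
    {L U : ℝ → Ω → ℝ} (hL : RegularOn F a b L) (hU : RegularOn F a b U)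
    (hLD : ClassD F P a b L) (hUD : ClassD F P a b U)
    (hLU : ∀ᵐ ω ∂P, ∀ t ∈ Icc a b, L t ω ≤ U t ω) {ξ : Ω → ℝ}
    (hξ : Measurable[F b] ξ) (hξi : Integrable ξ P)
    (hξ1 : ∀ᵐ ω ∂P, L b ω ≤ ξ ω ∧ ξ ω ≤ U b ω) :
    ∃ X : ℝ → Ω → ℝ, RegularOn F a b X ∧ ClassD F P a b X ∧ X b =ᵐ[P] ξ ∧
      ∀ t ∈ Icc a b, ∃ V : {τ : Ω → ℝ // IsStoppingTimeIn F P t b τ} → Ω → ℝ,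
        (∀ τ, IsEssInf P (fun σ : {σ : Ω → ℝ // IsStoppingTimeIn F P t b σ} =>
          P[fun ω => gamePayoff b L U ξ (τ.1 ω) (σ.1 ω) ω | F t]) (V τ)) ∧
        IsEssSup P V (X t) := by
  have hpos : ∀ n : ℕ, (0 : ℝ) < 1 / ((n : ℝ) + 1) := fun n => by positivity
  choose Xn G hXr hXD hG hG0 hXξ hgame using fun n : ℕ =>
    hF.exists_approx_saddle hab hCM hL hU hLD hUD hLU hξ hξi hξ1 (hpos n)
  have hbm : b ∈ Icc a b := ⟨hab.le, le_rfl⟩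
  have hLn := hLD.normOne_lt_top
  have hUn := hUD.normOne_lt_top
  have hξm : Measurable ξ := hξ.mono (F.le b) le_rfl
  -- The near-optimal `τ` of the `n`-th approximation is played against the near-optimal `σ` of the
  -- `k`-th. The common payoff cancels, and only the two errors at `τ ∧ σ` remain.
  have hle : ∀ n k t, t ∈ Icc a b → ∀ W : Ω → ℝ, (∀ ρ, IsStoppingTimeIn F P t b ρ →
      P[fun ω => G n (ρ ω) ω + G k (ρ ω) ω | F t] ≤ᵐ[P] W) →
      ∀ᵐ ω ∂P, Xn n t ω - Xn k t ω ≤ W ω := by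
    intro n k t ht W hW
    obtain ⟨τ, hτ, hτσ⟩ := (hgame n t ht).1
    obtain ⟨σ, hσ, hστ⟩ := (hgame k t ht).2
    have hρ := (hτ.min hσ).mono ht.1 le_rfl
    filter_upwards [hτσ σ hσ, hστ τ hτ, hW _ (hτ.min hσ),
      condExp_add (hG n _ hρ).1 (hG k _ hρ).1 (F t)] with ω h1 h2 h3 h4
    have h5 : (P[fun ω => G n (min (τ ω) (σ ω)) ω + G k (min (τ ω) (σ ω)) ω | F t]) ω =
      (P[fun ω => G n (min (τ ω) (σ ω)) ω | F t]) ω +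
      (P[fun ω => G k (min (τ ω) (σ ω)) ω | F t]) ω := h4
    rw [h5] at h3
    simp only [Pi.add_apply, Pi.sub_apply] at h1 h2
    linarith
  have hdist : ∀ n k, normOne F P a b (fun t ω => Xn n t ω - Xn k t ω) ≤
      ENNReal.ofReal (1 / ((n : ℝ) + 1) + 1 / ((k : ℝ) + 1)) := by
    intro n k
    refine hF.normOne_le_of_condExp_le hab.le ((hXr n).sub (hXr k))
      (G := fun t ω => G n t ω + G k t ω) (fun ρ hρ => (hG n ρ hρ).1.add (hG k ρ hρ).1)
      (fun ρ hρ => ?_) fun t ht W _ hW => ?_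
    · rw [integral_add (hG n ρ hρ).1 (hG k ρ hρ).1]
      exact add_le_add (hG n ρ hρ).2 (hG k ρ hρ).2
    · filter_upwards [hle n k t ht W hW, hle k n t ht W (fun ρ hρ => by
        simpa only [add_comm] using hW ρ hρ)] with ω h1 h2
      exact abs_le.2 ⟨by linarith, h1⟩
  have hlim0 : Tendsto (fun n : ℕ => ENNReal.ofReal (1 / ((n : ℝ) + 1))) atTop (𝓝 0) := by
    have := ENNReal.tendsto_ofReal (tendsto_one_div_add_atTop_nhds_zero_nat (𝕜 := ℝ))
    simpa using this
  obtain ⟨X, hX, hXlim⟩ := hF.exists_tendsto_normOne hab hXr fun ε hε => by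
    obtain ⟨N, hN⟩ := eventually_atTop.1
      (ENNReal.tendsto_nhds_zero.1 hlim0 (ε / 2) (ENNReal.half_pos hε.ne'))
    refine ⟨N, fun n hn k hk => (hdist n k).trans ?_⟩
    rw [ENNReal.ofReal_add (hpos n).le (hpos k).le, ← ENNReal.add_halves ε]
    exact add_le_add (hN n hn) (hN k hk)
  have hXD' : ClassD F P a b X := ClassD.of_normOne_sub hXD hXr hXlim
  have hXt : ∀ t ∈ Icc a b, Tendsto (fun n => ∫⁻ ω, ‖Xn n t ω - X t ω‖ₑ ∂P) atTop (𝓝 0) :=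
    fun t ht => tendsto_of_tendsto_of_tendsto_of_le_of_le tendsto_const_nhds hXlim
      (fun n => zero_le) fun n => lintegral_le_normOne (fun t ω => Xn n t ω - X t ω)
        (isStoppingTimeIn_const ht)
  have hperturb : ∀ t ∈ Icc a b, ∀ W : ℕ → Ω → ℝ,
      (∀ n, ∫⁻ ω, ‖W n ω‖ₑ ∂P ≤ ENNReal.ofReal (1 / ((n : ℝ) + 1))) →
      Tendsto (fun n => ∫⁻ ω, ‖Xn n t ω + W n ω - X t ω‖ₑ ∂P) atTop (𝓝 0) := by
    intro t ht W hW
    have h1 := (hXt t ht).add hlim0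
    rw [add_zero] at h1
    refine tendsto_of_tendsto_of_tendsto_of_le_of_le tendsto_const_nhds h1 (fun n => zero_le)
      fun n => ?_
    refine le_trans (lintegral_mono fun ω => ?_) ((lintegral_add_left
      (((hXr n).measurable t).sub (hX.measurable t)).enorm _).le.trans
      (add_le_add le_rfl (hW n)))
    rw [add_sub_right_comm]
    exact enorm_add_le _ _
  -- One variable dominates the conditional errors for all pairs of strategies at once, and it is
  -- still of size `1 / (n + 1)` in `L¹`.
  have hGW : ∀ n : ℕ, ∀ t ∈ Icc a b, ∃ W : Ω → ℝ, Integrable W P ∧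
      ∫⁻ ω, ‖W ω‖ₑ ∂P ≤ ENNReal.ofReal (1 / ((n : ℝ) + 1)) ∧
      ∀ ρ, IsStoppingTimeIn F P t b ρ → P[fun ω => G n (ρ ω) ω | F t] ≤ᵐ[P] W := by
    intro n t ht
    obtain ⟨W, hWi, hWint, hWG⟩ := hF.exists_condExp_le ht.2 (G := G n)
      (fun ρ hρ => (hG n ρ (hρ.mono ht.1 le_rfl)).1) (fun ρ hρ => (hG n ρ (hρ.mono ht.1 le_rfl)).2)
    refine ⟨W, hWi, ?_, hWG⟩
    have h0 : 0 ≤ᵐ[P] W := by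
      refine EventuallyLE.trans (condExp_nonneg ?_)
        (hWG _ (isStoppingTimeIn_const (t := b) ⟨ht.2, le_rfl⟩))
      filter_upwards [hG0 n] with ω hω using hω b hbm
    have h1 : ∫⁻ ω, ‖W ω‖ₑ ∂P = ENNReal.ofReal (∫ ω, W ω ∂P) := by
      rw [ofReal_integral_eq_lintegral_ofReal hWi h0]
      refine lintegral_congr_ae ?_
      filter_upwards [h0] with ω hω
      rw [Real.enorm_eq_ofReal_abs, abs_of_nonneg hω]
    rw [h1]
    exact ENNReal.ofReal_le_ofReal hWint
  refine ⟨X, hX, hXD', ?_, fun t ht => ?_⟩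
  · have h1 := hperturb b hbm (fun n ω => ξ ω - Xn n b ω) fun n => by
      have h2 := hG n _ (isStoppingTimeIn_const hbm)
      refine le_trans ?_ (ENNReal.ofReal_le_ofReal h2.2)
      rw [ofReal_integral_eq_lintegral_ofReal h2.1
        (by filter_upwards [hG0 n] with ω hω using hω b hbm)]
      refine lintegral_mono_ae ?_
      filter_upwards [hXξ n] with ω hω
      rw [Real.enorm_eq_ofReal_abs, abs_sub_comm]
      exact ENNReal.ofReal_le_ofReal hω
    have h2 : ∫⁻ ω, ‖ξ ω - X b ω‖ₑ ∂P = 0 := by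
      refine tendsto_nhds_unique (tendsto_const_nhds (f := (atTop : Filter ℕ))) ?_
      refine h1.congr fun n => lintegral_congr fun ω => ?_
      rw [add_sub_cancel]
    filter_upwards [(lintegral_eq_zero_iff (hξm.sub (hX.measurable b)).enorm).1 h2] with ω hω
    have : ξ ω - X b ω = 0 := by simpa using hω
    linarith
  have hJi : ∀ {τ σ : Ω → ℝ}, IsStoppingTimeIn F P t b τ → IsStoppingTimeIn F P t b σ →
      Integrable (fun ω => gamePayoff b L U ξ (τ ω) (σ ω) ω) P := fun hτ hσ =>
    integrable_gamePayoff hL hU hLn hUn hξm hξi (hτ.mono ht.1 le_rfl) (hσ.mono ht.1 le_rfl)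
  have hV : ∀ τ : {τ : Ω → ℝ // IsStoppingTimeIn F P t b τ}, ∃ V : Ω → ℝ,
      IsEssInf P (fun σ : {σ : Ω → ℝ // IsStoppingTimeIn F P t b σ} =>
        P[fun ω => gamePayoff b L U ξ (τ.1 ω) (σ.1 ω) ω | F t]) V := by
    intro τ
    -- For fixed `τ` the negative payoff is a process in the stopping time of the opponent, so the
    -- inner essential infimum is minus an essential supremum of the type already treated.
    obtain ⟨u, W, hu, hW, hlim, hdom, -⟩ := hF.exists_essSup_condExp ht.2
      (G := fun s ω => -gamePayoff b L U ξ (τ.1 ω) s ω) (fun σ hσ => (hJi τ.2 hσ).neg)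
      (C := (normOne F P a b L).toReal + (normOne F P a b U).toReal + ∫ ω, |ξ ω| ∂P)
      fun σ hσ => by
        have hτ' := τ.2.mono ht.1 (le_refl b)
        have hσ' := hσ.mono ht.1 (le_refl b)
        have h1 := (hL.integrable_comp hLn hτ').abs
        have h2 := (hU.integrable_comp hUn hσ').abs
        have h3 := integral_add (h1.add h2) hξi.abs
        have h4 := integral_add h1 h2
        simp only [Pi.add_apply] at h3 h4
        refine (integral_mono (hJi τ.2 hσ).neg ((h1.add h2).add hξi.abs) fun ω =>
          (neg_le_abs _).trans (abs_gamePayoff_le _ _ _ _ _ _ _)).trans (h3.trans_le ?_)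
        rw [h4]
        exact add_le_add (add_le_add (integral_abs_le_normOne hLn hτ')
          (integral_abs_le_normOne hUn hσ')) le_rfl
    have hneg : ∀ σ : Ω → ℝ, P[fun ω => -gamePayoff b L U ξ (τ.1 ω) (σ ω) ω | F t] =ᵐ[P]
        fun ω => -(P[fun ω => gamePayoff b L U ξ (τ.1 ω) (σ ω) ω | F t]) ω := fun σ =>
      condExp_neg _ _
    refine ⟨fun ω => -W ω, hW.aemeasurable.neg, fun σ => ?_, fun Z hZ hZV => ?_⟩
    · filter_upwards [hdom σ.1 σ.2, hneg σ.1] with ω h1 h2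
      rw [h2] at h1
      linarith
    · filter_upwards [hlim, ae_all_iff.2 fun n => hneg (u n), ae_all_iff.2 fun n =>
        hZV ⟨u n, hu n⟩] with ω h1 h2 h3
      have h4 : W ω ≤ -Z ω := le_of_tendsto' h1 fun n => by
        rw [h2 n]
        exact neg_le_neg (h3 n)
      linarith
  choose V hV using hV
  choose W hWi hWint hWG using fun n => hGW n t ht
  have hXm : AEMeasurable (X t) P := (hX.measurable t).aemeasurable
  refine ⟨V, hV, hXm, fun τ => ?_, fun Z hZ hVZ => ?_⟩
  -- Against any `τ`, the near-optimal `σ` of the minimizer keeps the conditional payoff below `Xn n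
  -- t + W n`, which tends to `X t` in `L¹`.
  · refine ae_le_of_tendsto_lintegral (hV τ).1 hXm (fun n => ?_) (hperturb t ht W hWint)
    obtain ⟨σ, hσ, hστ⟩ := (hgame n t ht).2
    filter_upwards [(hV τ).2.1 ⟨σ, hσ⟩, hστ τ.1 τ.2, hWG n _ (τ.2.min hσ)] with ω h1 h2 h3
    simp only [Pi.sub_apply] at h2
    linarith
  · have h0 : (fun ω => -Z ω) ≤ᵐ[P] fun ω => -X t ω := by
      refine ae_le_of_tendsto_lintegral hZ.neg hXm.neg
        (u := fun n ω => -(Xn n t ω + -W n ω)) (fun n => ?_) ?_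
      · obtain ⟨τ, hτ, hτσ⟩ := (hgame n t ht).1
        -- The near-optimal `τ` of the maximizer guarantees `Xn n t - W n` against every `σ`, so any
        -- upper bound `Z` of the family `V` dominates it, hence also its limit `X t`.
        have h1 : (fun ω => Xn n t ω + -W n ω) ≤ᵐ[P] V ⟨τ, hτ⟩ := by
          refine (hV ⟨τ, hτ⟩).2.2 _ (((hXr n).measurable t).aemeasurable.add
            (hWi n).aemeasurable.neg) fun σ => ?_
          filter_upwards [hτσ σ.1 σ.2, hWG n _ (hτ.min σ.2)] with ω h1 h2
          simp only [Pi.add_apply] at h1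
          linarith
        filter_upwards [h1, hVZ ⟨τ, hτ⟩] with ω h2 h3
        linarith
      · have := hperturb t ht (fun n ω => -W n ω) (fun n => by simpa only [enorm_neg] using hWint n)
        refine this.congr fun n => lintegral_congr fun ω => ?_
        rw [← enorm_neg]
        congr 1
        ring
    filter_upwards [h0] with ω hω
    linarith

end GameValue

end MFDRBSDE

/-! ### Substituting a process and its mean into the coefficients. -/

namespace MFDRBSDE

open Filter Topology

/-- Substitution of measurable arguments in a Carathéodory function. -/
theorem measurable_apply_of_continuous {E α : Type*} [TopologicalSpace E]
    [TopologicalSpace.MetrizableSpace E] [MeasurableSpace E] [SecondCountableTopology E]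
    [OpensMeasurableSpace E] {mα : MeasurableSpace α} {u : E → α → ℝ}
    (hc : ∀ x, Continuous fun e => u e x) (hm : ∀ e, Measurable[mα] (u e)) {v : α → E}
    (hv : Measurable[mα] v) : Measurable[mα] fun x => u (v x) x :=
  (measurable_uncurry_of_continuous_of_measurable hc hm).comp (hv.prodMk measurable_id)

theorem continuous_of_lipschitz_pair {φ : ℝ → ℝ → ℝ} {K₁ K₂ : ℝ} (hK₁ : 0 ≤ K₁) (hK₂ : 0 ≤ K₂)
    (h : ∀ x x' y y', |φ x x' - φ y y'| ≤ K₁ * |x - y| + K₂ * |x' - y'|) :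
    LipschitzWith (Real.toNNReal (K₁ + K₂)) fun p : ℝ × ℝ => φ p.1 p.2 := by
  refine LipschitzWith.of_dist_le_mul fun p q => ?_
  rw [Real.coe_toNNReal _ (add_nonneg hK₁ hK₂), Real.dist_eq, Prod.dist_eq, add_mul]
  refine (h _ _ _ _).trans (add_le_add ?_ ?_)
  · exact mul_le_mul_of_nonneg_left (le_max_left _ _) hK₁
  · exact mul_le_mul_of_nonneg_left (le_max_right _ _) hK₂

theorem measurable_prodMk_real {α : Type*} {mα : MeasurableSpace α} {f g : α → ℝ}
    (hf : Measurable[mα] f) (hg : Measurable[mα] g) : Measurable[mα] fun x => (f x, g x) :=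
  hf.prodMk hg

section Coefficients

variable {Ω : Type*} [m : MeasurableSpace Ω] {F : Filtration ℝ m} {P : Measure Ω}

open Classical in
/-- A coefficient that is continuous in time and Lipschitz in space has a version that is
jointly continuous for every `ω`. -/
theorem NullComplete.exists_regular_coefficient (hF : NullComplete F P) {T : ℝ} (hT : 0 ≤ T)
    {h : ℝ → Ω → ℝ → ℝ → ℝ} {K₁ K₂ : ℝ} (hK₁ : 0 ≤ K₁) (hK₂ : 0 ≤ K₂)
    (had : ∀ x x', ∀ t ∈ Icc (0 : ℝ) T, Measurable[F t] fun ω => h t ω x x')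
    (hc : ∀ x x', ∀ᵐ ω ∂P, ContinuousOn (fun t => h t ω x x') (Icc 0 T))
    (hl : ∀ᵐ ω ∂P, ∀ t ∈ Icc (0 : ℝ) T, ∀ x x' y y' : ℝ,
      |h t ω x x' - h t ω y y'| ≤ K₁ * |x - y| + K₂ * |x' - y'|) :
    ∃ k : ℝ → Ω → ℝ → ℝ → ℝ, (∀ ω, Continuous fun p : ℝ × ℝ × ℝ => k p.1 ω p.2.1 p.2.2) ∧
      (∀ t ∈ Icc (0 : ℝ) T, ∀ x x', Measurable[F t] fun ω => k t ω x x') ∧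
      (∀ t x x', Measurable fun ω => k t ω x x') ∧
      ∀ᵐ ω ∂P, ∀ t ∈ Icc (0 : ℝ) T, ∀ x x', k t ω x x' = h t ω x x' := by
  -- Continuity in time is assumed with an exceptional set depending on the space arguments.
  -- Rational arguments share one null set, and the Lipschitz bound extends continuity to all
  -- arguments jointly.
  set S : Set Ω := {ω | ContinuousOn (fun p : ℝ × ℝ × ℝ => h p.1 ω p.2.1 p.2.2) (Icc 0 T ×ˢ univ)}
  have hS : ∀ᵐ ω ∂P, ω ∈ S := by
    have hc' : ∀ᵐ ω ∂P, ∀ q : ℚ × ℚ, ContinuousOn (fun t => h t ω q.1 q.2) (Icc 0 T) :=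
      ae_all_iff.2 fun q => hc _ _
    filter_upwards [hc', hl] with ω h1 h2
    refine continuousOn_prod_of_subset_closure_continuousOn_lipschitzOnWith'
      (fun p : ℝ × ℝ × ℝ => h p.1 ω p.2.1 p.2.2)
      (t' := range (Prod.map (Rat.cast : ℚ → ℝ) (Rat.cast : ℚ → ℝ))) (subset_univ _)
      (DenseRange.prodMap Rat.denseRange_cast Rat.denseRange_cast).closure_range.ge
      (Real.toNNReal (K₁ + K₂))
      (fun t ht => (continuous_of_lipschitz_pair hK₁ hK₂ (h2 t ht)).lipschitzOnWith) ?_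
    rintro _ ⟨q, rfl⟩
    exact h1 q
  set k : ℝ → Ω → ℝ → ℝ → ℝ := fun t ω x x' =>
    if ω ∈ S then h (projIcc 0 T hT t) ω x x' else 0 with hk
  have hae : ∀ᵐ ω ∂P, ∀ t x x', k t ω x x' = h (projIcc 0 T hT t) ω x x' := by
    filter_upwards [hS] with ω hω t x x'
    simp [hk, hω]
  have hkm : ∀ t x x', Measurable[F (projIcc 0 T hT t)] fun ω => k t ω x x' := fun t x x' =>
    hF.measurable_congr (had x x' _ (projIcc 0 T hT t).2) (by
      filter_upwards [hae] with ω hω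
      rw [hω])
  refine ⟨k, fun ω => ?_, fun t ht x x' => ?_, fun t x x' => (hkm t x x').mono (F.le _) le_rfl, ?_⟩
  · by_cases hω : ω ∈ S
    · simp only [hk, hω, if_true]
      have h1 : ContinuousOn (fun p : ℝ × ℝ × ℝ => h p.1 ω p.2.1 p.2.2) (Icc 0 T ×ˢ univ) := hω
      exact h1.comp_continuous (f := fun p : ℝ × ℝ × ℝ => ((projIcc 0 T hT p.1 : ℝ), p.2))
        (by fun_prop) fun p => ⟨(projIcc 0 T hT p.1).2, mem_univ _⟩
    · simp only [hk, hω, if_false]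
      exact continuous_const
  · have := hkm t x x'
    rwa [projIcc_of_mem hT ht] at this
  · filter_upwards [hae] with ω hω t ht x x'
    rw [hω, projIcc_of_mem hT ht]

/-- Evaluation of a coefficient along a process and a deterministic function. -/
theorem NullComplete.exists_coefficient_comp (hF : NullComplete F P) {a T : ℝ} (ha : 0 ≤ a)
    (haT : a ≤ T) {h : ℝ → Ω → ℝ → ℝ → ℝ} {K₁ K₂ : ℝ} (hK₁ : 0 ≤ K₁) (hK₂ : 0 ≤ K₂)
    (had : ∀ x x', ∀ t ∈ Icc (0 : ℝ) T, Measurable[F t] fun ω => h t ω x x')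
    (hc : ∀ x x', ∀ᵐ ω ∂P, ContinuousOn (fun t => h t ω x x') (Icc 0 T))
    (hl : ∀ᵐ ω ∂P, ∀ t ∈ Icc (0 : ℝ) T, ∀ x x' y y' : ℝ,
      |h t ω x x' - h t ω y y'| ≤ K₁ * |x - y| + K₂ * |x' - y'|)
    {Y : ℝ → Ω → ℝ} (hY : RegularOn F a T Y) {μ : ℝ → ℝ} (hμ : Measurable μ) :
    ∃ L : ℝ → Ω → ℝ, (Measurable fun p : ℝ × Ω => L p.1 p.2) ∧
      (∀ t ∈ Icc a T, Measurable[F t] (L t)) ∧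
      (ContinuousOn μ (Icc a T) → ∀ ω, ContinuousOn (fun t => L t ω) (Icc a T)) ∧
      ∀ᵐ ω ∂P, ∀ t ∈ Icc a T, L t ω = h t ω (Y t ω) (μ t) := by
  obtain ⟨k, hkc, hkF, hkm, hkh⟩ := hF.exists_regular_coefficient (ha.trans haT) hK₁ hK₂ had hc hl
  have hsub : Icc a T ⊆ Icc 0 T := Icc_subset_Icc_left ha
  refine ⟨fun t ω => k t ω (Y t ω) (μ t), ?_, fun t ht => ?_, fun hμc ω => ?_, ?_⟩
  · exact measurable_apply_of_continuous (E := ℝ × ℝ × ℝ) (α := ℝ × Ω)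
      (u := fun e p => k e.1 p.2 e.2.1 e.2.2) (v := fun p => (p.1, Y p.1 p.2, μ p.1))
      (fun p => hkc p.2) (fun e => (hkm _ _ _).comp measurable_snd)
      (measurable_fst.prodMk (hY.measurable_uncurry.prodMk (hμ.comp measurable_fst)))
  · exact measurable_apply_of_continuous (E := ℝ × ℝ)
      (u := fun e ω => k t ω e.1 e.2) (v := fun ω => (Y t ω, μ t))
      (fun ω => (hkc ω).comp (f := fun e : ℝ × ℝ => (t, e.1, e.2)) (by fun_prop))
      (fun e => hkF t (hsub ht) _ _)
      (measurable_prodMk_real (hY.adapted t ht) measurable_const)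
  -- Continuity of `μ` enters only here. For the mean of a process in `D` it may fail without class
  -- (D), whereas measurability does not depend on it.
  · exact (hkc ω).comp_continuousOn (f := fun t => (t, Y t ω, μ t))
      (continuousOn_id.prodMk ((hY.continuous ω).continuousOn.prodMk hμc))
  · filter_upwards [hkh] with ω hω t ht
    rw [hω t (hsub ht)]

theorem measurable_integral_Ioc {Ω : Type*} {m' : MeasurableSpace Ω} {φ : ℝ × Ω → ℝ} (hφ : Measurable φ)
    (a t : ℝ) : Measurable fun ω => ∫ s in Ioc a t, φ (s, ω) :=
  (hφ.stronglyMeasurable.integral_prod_left' (μ := volume.restrict (Ioc a t))).measurable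

theorem measurable_comp_min {Ω : Type*} {m' : MeasurableSpace Ω} {t : ℝ} {φ : Iic t × Ω → ℝ}
    (hφ : Measurable φ) :
    Measurable fun p : ℝ × Ω => φ (⟨min p.1 t, min_le_right p.1 t⟩, p.2) :=
  hφ.comp (((measurable_fst.min measurable_const).subtype_mk).prodMk measurable_snd)

theorem measurable_apply_prod {Ω : Type*} {m' : MeasurableSpace Ω} {α : Type*} [MeasurableSpace α]
    {u : ℝ × ℝ → α × Ω → ℝ}
    (hc : ∀ x, Continuous fun e => u e x) (hm : ∀ e, Measurable (u e)) {v w : α × Ω → ℝ}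
    (hv : Measurable v) (hw : Measurable w) : Measurable fun x => u (v x, w x) x :=
  measurable_apply_of_continuous hc hm (hv.prodMk hw)

theorem measurable_uncurry_clamp {Ω : Type*} {m' : MeasurableSpace Ω} {Y : ℝ → Ω → ℝ} {a t : ℝ} (hat : a ≤ t)
    (hc : ∀ ω, Continuous fun s => Y s ω) (hm : ∀ s ∈ Icc a t, Measurable (Y s)) :
    Measurable fun p : Iic t × Ω => Y (max a (min p.1 t)) p.2 := by
  have h : Measurable fun p : ℝ × Ω => Y (max a (min p.1 t)) p.2 :=
    measurable_uncurry_of_continuous_of_measurable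
      (u := fun s ω => Y (max a (min s t)) ω) (fun ω => (hc ω).comp (by fun_prop))
      fun s => hm _ ⟨le_max_left _ _, max_le hat (min_le_right _ _)⟩
  exact h.comp ((measurable_subtype_coe.comp measurable_fst).prodMk measurable_snd)

open Classical in
/-- Evaluation of a progressively measurable driver along a process and a deterministic function. -/
theorem NullComplete.exists_driver_comp (hF : NullComplete F P) {a T : ℝ} (ha : 0 ≤ a)
    (haT : a ≤ T) {f : ℝ → Ω → ℝ → ℝ → ℝ} {K : ℝ} (hK : 0 ≤ K)
    (hp : ∀ y y', IsStronglyProgressive F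
      fun t ω => (Icc (0 : ℝ) T).indicator (fun s => f s ω y y') t)
    (hl : ∀ᵐ ω ∂P, ∀ t ∈ Icc (0 : ℝ) T, ∀ y₁ y₁' y₂ y₂' : ℝ,
      |f t ω y₁ y₁' - f t ω y₂ y₂'| ≤ K * (|y₁ - y₂| + |y₁' - y₂'|))
    {Y : ℝ → Ω → ℝ} (hY : RegularOn F a T Y) {μ : ℝ → ℝ} (hμ : Measurable μ) :
    ∃ φ : ℝ → Ω → ℝ, (Measurable fun p : ℝ × Ω => φ p.1 p.2) ∧
      (∀ t ∈ Icc a T, Measurable[F t] fun ω => ∫ s in Ioc a t, φ s ω) ∧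
      ∀ᵐ ω ∂P, ∀ t ∈ Icc a T, φ t ω = f t ω (Y t ω) (μ t) := by
  set S : Set Ω := {ω | ∀ t ∈ Icc (0 : ℝ) T, ∀ y₁ y₁' y₂ y₂' : ℝ,
      |f t ω y₁ y₁' - f t ω y₂ y₂'| ≤ K * (|y₁ - y₂| + |y₁' - y₂'|)}
  have hS : ∀ᵐ ω ∂P, ω ∈ S := hl
  -- Setting the driver to zero off the almost sure set `S` makes it continuous in space for every
  -- `ω`. As `S` lies in every `F t`, progressive measurability survives.
  set k : ℝ → Ω → ℝ → ℝ → ℝ := fun t ω y y' =>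
    if ω ∈ S then (Icc (0 : ℝ) T).indicator (fun s => f s ω y y') t else 0 with hk
  have hSm : ∀ t, MeasurableSet[F t] S := fun t =>
    hF.measurableSet_congr (A := univ) MeasurableSet.univ (by
      filter_upwards [hS] with ω hω
      change (ω ∈ univ) = (ω ∈ S)
      simp [hω])
  have hkc : ∀ t ω, Continuous fun p : ℝ × ℝ => k t ω p.1 p.2 := by
    intro t ω
    by_cases hω : ω ∈ S
    · by_cases ht : t ∈ Icc 0 T
      · simp only [hk, hω, if_true, indicator_of_mem ht]
        exact (continuous_of_lipschitz_pair hK hK fun x x' y y' => by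
          rw [← mul_add]; exact hω t ht x x' y y').continuous
      · simp only [hk, hω, if_true, indicator_of_notMem ht]
        exact continuous_const
    · simp only [hk, hω, if_false]
      exact continuous_const
  have hkm : ∀ t y y', Measurable[Subtype.instMeasurableSpace.prod (F t)]
      fun p : Iic t × Ω => k p.1 p.2 y y' := by
    intro t y y'
    refine Measurable.ite ?_ (hp y y' t).measurable measurable_const
    exact measurable_snd (hSm t)
  -- Clamping time at `t` makes the integrand jointly measurable with `F t` in the second factor.
  -- The lower clamp at `a` is there because `Y` is adapted only from `a` on.
  have hψ : ∀ t ∈ Icc a T, Measurable[borel ℝ |>.prod (F t)] fun p : ℝ × Ω =>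
      k (min p.1 t) p.2 (Y (max a (min (min p.1 t) t)) p.2)
        (μ (min p.1 t)) := by
    intro t ht
    have h1 := measurable_uncurry_clamp (m' := F t) ht.1 hY.continuous fun s hs =>
      (hY.adapted s ⟨hs.1, hs.2.trans ht.2⟩).mono (F.mono hs.2) le_rfl
    exact measurable_comp_min (m' := F t) (measurable_apply_prod (m' := F t)
      (u := fun e (p : Iic t × Ω) => k p.1 p.2 e.1 e.2)
      (fun p => hkc p.1 p.2) (fun e => hkm t e.1 e.2) h1
      (hμ.comp (measurable_subtype_coe.comp measurable_fst)))
  refine ⟨fun s ω => k (min s T) ω (Y (max a (min (min s T) T)) ω) (μ (min s T)), ?_,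
    fun t ht => ?_, ?_⟩
  · have h1 := hψ T ⟨haT, le_rfl⟩
    exact h1.mono (sup_le_sup (MeasurableSpace.comap_mono (BorelSpace.measurable_eq).ge)
      (MeasurableSpace.comap_mono (F.le T))) le_rfl
  · have h1 := measurable_integral_Ioc (m' := F t) (hψ t ht) a t
    convert h1 using 2 with ω
    refine setIntegral_congr_fun measurableSet_Ioc fun s hs => ?_
    simp only [min_eq_left hs.2, min_eq_left (hs.2.trans ht.2)]
  · filter_upwards [hS] with ω hω t ht
    have h1 : t ∈ Icc 0 T := ⟨ha.trans ht.1, ht.2⟩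
    simp only [min_eq_left ht.2, max_eq_right ht.1, hk, hω, if_true, indicator_of_mem h1]

end Coefficients

end MFDRBSDE

/-! ### Obstacles and running reward along a process, and the reduced game. -/

namespace MFDRBSDE

open Filter Topology

section Composite

variable {Ω : Type*} [m : MeasurableSpace Ω] {F : Filtration ℝ m} {P : Measure Ω}

theorem RegularOn.measurable_mean [SFinite P] {a b : ℝ} {Y : ℝ → Ω → ℝ} (hY : RegularOn F a b Y) :
    Measurable fun t => ∫ ω, Y t ω ∂P :=
  (hY.measurable_uncurry.stronglyMeasurable.integral_prod_right' (ν := P)).measurable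

theorem abs_mean_le {a b : ℝ} {Y : ℝ → Ω → ℝ} (hn : normOne F P a b Y < ∞) {t : ℝ}
    (ht : t ∈ Icc a b) : |∫ ω, Y t ω ∂P| ≤ (normOne F P a b Y).toReal :=
  abs_integral_le_integral_abs.trans (integral_abs_le_normOne hn (isStoppingTimeIn_const ht))

/-- The mean of a continuous process of class (D) is continuous. -/
theorem ClassD.continuousOn_mean [IsProbabilityMeasure P] {a b : ℝ} {Y : ℝ → Ω → ℝ}
    (hY : ClassD F P a b Y) (hYr : RegularOn F a b Y) :
    ContinuousOn (fun t => ∫ ω, Y t ω ∂P) (Icc a b) := by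
  refine continuousOn_of_uniform_approx_of_continuousOn fun u hu => ?_
  obtain ⟨ε, hε, hεu⟩ := Metric.mem_uniformity_dist.1 hu
  obtain ⟨R, hR, hn⟩ := hY (ENNReal.ofReal (ε / 2)) (ENNReal.ofReal_pos.2 (half_pos hε))
  have htr := hYr.comp (continuous_trunc R)
  have hi : ∀ t, Integrable (fun ω => trunc R (Y t ω)) P := fun t =>
    Integrable.of_bound (htr.measurable t).aestronglyMeasurable R
      (Eventually.of_forall fun ω => abs_trunc_le hR _)
  -- Means of truncations are continuous by bounded convergence, and class (D) makes the truncation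
  -- error uniform in time.
  refine ⟨fun t => ∫ ω, trunc R (Y t ω) ∂P, ?_, fun t ht => hεu ?_⟩
  · exact (continuous_of_dominated (bound := fun _ => R)
      (fun t => (htr.measurable t).aestronglyMeasurable)
      (fun t => Eventually.of_forall fun ω => abs_trunc_le hR _) (integrable_const _)
      (Eventually.of_forall htr.continuous)).continuousOn
  · have hτ : IsStoppingTimeIn F P a b fun _ => t := isStoppingTimeIn_const ht
    have h1 := hYr.integrable_comp hY.normOne_lt_top hτ
    have h2 := (hYr.tail R).integrable_comp (hn.trans_lt ENNReal.ofReal_lt_top) hτ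
    rw [Real.dist_eq, ← integral_sub h1 (hi t)]
    refine lt_of_le_of_lt (abs_integral_le_integral_abs.trans
      ((integral_mono (h1.sub (hi t)).abs h2 fun ω => abs_sub_trunc_le hR _).trans
      (integral_le_of_lintegral_enorm_le (half_pos hε).le
        ((lintegral_le_normOne _ hτ).trans hn)))) (half_lt_self hε)

theorem MemD.exists_regularOn (hF : NullComplete F P) {a b : ℝ} (hab : a ≤ b) {X : ℝ → Ω → ℝ}
    (hX : MemD F P a b X) : ∃ X', RegularOn F a b X' ∧ normOne F P a b X' < ∞ ∧
      ∀ᵐ ω ∂P, ∀ t ∈ Icc a b, X' t ω = X t ω := by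
  obtain ⟨X', h1, h2⟩ := hF.exists_regularOn hab hX.adapted hX.continuous_paths
  exact ⟨X', h1, (normOne_congr_ae h2).trans_lt hX.norm_lt_top, h2⟩

theorem ClassD.congr {a b : ℝ} {X Y : ℝ → Ω → ℝ} (hY : ClassD F P a b Y)
    (h : ∀ᵐ ω ∂P, ∀ t ∈ Icc a b, X t ω = Y t ω) : ClassD F P a b X :=
  hY.of_le (h.mono fun ω hω t ht => by rw [hω t ht])

theorem MemClassD.exists_regularOn (hF : NullComplete F P) {a b : ℝ} (hab : a ≤ b)
    {X : ℝ → Ω → ℝ} (hX : MemClassD F P a b X) : ∃ X', RegularOn F a b X' ∧ ClassD F P a b X' ∧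
      ∀ᵐ ω ∂P, ∀ t ∈ Icc a b, X' t ω = X t ω := by
  obtain ⟨X', h1, -, h2⟩ := hX.toMemD.exists_regularOn hF hab
  exact ⟨X', h1, hX.classD.congr h2, h2⟩

/-- An obstacle evaluated along a process and its mean. -/
theorem NullComplete.exists_obstacle [IsProbabilityMeasure P] (hF : NullComplete F P) {a T : ℝ}
    (ha : 0 ≤ a) (haT : a ≤ T) {h : ℝ → Ω → ℝ → ℝ → ℝ} {K₁ K₂ : ℝ} (hK₁ : 0 ≤ K₁) (hK₂ : 0 ≤ K₂)
    (hK : K₁ ≤ 1)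
    (had : ∀ x x', ∀ t ∈ Icc (0 : ℝ) T, Measurable[F t] fun ω => h t ω x x')
    (hc : ∀ x x', ∀ᵐ ω ∂P, ContinuousOn (fun t => h t ω x x') (Icc 0 T))
    (hl : ∀ᵐ ω ∂P, ∀ t ∈ Icc (0 : ℝ) T, ∀ x x' y y' : ℝ,
      |h t ω x x' - h t ω y y'| ≤ K₁ * |x - y| + K₂ * |x' - y'|)
    (hD : MemClassD F P 0 T fun t ω => h t ω 0 0)
    {Y : ℝ → Ω → ℝ} (hY : RegularOn F a T Y) (hn : normOne F P a T Y < ∞) :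
    ∃ L : ℝ → Ω → ℝ, (Measurable fun p : ℝ × Ω => L p.1 p.2) ∧
      (∀ τ, IsStoppingTimeIn F P a T τ → Integrable (fun ω => L (τ ω) ω) P) ∧
      (∀ᵐ ω ∂P, ∀ t ∈ Icc a T, L t ω = h t ω (Y t ω) (∫ ω', Y t ω' ∂P)) ∧
      (ClassD F P a T Y → RegularOn F a T L ∧ ClassD F P a T L) := by
  obtain ⟨L, hLm, hLF, hLc, hLh⟩ := hF.exists_coefficient_comp ha haT hK₁ hK₂ had hc hl hY
    (hY.measurable_mean (P := P))
  set C := (normOne F P a T Y).toReal with hC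
  obtain ⟨H, hHr, hHD, hHh⟩ := hD.exists_regularOn hF (ha.trans haT)
  have hsub : Icc a T ⊆ Icc 0 T := Icc_subset_Icc_left ha
  have hHr' : RegularOn F a T H := hHr.mono hsub
  have hHD' : ClassD F P a T H := fun ε hε => by
    obtain ⟨R, hR, h1⟩ := hHD ε hε
    exact ⟨R, hR, (normOne_mono_interval _ ha le_rfl).trans h1⟩
  -- The Lipschitz bound is compared with the value at zero, the mean of `Y` being at most the norm
  -- `C`; `K₁ ≤ 1` removes one constant.
  have hbd : ∀ᵐ ω ∂P, ∀ t ∈ Icc a T, |L t ω| ≤ |H t ω| + (|Y t ω| + K₂ * C) := by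
    filter_upwards [hLh, hHh, hl] with ω h1 h2 h3 t ht
    rw [h1 t ht, h2 t (hsub ht)]
    have h4 := h3 t (hsub ht) (Y t ω) (∫ ω', Y t ω' ∂P) 0 0
    rw [sub_zero, sub_zero] at h4
    have h5 := abs_sub_abs_le_abs_sub (h t ω (Y t ω) (∫ ω', Y t ω' ∂P)) (h t ω 0 0)
    have h6 := mul_le_mul_of_nonneg_left (abs_mean_le hn ht) hK₂
    have h7 := mul_le_of_le_one_left (abs_nonneg (Y t ω)) hK
    linarith
  have hint : ∀ τ, IsStoppingTimeIn F P a T τ → Integrable (fun ω => L (τ ω) ω) P := by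
    intro τ hτ
    refine ((hHr'.integrable_comp hHD'.normOne_lt_top hτ).abs.add
      ((hY.integrable_comp hn hτ).abs.add (integrable_const (K₂ * C)))).mono'
      (hLm.comp (hτ.measurable.prodMk measurable_id)).aestronglyMeasurable ?_
    filter_upwards [hbd, hτ.2] with ω h1 h2 using h1 _ h2
  -- Only for class (D) is the mean, hence the obstacle, known to be continuous. Otherwise the
  -- merely measurable version is kept, which suffices for the contraction estimate.
  by_cases hYD : ClassD F P a T Y
  · obtain ⟨L', hL'r, hL'⟩ := hF.exists_regularOn haT hLF
      (Eventually.of_forall (hLc (hYD.continuousOn_mean hY)))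
    have hZ : ClassD F P a T fun t ω => |Y t ω| + K₂ * C :=
      hYD.of_le_add (Z := fun _ _ => K₂ * C) (classD_of_integrable_bound
        (integrable_const |K₂ * C|) (Eventually.of_forall fun _ _ _ => le_rfl)) hY
        (Eventually.of_forall fun ω t _ => by
          simpa using abs_add_le |Y t ω| (K₂ * C))
    have hC0 : 0 ≤ K₂ * C := mul_nonneg hK₂ ENNReal.toReal_nonneg
    have hL'D : ClassD F P a T L' := hHD'.of_le_add hZ hHr' (by
      filter_upwards [hL', hbd] with ω h1 h2 t ht
      rw [h1 t ht, abs_of_nonneg (add_nonneg (abs_nonneg (Y t ω)) hC0)]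
      exact h2 t ht)
    refine ⟨L', hL'r.measurable_uncurry, fun τ hτ => hL'r.integrable_comp hL'D.normOne_lt_top hτ,
      ?_, fun _ => ⟨hL'r, hL'D⟩⟩
    filter_upwards [hL', hLh] with ω h1 h2 t ht
    rw [h1 t ht, h2 t ht]
  · exact ⟨L, hLm, hint, hLh, fun h => absurd h hYD⟩

/-- The running reward along a process and its mean. -/
theorem NullComplete.exists_running_reward [IsProbabilityMeasure P] (hF : NullComplete F P)
    {a T : ℝ} (ha : 0 ≤ a) (haT : a ≤ T) {f : ℝ → Ω → ℝ → ℝ → ℝ} {K : ℝ} (hK : 0 ≤ K)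
    (hp : ∀ y y', IsStronglyProgressive F
      fun t ω => (Icc (0 : ℝ) T).indicator (fun s => f s ω y y') t)
    (h0 : ∫⁻ ω, (∫⁻ t in Icc (0 : ℝ) T, ‖f t ω 0 0‖ₑ) ∂P < ∞)
    (hl : ∀ᵐ ω ∂P, ∀ t ∈ Icc (0 : ℝ) T, ∀ y₁ y₁' y₂ y₂' : ℝ,
      |f t ω y₁ y₁' - f t ω y₂ y₂'| ≤ K * (|y₁ - y₂| + |y₁' - y₂'|))
    {Y : ℝ → Ω → ℝ} (hY : RegularOn F a T Y) (hn : normOne F P a T Y < ∞) :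
    ∃ A : ℝ → Ω → ℝ, RegularOn F a T A ∧ ClassD F P a T A ∧
      ∀ᵐ ω ∂P, IntegrableOn (fun s => f s ω (Y s ω) (∫ ω', Y s ω' ∂P)) (Icc a T) ∧
        ∀ t ∈ Icc a T, A t ω = ∫ s in a..t, f s ω (Y s ω) (∫ ω', Y s ω' ∂P) := by
  obtain ⟨φ, hφm, hφF, hφf⟩ := hF.exists_driver_comp ha haT hK hp hl hY
    (hY.measurable_mean (P := P))
  set C := (normOne F P a T Y).toReal with hC
  have hsub : Icc a T ⊆ Icc 0 T := Icc_subset_Icc_left ha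
  -- The part of the driver coming from the Lipschitz bound; exchanging the integrals bounds its
  -- mean by the norm of `Y` times the length of the interval.
  set v : Ω × ℝ → ℝ≥0∞ := fun p => ENNReal.ofReal K * (‖Y p.2 p.1‖ₑ + ENNReal.ofReal C) with hv
  have hYm : Measurable fun p : Ω × ℝ => Y p.2 p.1 := hY.measurable_uncurry.comp measurable_swap
  have hvm : Measurable v := (hYm.enorm.add measurable_const).const_mul _
  have hφm' : Measurable fun p : Ω × ℝ => φ p.2 p.1 := hφm.comp measurable_swap
  have hbd : ∀ᵐ ω ∂P, ∀ t ∈ Icc a T, ‖φ t ω‖ₑ ≤ ‖f t ω 0 0‖ₑ + v (ω, t) := by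
    filter_upwards [hφf, hl] with ω h1 h2 t ht
    have h3 := h2 t (hsub ht) (Y t ω) (∫ ω', Y t ω' ∂P) 0 0
    rw [sub_zero, sub_zero, ← h1 t ht] at h3
    have h4 : |φ t ω| ≤ |f t ω 0 0| + K * (|Y t ω| + C) := by
      have h5 := abs_sub_abs_le_abs_sub (φ t ω) (f t ω 0 0)
      have h6 := mul_le_mul_of_nonneg_left
        (add_le_add_right (abs_mean_le hn ht) |Y t ω|) hK
      linarith
    simp only [hv, Real.enorm_eq_ofReal_abs]
    rw [← ENNReal.ofReal_add (abs_nonneg _) ENNReal.toReal_nonneg, ← ENNReal.ofReal_mul hK,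
      ← ENNReal.ofReal_add (abs_nonneg _)
        (mul_nonneg hK (add_nonneg (abs_nonneg _) ENNReal.toReal_nonneg))]
    exact ENNReal.ofReal_le_ofReal h4
  have hfin : ∫⁻ ω, (∫⁻ s in Icc a T, ‖φ s ω‖ₑ) ∂P < ∞ := by
    have h1 : ∫⁻ ω, (∫⁻ s in Icc a T, v (ω, s)) ∂P < ∞ := by
      rw [lintegral_lintegral_swap (f := fun ω s => v (ω, s)) hvm.aemeasurable]
      refine lt_of_le_of_lt (setLIntegral_mono (g := fun _ => ENNReal.ofReal K *
        (normOne F P a T Y + ENNReal.ofReal C)) measurable_const fun s hs => ?_) ?_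
      · simp only [hv]
        rw [lintegral_const_mul' _ _ ENNReal.ofReal_ne_top,
          lintegral_add_right _ measurable_const, lintegral_const, measure_univ, mul_one]
        gcongr
        exact lintegral_le_normOne Y (isStoppingTimeIn_const hs)
      · rw [setLIntegral_const]
        refine ENNReal.mul_lt_top (ENNReal.mul_lt_top ENNReal.ofReal_lt_top
          (ENNReal.add_lt_top.2 ⟨hn, ENNReal.ofReal_lt_top⟩)) (by simp)
    refine lt_of_le_of_lt (lintegral_mono_ae (g := fun ω => (∫⁻ t in Icc (0 : ℝ) T, ‖f t ω 0 0‖ₑ)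
      + ∫⁻ s in Icc a T, v (ω, s)) ?_) ?_
    · filter_upwards [hbd] with ω hω
      refine (setLIntegral_mono' measurableSet_Icc hω).trans ?_
      have hvω : Measurable fun s => v (ω, s) := hvm.comp measurable_prodMk_left
      rw [lintegral_add_right _ hvω]
      exact add_le_add (lintegral_mono_set hsub) le_rfl
    · rw [lintegral_add_right _ hvm.lintegral_prod_right']
      exact ENNReal.add_lt_top.2 ⟨h0, h1⟩
  have hφi : Integrable (fun p : Ω × ℝ => φ p.2 p.1) (P.prod (volume.restrict (Icc a T))) := by
    refine ⟨hφm'.aestronglyMeasurable, ?_⟩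
    rw [HasFiniteIntegral, lintegral_prod _ hφm'.enorm.aemeasurable]
    exact hfin
  have hφω : ∀ᵐ ω ∂P, IntegrableOn (fun s => φ s ω) (Icc a T) := hφi.prod_right_ae
  obtain ⟨A, hAr, hA⟩ := hF.exists_regularOn haT (X := fun t ω => ∫ s in Ioc a t, φ s ω) hφF
    (hφω.mono fun ω hω => intervalIntegral.continuousOn_primitive hω)
  -- The integral of `|φ|` over the whole interval is an integrable bound for every `A t`.
  refine ⟨A, hAr, classD_of_integrable_bound hφi.integral_norm_prod_left ?_, ?_⟩
  · filter_upwards [hA, hφω] with ω h1 h2 t ht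
    rw [h1 t ht]
    refine abs_integral_le_integral_abs.trans (setIntegral_mono_set h2.norm
      (Eventually.of_forall fun s => abs_nonneg _)
      (Eventually.of_forall fun s hs => ⟨hs.1.le, hs.2.trans ht.2⟩))
  · filter_upwards [hA, hφω, hφf] with ω h1 h2 h3
    refine ⟨h2.congr_fun h3 measurableSet_Icc, fun t ht => ?_⟩
    rw [h1 t ht, intervalIntegral.integral_of_le ht.1]
    exact setIntegral_congr_fun measurableSet_Ioc fun s hs => h3 s ⟨hs.1.le, hs.2.trans ht.2⟩

/-- The payoff as the payoff of a game without running reward. -/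
theorem payoff_ae_eq {a T : ℝ} {f h g : ℝ → Ω → ℝ → ℝ → ℝ} {ξ : Ω → ℝ} {Y A L U : ℝ → Ω → ℝ}
    (hA : ∀ᵐ ω ∂P, IntegrableOn (fun s => f s ω (Y s ω) (∫ ω', Y s ω' ∂P)) (Icc a T) ∧
      ∀ t ∈ Icc a T, A t ω = ∫ s in a..t, f s ω (Y s ω) (∫ ω', Y s ω' ∂P))
    (hL : ∀ᵐ ω ∂P, ∀ t ∈ Icc a T, L t ω = h t ω (Y t ω) (∫ ω', Y t ω' ∂P))
    (hU : ∀ᵐ ω ∂P, ∀ t ∈ Icc a T, U t ω = g t ω (Y t ω) (∫ ω', Y t ω' ∂P))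
    {t : ℝ} (ht : t ∈ Icc a T) {τ σ : Ω → ℝ} (hτ : IsStoppingTimeIn F P t T τ)
    (hσ : IsStoppingTimeIn F P t T σ) :
    payoff P T f h g ξ Y t τ σ =ᵐ[P] fun ω =>
      gamePayoff T (fun s ω => L s ω + A s ω) (fun s ω => U s ω + A s ω) (fun ω => ξ ω + A T ω)
        (τ ω) (σ ω) ω - A t ω := by
  filter_upwards [hA, hL, hU, hτ.2, hσ.2] with ω ⟨h1, h2⟩ h3 h4 h5 h6
  have hint : ∀ {r}, r ∈ Icc t T →
      ∫ s in t..r, f s ω (Y s ω) (∫ ω', Y s ω' ∂P) = A r ω - A t ω := by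
    intro r hr
    rw [h2 r ⟨ht.1.trans hr.1, hr.2⟩, h2 t ht, intervalIntegral.integral_interval_sub_left]
    · exact (intervalIntegrable_iff_integrableOn_Icc_of_le (ht.1.trans hr.1)).2
        (h1.mono_set (Icc_subset_Icc_right hr.2))
    · exact (intervalIntegrable_iff_integrableOn_Icc_of_le ht.1).2
        (h1.mono_set (Icc_subset_Icc_right ht.2))
  have hmem : ∀ {r}, r ∈ Icc t T → r ∈ Icc a T := fun hr => ⟨ht.1.trans hr.1, hr.2⟩
  unfold payoff gamePayoff
  by_cases hlt : σ ω < τ ω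
  · rw [min_eq_left hlt.le, if_pos hlt, if_neg (fun h => absurd h.1 (not_le.2 hlt)),
      if_neg (fun h => absurd hlt (by rw [h.1, h.2]; exact lt_irrefl _)), if_pos hlt, hint h6,
      ← h4 _ (hmem h6)]
    ring
  · rw [min_eq_right (not_lt.1 hlt), if_neg hlt, if_neg hlt, hint h5]
    by_cases hT : τ ω < T
    · rw [if_pos ⟨not_lt.1 hlt, hT⟩, if_neg (fun h => hT.ne h.1), if_pos hT, ← h3 _ (hmem h5)]
      ring
    · have h7 : τ ω = T := le_antisymm h5.2 (not_lt.1 hT)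
      have h8 : σ ω = T := le_antisymm h6.2 (h7 ▸ not_lt.1 hlt)
      rw [if_neg (fun h => hT h.2), if_pos ⟨h7, h8⟩, if_neg hT, h7]
      ring

end Composite

end MFDRBSDE

/-! ### `Φ` preserves class (D) and the terminal value. -/

namespace MFDRBSDE

open Filter Topology

section Phi

variable {Ω : Type*} [m : MeasurableSpace Ω] {F : Filtration ℝ m} {P : Measure Ω}

theorem IsEssInf.sub_right {ι : Type*} {Z Z' : ι → Ω → ℝ} {X c : Ω → ℝ} (h : IsEssInf P Z X)
    (hc : AEMeasurable c P) (hZ : ∀ i, Z' i =ᵐ[P] Z i - c) : IsEssInf P Z' (X - c) := by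
  refine ⟨h.1.sub hc, fun i => ?_, fun W hW hWZ => ?_⟩
  · filter_upwards [h.2.1 i, hZ i] with ω h1 h2
    rw [h2]
    exact sub_le_sub_right h1 _
  · filter_upwards [h.2.2 (W + c) (hW.add hc) fun i => by
      filter_upwards [hWZ i, hZ i] with ω h1 h2
      rw [h2, Pi.sub_apply] at h1
      rw [Pi.add_apply]
      linarith] with ω h1
    rw [Pi.add_apply] at h1
    rw [Pi.sub_apply]
    linarith

theorem IsEssSup.sub_right {ι : Type*} {Z : ι → Ω → ℝ} {X c : Ω → ℝ} (h : IsEssSup P Z X)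
    (hc : AEMeasurable c P) : IsEssSup P (fun i => Z i - c) (X - c) := by
  refine ⟨h.1.sub hc, fun i => ?_, fun W hW hWZ => ?_⟩
  · filter_upwards [h.2.1 i] with ω h1
    exact sub_le_sub_right h1 _
  · filter_upwards [h.2.2 (W + c) (hW.add hc) fun i => by
      filter_upwards [hWZ i] with ω h1
      rw [Pi.sub_apply] at h1
      rw [Pi.add_apply]
      linarith] with ω h1
    rw [Pi.add_apply] at h1
    rw [Pi.sub_apply]
    linarith

theorem integrable_gamePayoff_of_integrable {b : ℝ} {L U : ℝ → Ω → ℝ}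
    (hL : Measurable fun p : ℝ × Ω => L p.1 p.2) (hU : Measurable fun p : ℝ × Ω => U p.1 p.2)
    {ξ : Ω → ℝ} (hξ : Measurable ξ) (hξi : Integrable ξ P) {τ σ : Ω → ℝ} (hτ : Measurable τ)
    (hσ : Measurable σ) (hLi : Integrable (fun ω => L (τ ω) ω) P)
    (hUi : Integrable (fun ω => U (σ ω) ω) P) :
    Integrable (fun ω => gamePayoff b L U ξ (τ ω) (σ ω) ω) P :=
  ((hLi.abs.add hUi.abs).add hξi.abs).mono'
    (measurable_gamePayoff hL hU hξ hτ hσ).aestronglyMeasurable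
    (Eventually.of_forall fun _ => abs_gamePayoff_le _ _ _ _ _ _ _)

variable {T a : ℝ} {f h g : ℝ → Ω → ℝ → ℝ → ℝ} {ξ : Ω → ℝ} {Cf γ₁ γ₂ β₁ β₂ : ℝ}

/-- The running reward `A` and the obstacles `L`, `U` along the process `Y`. -/
structure IsComposite (F : Filtration ℝ m) (P : Measure Ω) (a T : ℝ) (f h g : ℝ → Ω → ℝ → ℝ → ℝ)
    (Y A L U : ℝ → Ω → ℝ) : Prop where
  regular_reward : RegularOn F a T A
  classD_reward : ClassD F P a T A
  reward_eq : ∀ᵐ ω ∂P, IntegrableOn (fun s => f s ω (Y s ω) (∫ ω', Y s ω' ∂P)) (Icc a T) ∧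
    ∀ t ∈ Icc a T, A t ω = ∫ s in a..t, f s ω (Y s ω) (∫ ω', Y s ω' ∂P)
  measurable_lower : Measurable fun p : ℝ × Ω => L p.1 p.2
  integrable_lower : ∀ τ, IsStoppingTimeIn F P a T τ → Integrable (fun ω => L (τ ω) ω) P
  lower_eq : ∀ᵐ ω ∂P, ∀ t ∈ Icc a T, L t ω = h t ω (Y t ω) (∫ ω', Y t ω' ∂P)
  measurable_upper : Measurable fun p : ℝ × Ω => U p.1 p.2
  integrable_upper : ∀ τ, IsStoppingTimeIn F P a T τ → Integrable (fun ω => U (τ ω) ω) P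
  upper_eq : ∀ᵐ ω ∂P, ∀ t ∈ Icc a T, U t ω = g t ω (Y t ω) (∫ ω', Y t ω' ∂P)

/-- The work is done on a regular version of `Y`; indistinguishable processes have the same means,
so the identities transfer to `Y`. Regular obstacles of class (D) are claimed only if `Y` is of
class (D). -/
theorem AssumptionA1.exists_composite [IsProbabilityMeasure P] (hF : NullComplete F P)
    (hA : AssumptionA1 F P T f h g ξ Cf γ₁ γ₂ β₁ β₂) (hCf : 0 ≤ Cf) (hγ₁ : 0 ≤ γ₁) (hγ₂ : 0 ≤ γ₂)
    (hβ₁ : 0 ≤ β₁) (hβ₂ : 0 ≤ β₂) (hγ : γ₁ ≤ 1) (hβ : β₁ ≤ 1) (ha : 0 ≤ a) (haT : a ≤ T)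
    {Y : ℝ → Ω → ℝ} (hY : MemD F P a T Y) :
    ∃ A L U, IsComposite F P a T f h g Y A L U ∧ (MemClassD F P a T Y →
      RegularOn F a T L ∧ ClassD F P a T L ∧ RegularOn F a T U ∧ ClassD F P a T U) := by
  obtain ⟨Z, hZ, hZn, hZY⟩ := hY.exists_regularOn hF haT
  have hmean : ∀ t ∈ Icc a T, ∫ ω, Z t ω ∂P = ∫ ω, Y t ω ∂P := fun t ht =>
    integral_congr_ae (hZY.mono fun ω hω => hω t ht)
  obtain ⟨L, hLm, hLi, hLe, hLD⟩ := hF.exists_obstacle ha haT hγ₁ hγ₂ hγ hA.h_adapted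
    hA.h_continuous hA.h_lipschitz hA.h_zero_classD hZ hZn
  obtain ⟨U, hUm, hUi, hUe, hUD⟩ := hF.exists_obstacle ha haT hβ₁ hβ₂ hβ hA.g_adapted
    hA.g_continuous hA.g_lipschitz hA.g_zero_classD hZ hZn
  obtain ⟨A, hAr, hAD, hAe⟩ := hF.exists_running_reward ha haT hCf hA.f_progressive
    hA.f_zero_integrable hA.f_lipschitz hZ hZn
  refine ⟨A, L, U, ⟨hAr, hAD, ?_, hLm, hLi, ?_, hUm, hUi, ?_⟩, fun hYD => ?_⟩
  · filter_upwards [hAe, hZY] with ω ⟨h1, h2⟩ h3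
    have h4 : EqOn (fun s => f s ω (Z s ω) (∫ ω', Z s ω' ∂P))
        (fun s => f s ω (Y s ω) (∫ ω', Y s ω' ∂P)) (Icc a T) := fun s hs => by
      simp only [h3 s hs, hmean s hs]
    refine ⟨h1.congr_fun h4 measurableSet_Icc, fun t ht => ?_⟩
    rw [h2 t ht]
    refine intervalIntegral.integral_congr fun s hs => ?_
    rw [uIcc_of_le ht.1] at hs
    exact h4 ⟨hs.1, hs.2.trans ht.2⟩
  · filter_upwards [hLe, hZY] with ω h1 h2 t ht
    rw [h1 t ht, h2 t ht, hmean t ht]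
  · filter_upwards [hUe, hZY] with ω h1 h2 t ht
    rw [h1 t ht, h2 t ht, hmean t ht]
  · have hZD := hYD.classD.congr hZY
    exact ⟨(hLD hZD).1, (hLD hZD).2, (hUD hZD).1, (hUD hZD).2⟩

theorem IsComposite.integrable_gamePayoff [IsProbabilityMeasure P] {Y A L U : ℝ → Ω → ℝ}
    (hc : IsComposite F P a T f h g Y A L U) (haT : a ≤ T) (hξ : Measurable ξ)
    (hξi : Integrable ξ P) {τ σ : Ω → ℝ} (hτ : IsStoppingTimeIn F P a T τ)
    (hσ : IsStoppingTimeIn F P a T σ) :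
    Integrable (fun ω => gamePayoff T (fun s ω => L s ω + A s ω) (fun s ω => U s ω + A s ω)
      (fun ω => ξ ω + A T ω) (τ ω) (σ ω) ω) P := by
  have hA := hc.regular_reward
  have hAi : ∀ {ρ}, IsStoppingTimeIn F P a T ρ → Integrable (fun ω => A (ρ ω) ω) P := fun hρ =>
    hA.integrable_comp hc.classD_reward.normOne_lt_top hρ
  exact integrable_gamePayoff_of_integrable (hc.measurable_lower.add hA.measurable_uncurry)
    (hc.measurable_upper.add hA.measurable_uncurry) (hξ.add (hA.measurable T))
    (hξi.add (hAi (isStoppingTimeIn_const ⟨haT, le_rfl⟩))) hτ.measurable hσ.measurable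
    ((hc.integrable_lower τ hτ).add (hAi hτ)) ((hc.integrable_upper σ hσ).add (hAi hσ))

theorem IsComposite.integrable_payoff [IsProbabilityMeasure P] {Y A L U : ℝ → Ω → ℝ}
    (hc : IsComposite F P a T f h g Y A L U) (haT : a ≤ T) (hξ : Measurable ξ)
    (hξi : Integrable ξ P) {t : ℝ} (ht : t ∈ Icc a T) {τ σ : Ω → ℝ}
    (hτ : IsStoppingTimeIn F P t T τ) (hσ : IsStoppingTimeIn F P t T σ) :
    Integrable (payoff P T f h g ξ Y t τ σ) P := by
  refine Integrable.congr ?_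
    (payoff_ae_eq hc.reward_eq hc.lower_eq hc.upper_eq ht hτ hσ).symm
  exact (hc.integrable_gamePayoff haT hξ hξi (hτ.mono ht.1 le_rfl) (hσ.mono ht.1 le_rfl)).sub
    (hc.regular_reward.integrable_comp hc.classD_reward.normOne_lt_top (isStoppingTimeIn_const ht))

/-- `Φ` maps processes of class (D) with terminal value `ξ` to processes of the same kind. -/
theorem AssumptionA1.exists_phi [IsProbabilityMeasure P] (hF : NullComplete F P)
    (hA : AssumptionA1 F P T f h g ξ Cf γ₁ γ₂ β₁ β₂) (hCf : 0 ≤ Cf) (hγ₁ : 0 ≤ γ₁) (hγ₂ : 0 ≤ γ₂)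
    (hβ₁ : 0 ≤ β₁) (hβ₂ : 0 ≤ β₂) (hγ : γ₁ ≤ 1) (hβ : β₁ ≤ 1) (ha : 0 ≤ a) (haT : a < T)
    (hCM : ∀ ζ : Ω → ℝ, Measurable[F T] ζ → Integrable ζ P → HasContinuousVersion F P a T ζ)
    {Y : ℝ → Ω → ℝ} (hY : MemClassD F P a T Y) (hYT : Y T =ᵐ[P] ξ) :
    ∃ X, RegularOn F a T X ∧ ClassD F P a T X ∧ X T =ᵐ[P] ξ ∧ IsPhi F P T f h g ξ a Y X := by
  obtain ⟨A, L, U, hc, hD⟩ := hA.exists_composite hF hCf hγ₁ hγ₂ hβ₁ hβ₂ hγ hβ ha haT.le hY.toMemD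
  obtain ⟨hLr, hLD, hUr, hUD⟩ := hD hY
  have hAr := hc.regular_reward
  have hAD := hc.classD_reward
  have hTm : T ∈ Icc a T := ⟨haT.le, le_rfl⟩
  have hξm : Measurable ξ := hA.ξ_measurable.mono (F.le T) le_rfl
  have hAi : ∀ t ∈ Icc a T, Integrable (A t) P := fun t ht =>
    hAr.integrable_comp hAD.normOne_lt_top (isStoppingTimeIn_const ht)
  obtain ⟨X, hXr, hXD, hXT, hX⟩ := hF.exists_game_value haT hCM
    (L := fun s ω => L s ω + A s ω) (U := fun s ω => U s ω + A s ω) (ξ := fun ω => ξ ω + A T ω)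
    (hLr.add hAr) (hUr.add hAr)
    (hLD.of_le_add hAD hLr (Eventually.of_forall fun ω t _ => abs_add_le _ _))
    (hUD.of_le_add hAD hUr (Eventually.of_forall fun ω t _ => abs_add_le _ _))
    (by
      filter_upwards [hc.lower_eq, hc.upper_eq, hA.h_lt_g] with ω h1 h2 h3 t ht
      rw [h1 t ht, h2 t ht]
      exact add_le_add_left (h3 t ⟨ha.trans ht.1, ht.2⟩ _ _).le _)
    (hA.ξ_measurable.add (hAr.adapted T hTm)) (hA.ξ_integrable.add (hAi T hTm))
    (by
      -- The terminal condition on `Y` enters here: with `Y T = ξ` the obstacles at time `T` are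
      -- those that bracket `ξ` by assumption.
      filter_upwards [hc.lower_eq, hc.upper_eq, hA.ξ_between, hYT] with ω h1 h2 h3 h4
      rw [h1 T hTm, h2 T hTm, h4, integral_congr_ae hYT]
      exact ⟨add_le_add_left h3.1 _, add_le_add_left h3.2 _⟩)
  -- Subtracting the reward accumulated before `t`, an `F t`-measurable translation common to all
  -- strategies, recovers the original payoff.
  refine ⟨fun t ω => X t ω - A t ω, hXr.sub hAr,
    hXD.of_le_add hAD hXr (Eventually.of_forall fun ω t _ => abs_sub _ _), ?_, fun t ht => ?_⟩
  · filter_upwards [hXT] with ω hω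
    rw [hω, add_sub_cancel_right]
  · obtain ⟨V, hV, hVX⟩ := hX t ht
    refine ⟨fun τ => V τ - A t, fun τ => ?_, hVX.sub_right (hAr.measurable t).aemeasurable⟩
    refine (hV τ).sub_right (hAr.measurable t).aemeasurable fun σ => ?_
    refine (condExp_congr_ae
      (payoff_ae_eq hc.reward_eq hc.lower_eq hc.upper_eq ht τ.2 σ.2)).trans ?_
    have h1 := condExp_sub (hc.integrable_gamePayoff haT.le hξm hA.ξ_integrable
      (τ.2.mono ht.1 le_rfl) (σ.2.mono ht.1 le_rfl)) (hAi t ht) (F t)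
    rwa [condExp_of_stronglyMeasurable (F.le t) (hAr.adapted t ht).stronglyMeasurable
      (hAi t ht)] at h1

end Phi

end MFDRBSDE

/-! ### The contraction estimate. -/

namespace MFDRBSDE

open Filter Topology

section Contraction

variable {Ω : Type*} [m : MeasurableSpace Ω] {F : Filtration ℝ m} {P : Measure Ω}
variable {T a : ℝ} {f h g : ℝ → Ω → ℝ → ℝ → ℝ} {ξ : Ω → ℝ} {Cf γ₁ γ₂ β₁ β₂ : ℝ}

theorem MemD.normOne_sub_lt_top (hF : NullComplete F P) {b : ℝ} (hab : a ≤ b)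
    {X Y : ℝ → Ω → ℝ} (hX : MemD F P a b X) (hY : MemD F P a b Y) :
    normOne F P a b (fun t ω => X t ω - Y t ω) < ∞ := by
  obtain ⟨X', h1, h2, h3⟩ := hX.exists_regularOn hF hab
  refine lt_of_le_of_lt (normOne_le_add h1 (Z := Y) ?_) (ENNReal.add_lt_top.2 ⟨h2, hY.norm_lt_top⟩)
  filter_upwards [h3] with ω hω t ht
  rw [hω t ht]
  exact abs_sub _ _

/-- The integral in time of the absolute value of a process in `D([a,b])`. -/
theorem RegularOn.integrable_integral_abs [IsProbabilityMeasure P] {b : ℝ} (hab : a ≤ b)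
    {Z : ℝ → Ω → ℝ} (hZ : RegularOn F a b Z) (hn : normOne F P a b Z < ∞) :
    Integrable (fun ω => ∫ s in a..b, |Z s ω|) P ∧
      ∫ ω, (∫ s in a..b, |Z s ω|) ∂P ≤ (b - a) * (normOne F P a b Z).toReal := by
  have hm : Measurable fun p : Ω × ℝ => Z p.2 p.1 := hZ.measurable_uncurry.comp measurable_swap
  have hle : ∫⁻ s in Ioc a b, ∫⁻ ω, ‖Z s ω‖ₑ ∂P ≤ normOne F P a b Z * ENNReal.ofReal (b - a) := by
    rw [← Real.volume_Ioc, ← setLIntegral_const]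
    exact setLIntegral_mono measurable_const fun s hs =>
      lintegral_le_normOne Z (isStoppingTimeIn_const ⟨hs.1.le, hs.2⟩)
  have hi : Integrable (fun p : Ω × ℝ => Z p.2 p.1) (P.prod (volume.restrict (Ioc a b))) := by
    refine ⟨hm.aestronglyMeasurable, ?_⟩
    rw [HasFiniteIntegral, lintegral_prod _ hm.enorm.aemeasurable,
      lintegral_lintegral_swap (f := fun ω s => ‖Z s ω‖ₑ) hm.enorm.aemeasurable]
    exact hle.trans_lt (ENNReal.mul_lt_top hn ENNReal.ofReal_lt_top)
  simp only [intervalIntegral.integral_of_le hab]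
  refine ⟨hi.integral_norm_prod_left, ?_⟩
  have hswap := integral_integral_swap (f := fun ω s => |Z s ω|) hi.norm
  refine hswap.trans_le ?_
  have h1 : ∀ s ∈ Ioc a b, ∫ ω, |Z s ω| ∂P ≤ (normOne F P a b Z).toReal := fun s hs =>
    integral_abs_le_normOne hn (isStoppingTimeIn_const ⟨hs.1.le, hs.2⟩)
  refine (setIntegral_mono_on hi.integral_norm_prod_right (integrable_const _) measurableSet_Ioc
    h1).trans ?_
  rw [setIntegral_const, smul_eq_mul, Real.volume_real_Ioc_of_le hab]

/-- Comparison of the values of two games whose payoffs are close. -/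
theorem essSup_le_of_payoff_le {t : ℝ} {J J' : (Ω → ℝ) → (Ω → ℝ) → Ω → ℝ} {X X' W : Ω → ℝ}
    {V V' : {τ : Ω → ℝ // IsStoppingTimeIn F P t T τ} → Ω → ℝ}
    (hV : ∀ τ, IsEssInf P (fun σ : {σ : Ω → ℝ // IsStoppingTimeIn F P t T σ} =>
      P[J τ.1 σ.1 | F t]) (V τ)) (hX : IsEssSup P V X)
    (hV' : ∀ τ, IsEssInf P (fun σ : {σ : Ω → ℝ // IsStoppingTimeIn F P t T σ} =>
      P[J' τ.1 σ.1 | F t]) (V' τ)) (hX' : IsEssSup P V' X')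
    (hW : AEMeasurable W P)
    (hJ : ∀ τ σ, IsStoppingTimeIn F P t T τ → IsStoppingTimeIn F P t T σ →
      P[J τ σ | F t] ≤ᵐ[P] P[J' τ σ | F t] + W) : X ≤ᵐ[P] X' + W := by
  refine hX.2.2 _ (hX'.1.add hW) fun τ => ?_
  have h1 : V τ - W ≤ᵐ[P] V' τ := by
    refine (hV' τ).2.2 _ ((hV τ).1.sub hW) fun σ => ?_
    filter_upwards [(hV τ).2.1 σ, hJ τ.1 σ.1 τ.2 σ.2] with ω h2 h3
    rw [Pi.add_apply] at h3
    rw [Pi.sub_apply]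
    linarith
  filter_upwards [h1, hX'.2.1 τ] with ω h2 h3
  rw [Pi.sub_apply] at h2
  rw [Pi.add_apply]
  linarith

/-- The payoffs along two processes differ at most by Lipschitz bounds. -/
theorem AssumptionA1.abs_payoff_sub_le (hA : AssumptionA1 F P T f h g ξ Cf γ₁ γ₂ β₁ β₂)
    (hCf : 0 ≤ Cf) (hγ₁ : 0 ≤ γ₁) (hγ₂ : 0 ≤ γ₂) (hβ₁ : 0 ≤ β₁) (hβ₂ : 0 ≤ β₂) (ha : 0 ≤ a)
    {Y Y' A A' L L' U U' Z : ℝ → Ω → ℝ} (hc : IsComposite F P a T f h g Y A L U)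
    (hc' : IsComposite F P a T f h g Y' A' L' U') (hZ : RegularOn F a T Z)
    (hZY : ∀ᵐ ω ∂P, ∀ t ∈ Icc a T, Z t ω = Y t ω - Y' t ω) {n : ℝ}
    (hn : ∀ t ∈ Icc a T, |∫ ω, Y t ω ∂P - ∫ ω, Y' t ω ∂P| ≤ n) {t : ℝ} (ht : t ∈ Icc a T)
    {τ σ : Ω → ℝ} (hτ : IsStoppingTimeIn F P t T τ) (hσ : IsStoppingTimeIn F P t T σ) :
    ∀ᵐ ω ∂P, |payoff P T f h g ξ Y t τ σ ω - payoff P T f h g ξ Y' t τ σ ω| ≤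
      (γ₁ + β₁) * |Z (min (τ ω) (σ ω)) ω| + ((γ₂ + β₂) * n + Cf * (∫ s in a..T, |Z s ω|)
        + Cf * (T - a) * n) := by
  have hn0 : 0 ≤ n := (abs_nonneg _).trans (hn t ht)
  filter_upwards [hc.reward_eq, hc'.reward_eq, hZY, hA.f_lipschitz, hA.h_lipschitz,
    hA.g_lipschitz, hτ.2, hσ.2] with ω ⟨hi, _⟩ ⟨hi', _⟩ h1 h2 h3 h4 h5 h6
  have hsub : Icc a T ⊆ Icc 0 T := Icc_subset_Icc_left ha
  have hmem : ∀ {r}, r ∈ Icc t T → r ∈ Icc a T := fun hr => ⟨ht.1.trans hr.1, hr.2⟩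
  have hρ : min (σ ω) (τ ω) ∈ Icc t T := ⟨le_min h6.1 h5.1, (min_le_left _ _).trans h6.2⟩
  set ρ := min (σ ω) (τ ω) with hρdef
  have hcont := hZ.continuous ω
  have hbi : ∀ x y : ℝ, IntervalIntegrable (fun s => Cf * (|Z s ω| + n)) volume x y := fun x y =>
    (continuous_const.mul (hcont.abs.add continuous_const)).intervalIntegrable _ _
  have hII : ∀ {φ : ℝ → ℝ}, IntegrableOn φ (Icc a T) → IntervalIntegrable φ volume t ρ :=
    fun hφ => (intervalIntegrable_iff_integrableOn_Icc_of_le hρ.1).2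
      (hφ.mono_set (Icc_subset_Icc ht.1 hρ.2))
  -- The interval of integration is enlarged to `[a,T]`, which makes the bound independent of the
  -- stopping times.
  have hrun : |(∫ s in t..ρ, f s ω (Y s ω) (∫ ω', Y s ω' ∂P))
      - ∫ s in t..ρ, f s ω (Y' s ω) (∫ ω', Y' s ω' ∂P)| ≤
      Cf * (∫ s in a..T, |Z s ω|) + Cf * (T - a) * n := by
    rw [← intervalIntegral.integral_sub (hII hi) (hII hi')]
    have h7 : ∀ s ∈ Ioc t ρ, ‖f s ω (Y s ω) (∫ ω', Y s ω' ∂P)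
        - f s ω (Y' s ω) (∫ ω', Y' s ω' ∂P)‖ ≤ Cf * (|Z s ω| + n) := by
      intro s hs
      have hs' : s ∈ Icc a T := hmem ⟨hs.1.le, hs.2.trans hρ.2⟩
      refine (h2 s (hsub hs') _ _ _ _).trans (mul_le_mul_of_nonneg_left ?_ hCf)
      rw [h1 s hs']
      exact add_le_add_right (hn s hs') _
    have h8 := intervalIntegral.norm_integral_le_of_norm_le hρ.1
      (Eventually.of_forall h7) (hbi t ρ)
    refine h8.trans ((intervalIntegral.integral_mono_interval ht.1 hρ.1 hρ.2
      (Eventually.of_forall fun s => mul_nonneg hCf (add_nonneg (abs_nonneg _) hn0))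
      (hbi a T)).trans_eq ?_)
    rw [intervalIntegral.integral_const_mul, intervalIntegral.integral_add
      (hcont.abs.intervalIntegrable _ _) (by simp), intervalIntegral.integral_const, smul_eq_mul]
    ring
  have hterm : ∀ {k : ℝ → Ω → ℝ → ℝ → ℝ} {K₁ K₂ : ℝ}, 0 ≤ K₂ →
      (∀ t ∈ Icc (0 : ℝ) T, ∀ x x' y y' : ℝ,
        |k t ω x x' - k t ω y y'| ≤ K₁ * |x - y| + K₂ * |x' - y'|) → ∀ r ∈ Icc t T,
      |k r ω (Y r ω) (∫ ω', Y r ω' ∂P) - k r ω (Y' r ω) (∫ ω', Y' r ω' ∂P)| ≤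
        K₁ * |Z r ω| + K₂ * n := by
    intro k K₁ K₂ hK₂ hk r hr
    rw [h1 r (hmem hr)]
    exact (hk r (hsub (hmem hr)) _ _ _ _).trans
      (add_le_add_right (mul_le_mul_of_nonneg_left (hn r (hmem hr)) hK₂) _)
  -- At most one obstacle is paid, and it is paid at the minimum of the two times. Adding both pairs
  -- of constants gives one bound valid in every case; the terminal payoff cancels.
  have hZ0 := abs_nonneg (Z (min (τ ω) (σ ω)) ω)
  have e1 := mul_nonneg hγ₁ hZ0
  have e2 := mul_nonneg hβ₁ hZ0
  have e3 := mul_nonneg hγ₂ hn0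
  have e4 := mul_nonneg hβ₂ hn0
  have hrun1 := abs_le.1 hrun
  unfold payoff
  by_cases hlt : σ ω < τ ω
  · have hU := abs_le.1 (hterm hβ₂ h4 (σ ω) h6)
    rw [if_pos hlt, if_neg (fun h => absurd h.1 (not_le.2 hlt)),
      if_neg (fun h => absurd hlt (by rw [h.1, h.2]; exact lt_irrefl _)), if_pos hlt,
      if_neg (fun h => absurd h.1 (not_le.2 hlt)), ← hρdef]
    rw [min_eq_right hlt.le] at *
    exact abs_le.2 ⟨by linarith, by linarith⟩
  · rw [if_neg hlt, if_neg hlt, ← hρdef]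
    rw [min_eq_left (not_lt.1 hlt)] at *
    have hL := abs_le.1 (hterm hγ₂ h3 (τ ω) h5)
    by_cases hT : τ ω < T
    · rw [if_pos ⟨not_lt.1 hlt, hT⟩, if_neg (fun h => hT.ne h.1), if_pos ⟨not_lt.1 hlt, hT⟩]
      exact abs_le.2 ⟨by linarith, by linarith⟩
    · have hT' : ¬(τ ω ≤ σ ω ∧ τ ω < T) := fun h => hT h.2
      rw [if_neg hT', if_neg hT']
      exact abs_le.2 ⟨by linarith, by linarith⟩

/-- The contraction estimate for `Φ`. -/
theorem AssumptionA1.normOne_phi_sub_le [IsProbabilityMeasure P] (hF : NullComplete F P)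
    (hA : AssumptionA1 F P T f h g ξ Cf γ₁ γ₂ β₁ β₂) (hCf : 0 ≤ Cf) (hγ₁ : 0 ≤ γ₁) (hγ₂ : 0 ≤ γ₂)
    (hβ₁ : 0 ≤ β₁) (hβ₂ : 0 ≤ β₂) (hγ : γ₁ ≤ 1) (hβ : β₁ ≤ 1) (ha : 0 ≤ a) (haT : a ≤ T)
    {Y Y' X X' : ℝ → Ω → ℝ} (hY : MemD F P a T Y) (hY' : MemD F P a T Y') (hX : MemD F P a T X)
    (hX' : MemD F P a T X') (hΦ : IsPhi F P T f h g ξ a Y X) (hΦ' : IsPhi F P T f h g ξ a Y' X') :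
    normOne F P a T (fun t ω => X t ω - X' t ω) ≤
      ENNReal.ofReal (γ₁ + γ₂ + β₁ + β₂ + 2 * Cf * (T - a)) *
        normOne F P a T (fun t ω => Y t ω - Y' t ω) := by
  obtain ⟨A, L, U, hc, -⟩ := hA.exists_composite hF hCf hγ₁ hγ₂ hβ₁ hβ₂ hγ hβ ha haT hY
  obtain ⟨A', L', U', hc', -⟩ := hA.exists_composite hF hCf hγ₁ hγ₂ hβ₁ hβ₂ hγ hβ ha haT hY'
  obtain ⟨Z₁, hZ₁, hZ₁n, hZ₁Y⟩ := hY.exists_regularOn hF haT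
  obtain ⟨Z₂, hZ₂, hZ₂n, hZ₂Y⟩ := hY'.exists_regularOn hF haT
  obtain ⟨X₁, hX₁, -, hX₁X⟩ := hX.exists_regularOn hF haT
  obtain ⟨X₂, hX₂, -, hX₂X⟩ := hX'.exists_regularOn hF haT
  have hξm : Measurable ξ := hA.ξ_measurable.mono (F.le T) le_rfl
  set Z : ℝ → Ω → ℝ := fun t ω => Z₁ t ω - Z₂ t ω with hZdef
  have hZ : RegularOn F a T Z := hZ₁.sub hZ₂
  have hZY : ∀ᵐ ω ∂P, ∀ t ∈ Icc a T, Z t ω = Y t ω - Y' t ω := by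
    filter_upwards [hZ₁Y, hZ₂Y] with ω h1 h2 t ht
    simp only [hZdef, h1 t ht, h2 t ht]
  rw [← normOne_congr_ae hZY, ← normOne_congr_ae (X := fun t ω => X₁ t ω - X₂ t ω) (by
    filter_upwards [hX₁X, hX₂X] with ω h1 h2 t ht
    rw [h1 t ht, h2 t ht])]
  have hZn : normOne F P a T Z < ∞ := by
    rw [normOne_congr_ae hZY]
    exact hY.normOne_sub_lt_top hF haT hY'
  set n := (normOne F P a T Z).toReal with hn
  have hn0 : 0 ≤ n := ENNReal.toReal_nonneg
  have hmean : ∀ t ∈ Icc a T, |∫ ω, Y t ω ∂P - ∫ ω, Y' t ω ∂P| ≤ n := by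
    intro t ht
    rw [← integral_congr_ae (hZ₁Y.mono fun ω hω => hω t ht),
      ← integral_congr_ae (hZ₂Y.mono fun ω hω => hω t ht), ← integral_sub
      (hZ₁.integrable_comp hZ₁n (isStoppingTimeIn_const ht))
      (hZ₂.integrable_comp hZ₂n (isStoppingTimeIn_const ht))]
    exact abs_mean_le hZn ht
  obtain ⟨hIi, hIle⟩ := hZ.integrable_integral_abs haT hZn
  -- In expectation the first term gives `(γ₁ + β₁) n`, and the process and its mean each contribute
  -- `Cf (T - a) n` through the driver; hence the factor `2 * Cf`.
  set G : ℝ → Ω → ℝ := fun s ω => (γ₁ + β₁) * |Z s ω| + ((γ₂ + β₂) * n +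
    Cf * (∫ s in a..T, |Z s ω|) + Cf * (T - a) * n) with hG
  have hci : Integrable (fun ω => (γ₂ + β₂) * n + Cf * (∫ s in a..T, |Z s ω|)
      + Cf * (T - a) * n) P :=
    ((integrable_const _).add (hIi.const_mul _)).add (integrable_const _)
  have hZi : ∀ ρ, IsStoppingTimeIn F P a T ρ →
      Integrable (fun ω => (γ₁ + β₁) * |Z (ρ ω) ω|) P := fun ρ hρ =>
    (hZ.integrable_comp hZn hρ).abs.const_mul _
  have hGi : ∀ ρ, IsStoppingTimeIn F P a T ρ → Integrable (fun ω => G (ρ ω) ω) P := fun ρ hρ =>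
    (hZi ρ hρ).add hci
  have hle : normOne F P a T Z = ENNReal.ofReal n := (ENNReal.ofReal_toReal hZn.ne).symm
  have hpos : 0 ≤ γ₁ + γ₂ + β₁ + β₂ + 2 * Cf * (T - a) := by
    have : 0 ≤ T - a := sub_nonneg.2 haT
    positivity
  rw [hle, ← ENNReal.ofReal_mul hpos]
  refine hF.normOne_le_of_condExp_le haT (hX₁.sub hX₂) hGi (fun ρ hρ => ?_) fun t ht W hW hGW => ?_
  · have h1 : ∫ ω, G (ρ ω) ω ∂P = (γ₁ + β₁) * ∫ ω, |Z (ρ ω) ω| ∂P + ((γ₂ + β₂) * n +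
        Cf * (∫ ω, (∫ s in a..T, |Z s ω|) ∂P) + Cf * (T - a) * n) := by
      have e1 := integral_add (hZi ρ hρ) hci
      have e2 := integral_add ((integrable_const ((γ₂ + β₂) * n)).add (hIi.const_mul Cf))
        (integrable_const (μ := P) (Cf * (T - a) * n))
      have e3 := integral_add (integrable_const (μ := P) ((γ₂ + β₂) * n)) (hIi.const_mul Cf)
      simp only [Pi.add_apply] at e1 e2 e3
      simp only [hG]
      rw [e1, e2, e3, integral_const_mul, integral_const_mul Cf]
      simp
    rw [h1]
    have h2 := mul_le_mul_of_nonneg_left (integral_abs_le_normOne hZn hρ) (add_nonneg hγ₁ hβ₁)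
    have h3 := mul_le_mul_of_nonneg_left hIle hCf
    rw [← hn] at h2 h3
    linarith
  · obtain ⟨V, hV, hVX⟩ := hΦ t ht
    obtain ⟨V', hV', hVX'⟩ := hΦ' t ht
    have hdiff := fun {τ σ : Ω → ℝ} (hτ : IsStoppingTimeIn F P t T τ)
      (hσ : IsStoppingTimeIn F P t T σ) => hA.abs_payoff_sub_le hCf hγ₁ hγ₂ hβ₁ hβ₂ ha hc hc'
        hZ hZY hmean ht hτ hσ
    have hJ := fun {τ σ : Ω → ℝ} (hτ : IsStoppingTimeIn F P t T τ)
      (hσ : IsStoppingTimeIn F P t T σ) => hc.integrable_payoff haT hξm hA.ξ_integrable ht hτ hσ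
    have hJ' := fun {τ σ : Ω → ℝ} (hτ : IsStoppingTimeIn F P t T τ)
      (hσ : IsStoppingTimeIn F P t T σ) => hc'.integrable_payoff haT hξm hA.ξ_integrable ht hτ hσ
    have hGt := fun {τ σ : Ω → ℝ} (hτ : IsStoppingTimeIn F P t T τ)
      (hσ : IsStoppingTimeIn F P t T σ) => hGi _ ((hτ.min hσ).mono ht.1 le_rfl)
    have hkey : ∀ {J J' : Ω → ℝ} {τ σ : Ω → ℝ}, Integrable J P → Integrable J' P →
        IsStoppingTimeIn F P t T τ → IsStoppingTimeIn F P t T σ →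
        (∀ᵐ ω ∂P, J ω ≤ J' ω + G (min (τ ω) (σ ω)) ω) →
        P[J | F t] ≤ᵐ[P] P[J' | F t] + W := by
      intro J J' τ σ hJ hJ' hτ hσ hle
      filter_upwards [condExp_mono (m := F t) hJ (hJ'.add (hGt hτ hσ)) hle,
        condExp_add hJ' (hGt hτ hσ) (F t), hGW _ (hτ.min hσ)] with ω h1 h2 h3
      rw [h2, Pi.add_apply] at h1
      rw [Pi.add_apply]
      linarith
    -- The comparison is applied in both directions; together they bound `|X t - X' t|` by any `W`
    -- dominating all `E[G_ρ | F t]`.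
    have h1 := essSup_le_of_payoff_le hV hVX hV' hVX' hW.aemeasurable fun τ σ hτ hσ =>
      hkey (hJ hτ hσ) (hJ' hτ hσ) hτ hσ (by
        filter_upwards [hdiff hτ hσ] with ω hω
        linarith [(abs_le.1 hω).2])
    have h2 := essSup_le_of_payoff_le hV' hVX' hV hVX hW.aemeasurable fun τ σ hτ hσ =>
      hkey (hJ' hτ hσ) (hJ hτ hσ) hτ hσ (by
        filter_upwards [hdiff hτ hσ] with ω hω
        linarith [(abs_le.1 hω).1])
    filter_upwards [h1, h2, hX₁X, hX₂X] with ω h3 h4 h5 h6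
    rw [Pi.add_apply] at h3 h4
    rw [h5 t ht, h6 t ht]
    exact abs_le.2 ⟨by linarith, by linarith⟩

end Contraction

end MFDRBSDE

/-! ### Picard iteration in class (D). -/

namespace MFDRBSDE

open Filter Topology

section FixedPoint

variable {Ω : Type*} [m : MeasurableSpace Ω] {F : Filtration ℝ m} {P : Measure Ω}

/-- The continuous version of a closed martingale is of class (D). -/
theorem NullComplete.exists_martingale_classD [IsProbabilityMeasure P] (hF : NullComplete F P)
    {a b : ℝ} (hab : a ≤ b)
    (hCM : ∀ ζ : Ω → ℝ, Measurable[F b] ζ → Integrable ζ P → HasContinuousVersion F P a b ζ)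
    {ξ : Ω → ℝ} (hξ : Measurable[F b] ξ) (hξi : Integrable ξ P) :
    ∃ M, RegularOn F a b M ∧ ClassD F P a b M ∧ M b =ᵐ[P] ξ := by
  have hbm : b ∈ Icc a b := ⟨hab, le_rfl⟩
  have hpos : ∀ n : ℕ, (0 : ℝ) < 1 / ((n : ℝ) + 1) := fun n => by positivity
  have hξD : ClassD F P a b fun _ => ξ := classD_of_integrable_bound hξi.abs
    (Eventually.of_forall fun ω t _ => le_rfl)
  choose R hR hRn using fun n : ℕ => hξD _ (ENNReal.ofReal_pos.2 (hpos n))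
  set ζ : ℕ → Ω → ℝ := fun n ω => trunc (R n) (ξ ω)
  have hζm : ∀ n, Measurable[F b] (ζ n) := fun n => (continuous_trunc (R n)).measurable.comp hξ
  have hζb : ∀ n, ∀ᵐ ω ∂P, |ζ n ω| ≤ R n := fun n =>
    Eventually.of_forall fun ω => abs_trunc_le (hR n) _
  have hζi : ∀ n, Integrable (ζ n) P := fun n =>
    Integrable.of_bound ((hζm n).mono (F.le b) le_rfl).aestronglyMeasurable (R n) (hζb n)
  choose N hNr hN using fun n => hCM (ζ n) (hζm n) (hζi n)
  obtain ⟨M, hMr, hM⟩ := hCM ξ hξ hξi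
  -- The martingales closed by truncations of `ξ` are bounded and converge to `M` in `‖·‖₁` by
  -- Doob's inequality; class (D) is closed under such limits.
  refine ⟨M, hMr, ClassD.of_normOne_sub (X := N) (fun n => ?_) hNr ?_, ?_⟩
  · have hbd : ∀ t ∈ Icc a b, ∀ᵐ ω ∂P, |N n t ω| ≤ R n := fun t ht => by
      filter_upwards [hN n t ht, ae_bdd_abs_condExp_of_ae_bdd_abs (m := F t) (hζb n)]
        with ω h1 h2
      rw [h1]
      exact h2
    exact classD_of_integrable_bound (integrable_const (R n)) (ae_forall_le_of_forall_ae_le hab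
      (fun ω => ((hNr n).continuous ω).abs) (fun _ => continuous_const) hbd)
  · have hlim : Tendsto (fun n : ℕ => ENNReal.ofReal (1 / ((n : ℝ) + 1))) atTop (𝓝 0) := by
      have := ENNReal.tendsto_ofReal (tendsto_one_div_add_atTop_nhds_zero_nat (𝕜 := ℝ))
      simpa using this
    refine tendsto_of_tendsto_of_tendsto_of_le_of_le tendsto_const_nhds hlim (fun n => zero_le)
      fun n => (hF.normOne_sub_le_of_condExp hab (hNr n) hMr (hζi n) hξi (hN n) hM).trans
        (ENNReal.ofReal_le_ofReal ?_)
    have hi : Integrable (fun ω => max (|ξ ω| - R n) 0) P :=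
      (hξi.abs.sub (integrable_const (R n))).pos_part
    refine (integral_mono ((hζi n).sub hξi).abs hi fun ω => ?_).trans
      (integral_le_of_lintegral_enorm_le (hpos n).le
        ((lintegral_le_normOne _ (isStoppingTimeIn_const hbm)).trans (hRn n)))
    rw [Pi.sub_apply, abs_sub_comm]
    exact abs_sub_trunc_le (hR n) _
  · have h1 := hM b hbm
    rwa [condExp_of_stronglyMeasurable (F.le b) hξ.stronglyMeasurable hξi] at h1

/-- Banach's fixed point theorem in the space of processes of class (D) with a given terminal
value. -/
theorem NullComplete.exists_fixedPoint [IsProbabilityMeasure P] (hF : NullComplete F P) {a b : ℝ}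
    (hab : a < b) {ξ : Ω → ℝ} {Φ : (ℝ → Ω → ℝ) → (ℝ → Ω → ℝ) → Prop}
    (hex : ∃ Y, RegularOn F a b Y ∧ ClassD F P a b Y ∧ Y b =ᵐ[P] ξ)
    (hΦ : ∀ Y, RegularOn F a b Y → ClassD F P a b Y → Y b =ᵐ[P] ξ →
      ∃ X, RegularOn F a b X ∧ ClassD F P a b X ∧ X b =ᵐ[P] ξ ∧ Φ Y X)
    {c : ℝ} (hc0 : 0 ≤ c) (hc : c < 1)
    (hcontr : ∀ Y Y' X X', RegularOn F a b Y → RegularOn F a b Y' → RegularOn F a b X →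
      RegularOn F a b X' → ClassD F P a b Y → ClassD F P a b Y' → ClassD F P a b X →
      ClassD F P a b X' → Φ Y X → Φ Y' X' →
      normOne F P a b (fun t ω => X t ω - X' t ω) ≤
        ENNReal.ofReal c * normOne F P a b (fun t ω => Y t ω - Y' t ω)) :
    ∃ Y X, RegularOn F a b Y ∧ ClassD F P a b Y ∧ Y b =ᵐ[P] ξ ∧ Φ Y X ∧
      ∀ᵐ ω ∂P, ∀ t ∈ Icc a b, X t ω = Y t ω := by
  obtain ⟨Y₀, hY₀⟩ := hex
  have hbm : b ∈ Icc a b := ⟨hab.le, le_rfl⟩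
  choose! φ hφ using hΦ
  set S : ℕ → ℝ → Ω → ℝ := fun n => φ^[n] Y₀ with hS
  have hSsucc : ∀ n, S (n + 1) = φ (S n) := fun n => Function.iterate_succ_apply' φ n Y₀
  have hSn : ∀ n, RegularOn F a b (S n) ∧ ClassD F P a b (S n) ∧ S n b =ᵐ[P] ξ := by
    intro n
    induction n with
    | zero => exact hY₀
    | succ n ih =>
      obtain ⟨h1, h2, h3, -⟩ := hφ (S n) ih.1 ih.2.1 ih.2.2
      rw [hSsucc]
      exact ⟨h1, h2, h3⟩
  have hSΦ : ∀ n, Φ (S n) (S (n + 1)) := fun n => by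
    rw [hSsucc]
    exact (hφ (S n) (hSn n).1 (hSn n).2.1 (hSn n).2.2).2.2.2
  set D : ℕ → ℕ → ℝ≥0∞ := fun i j => normOne F P a b (fun t ω => S i t ω - S j t ω) with hD
  have hstep : ∀ i j, D (i + 1) (j + 1) ≤ ENNReal.ofReal c * D i j := fun i j =>
    hcontr _ _ _ _ (hSn i).1 (hSn j).1 (hSn (i + 1)).1 (hSn (j + 1)).1 (hSn i).2.1 (hSn j).2.1
      (hSn (i + 1)).2.1 (hSn (j + 1)).2.1 (hSΦ i) (hSΦ j)
  have htri : ∀ i j k, D i k ≤ D i j + D j k := fun i j k => normOne_sub_le (hSn i).1 (hSn j).1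
  have hsymm : ∀ i j, D i j = D j i := fun i j => normOne_sub_comm _ _
  have hfin : D 1 0 < ∞ := ClassD.normOne_lt_top ((hSn 1).2.1.of_le_add (hSn 0).2.1 (hSn 1).1
    (Eventually.of_forall fun ω t _ => abs_sub _ _))
  set n₀ := (D 1 0).toReal with hn₀
  -- The fixed point of `x ↦ c x + n₀`, that is, the sum of the geometric series: it bounds the
  -- distance of every iterate from the starting point.
  set C : ℝ := n₀ / (1 - c) with hC
  have hn₀0 : 0 ≤ n₀ := ENNReal.toReal_nonneg
  have hC0 : 0 ≤ C := div_nonneg hn₀0 (sub_nonneg.2 hc.le)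
  have hCeq : c * C + n₀ = C := by
    have : 1 - c ≠ 0 := (sub_pos.2 hc).ne'
    rw [hC]; field_simp; ring
  have hD0 : ∀ j, D j 0 ≤ ENNReal.ofReal C := by
    intro j
    induction j with
    | zero => simp only [hD, sub_self]; exact normOne_le fun τ _ => by simp
    | succ j ih =>
      refine (htri (j + 1) 1 0).trans ?_
      rw [← hCeq, ENNReal.ofReal_add (mul_nonneg hc0 hC0) hn₀0, hn₀, ENNReal.ofReal_toReal hfin.ne,
        ENNReal.ofReal_mul hc0]
      exact add_le_add ((hstep j 0).trans (mul_le_mul_right ih _)) le_rfl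
  have hDn : ∀ n j, D (n + j) n ≤ ENNReal.ofReal (c ^ n * C) := by
    intro n
    induction n with
    | zero => intro j; rw [zero_add, pow_zero, one_mul]; exact hD0 j
    | succ n ih =>
      intro j
      rw [show n + 1 + j = n + j + 1 by ring, pow_succ', mul_assoc, ENNReal.ofReal_mul hc0]
      exact (hstep _ _).trans (mul_le_mul_right (ih j) _)
  have hlim : Tendsto (fun n : ℕ => ENNReal.ofReal (c ^ n * C)) atTop (𝓝 0) := by
    have := ENNReal.tendsto_ofReal ((tendsto_pow_atTop_nhds_zero_of_lt_one hc0 hc).mul_const C)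
    simpa using this
  obtain ⟨Y, hYr, hY⟩ := hF.exists_tendsto_normOne hab (fun n => (hSn n).1) fun ε hε => by
    obtain ⟨N, hN⟩ := eventually_atTop.1
      (ENNReal.tendsto_nhds_zero.1 hlim (ε / 2) (ENNReal.half_pos hε.ne'))
    have hN' : ∀ n ≥ N, D n N ≤ ε / 2 := fun n hn => by
      obtain ⟨j, rfl⟩ := Nat.exists_eq_add_of_le hn
      exact (hDn N j).trans (hN N le_rfl)
    refine ⟨N, fun n hn k hk => (htri n N k).trans ?_⟩
    rw [← ENNReal.add_halves ε, hsymm N k]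
    exact add_le_add (hN' n hn) (hN' k hk)
  have hYD : ClassD F P a b Y := ClassD.of_normOne_sub (fun n => (hSn n).2.1)
    (fun n => (hSn n).1) hY
  have hYξ : Y b =ᵐ[P] ξ := by
    -- All iterates share the terminal value almost surely, and evaluation at `b` is continuous for
    -- the norm.
    have h1 : ∫⁻ ω, ‖S 0 b ω - Y b ω‖ₑ ∂P = 0 := by
      refine le_antisymm (ge_of_tendsto' hY fun n => ?_) zero_le
      refine (lintegral_congr_ae ?_).trans_le
        (lintegral_le_normOne (fun t ω => S n t ω - Y t ω) (isStoppingTimeIn_const hbm))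
      filter_upwards [(hSn 0).2.2, (hSn n).2.2] with ω h2 h3
      rw [h2, h3]
    filter_upwards [(lintegral_eq_zero_iff
      (((hSn 0).1.measurable b).sub (hYr.measurable b)).enorm).1 h1, (hSn 0).2.2] with ω h2 h3
    have h4 : S 0 b ω - Y b ω = 0 := by simpa using h2
    linarith
  obtain ⟨hX1, hX2, -, hX4⟩ := hφ Y hYr hYD hYξ
  refine ⟨Y, φ Y, hYr, hYD, hYξ, hX4, ?_⟩
  have h1 : normOne F P a b (fun t ω => φ Y t ω - Y t ω) = 0 := by
    -- The limit is compared with its image through `S (n + 1)`, an image of `S n`; both terms on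
    -- the right tend to zero.
    have h2 : ∀ n, normOne F P a b (fun t ω => φ Y t ω - Y t ω) ≤
        ENNReal.ofReal c * normOne F P a b (fun t ω => S n t ω - Y t ω)
          + normOne F P a b (fun t ω => S (n + 1) t ω - Y t ω) := fun n => by
      refine (normOne_sub_le hX1 (hSn (n + 1)).1).trans (add_le_add ?_ le_rfl)
      rw [normOne_sub_comm (S n)]
      exact hcontr _ _ _ _ hYr (hSn n).1 hX1 (hSn (n + 1)).1 hYD (hSn n).2.1 hX2 (hSn (n + 1)).2.1
        hX4 (hSΦ n)
    have h3 := (ENNReal.Tendsto.const_mul hY (Or.inr (ENNReal.ofReal_ne_top (r := c)))).add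
      (hY.comp (tendsto_add_atTop_nat 1))
    rw [mul_zero, add_zero] at h3
    exact le_antisymm (ge_of_tendsto' h3 h2) zero_le
  filter_upwards [(hX1.sub hYr).eq_zero_of_normOne hab h1] with ω hω t ht
  linarith [hω t ht]

variable {T a : ℝ} {f h g : ℝ → Ω → ℝ → ℝ → ℝ} {ξ : Ω → ℝ}

theorem IsPhi.congr_right {Y X X' : ℝ → Ω → ℝ} (hX : IsPhi F P T f h g ξ a Y X)
    (hXX' : ∀ t ∈ Icc a T, X t =ᵐ[P] X' t) : IsPhi F P T f h g ξ a Y X' := fun t ht => by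
  obtain ⟨V, hV, hVX⟩ := hX t ht
  exact ⟨V, hV, hVX.1.congr (hXX' t ht), fun τ => (hVX.2.1 τ).trans (hXX' t ht).le,
    fun W hW hVW => (hXX' t ht).symm.le.trans (hVX.2.2 W hW hVW)⟩

end FixedPoint

end MFDRBSDE

/-! ### The main theorem. -/

open MFDRBSDE

theorem mainTheorem5 (Cf γ₁ γ₂ β₁ β₂ : ℝ) (hCf : 0 < Cf) (hγ₁ : 0 < γ₁) (hγ₂ : 0 < γ₂)
    (hβ₁ : 0 < β₁) (hβ₂ : 0 < β₂) (hsmall : γ₁ + γ₂ + β₁ + β₂ < 1) :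
    ∃ δ : ℝ, 0 < δ ∧ ∃ κ : ℝ≥0, κ < 1 ∧
      ∀ (Ω : Type*) [MeasurableSpace Ω] (P : Measure Ω) [IsProbabilityMeasure P] [P.IsComplete]
        (T : ℝ) (_ : 0 < T) (d : ℕ) (B : Icc (0 : ℝ) T → Ω → (Fin d → ℝ))
        (hB : MFDRBSDE.IsBrownianMotion P B)
        (f h g : ℝ → Ω → ℝ → ℝ → ℝ) (ξ : Ω → ℝ)
        (F : Filtration ℝ ‹MeasurableSpace Ω›)
        (_ : F = MFDRBSDE.completedFiltration P B hB.measurable)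
        (_ : MFDRBSDE.AssumptionA1 F P T f h g ξ Cf γ₁ γ₂ β₁ β₂)
        (a : ℝ) (_ : a = max (T - δ) 0),
        -- `Φ` maps the elements of class (D) with terminal value `ξ` into themselves
        (∀ Y, MFDRBSDE.MemClassD F P a T Y → Y T =ᵐ[P] ξ →
          ∃ X, MFDRBSDE.MemClassD F P a T X ∧ X T =ᵐ[P] ξ ∧
            MFDRBSDE.IsPhi F P T f h g ξ a Y X) ∧
        -- contraction estimate
        (∀ Y Y' X X', MFDRBSDE.MemD F P a T Y → MFDRBSDE.MemD F P a T Y' →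
          MFDRBSDE.MemD F P a T X → MFDRBSDE.MemD F P a T X' →
          MFDRBSDE.IsPhi F P T f h g ξ a Y X → MFDRBSDE.IsPhi F P T f h g ξ a Y' X' →
          MFDRBSDE.normOne F P a T (fun t ω => X t ω - X' t ω) ≤
            κ * MFDRBSDE.normOne F P a T (fun t ω => Y t ω - Y' t ω)) ∧
        -- existence and uniqueness of the fixed point
        (∃ Y, MFDRBSDE.MemClassD F P a T Y ∧ MFDRBSDE.IsPhi F P T f h g ξ a Y Y ∧
          ∀ Y', MFDRBSDE.MemD F P a T Y' → MFDRBSDE.IsPhi F P T f h g ξ a Y' Y' →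
            ∀ᵐ ω ∂P, ∀ t ∈ Icc a T, Y' t ω = Y t ω) := by
  set s := γ₁ + γ₂ + β₁ + β₂ with hs
  have hs0 : 0 ≤ s := by positivity
  -- With `T - a ≤ δ` the driver contributes at most `2 * Cf * δ = (1 - s) / 2`, half of the
  -- available margin, so the total factor is at most `s + (1 - s) / 2 = (1 + s) / 2 < 1`.
  refine ⟨(1 - s) / (4 * Cf), div_pos (sub_pos.2 hsmall) (by positivity),
    Real.toNNReal ((1 + s) / 2), by rw [Real.toNNReal_lt_one]; linarith, ?_⟩
  intro Ω _ P _ _ T hT d B hB f h g ξ F hFB hA a haδ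
  have hδ : 0 < (1 - s) / (4 * Cf) := div_pos (sub_pos.2 hsmall) (by positivity)
  have ha : 0 ≤ a := haδ ▸ le_max_right _ _
  have haT : a < T := haδ ▸ max_lt (sub_lt_self _ hδ) hT
  have hκ : γ₁ + γ₂ + β₁ + β₂ + 2 * Cf * (T - a) ≤ (1 + s) / 2 := by
    have h1 : T - a ≤ (1 - s) / (4 * Cf) := by
      have := le_max_left (T - (1 - s) / (4 * Cf)) 0
      rw [← haδ] at this
      linarith
    have h2 : 2 * Cf * ((1 - s) / (4 * Cf)) = (1 - s) / 2 := by field_simp; ring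
    have h3 := mul_le_mul_of_nonneg_left h1 (by positivity : 0 ≤ 2 * Cf)
    linarith
  have hF : NullComplete F P := hFB ▸ nullComplete_completedFiltration hB.measurable
  have hCM : ∀ ζ : Ω → ℝ, Measurable[F T] ζ → Integrable ζ P →
      HasContinuousVersion F P a T ζ := by
    subst hFB
    exact fun ζ hζ hζi => (hB.hasContinuousVersion hT hζ hζi).mono (Icc_subset_Icc_left ha)
  have hγ : γ₁ ≤ 1 := by linarith
  have hβ : β₁ ≤ 1 := by linarith
  have hcontr : ∀ Y Y' X X', MemD F P a T Y → MemD F P a T Y' → MemD F P a T X →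
      MemD F P a T X' → IsPhi F P T f h g ξ a Y X → IsPhi F P T f h g ξ a Y' X' →
      normOne F P a T (fun t ω => X t ω - X' t ω) ≤
        ENNReal.ofReal ((1 + s) / 2) * normOne F P a T (fun t ω => Y t ω - Y' t ω) :=
    fun Y Y' X X' hY hY' hX hX' hΦ hΦ' => (hA.normOne_phi_sub_le hF hCf.le hγ₁.le hγ₂.le hβ₁.le
      hβ₂.le hγ hβ ha haT.le hY hY' hX hX' hΦ hΦ').trans
        (mul_le_mul_left (ENNReal.ofReal_le_ofReal hκ) _)
  have hex : ∀ Y, MemClassD F P a T Y → Y T =ᵐ[P] ξ →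
      ∃ X, RegularOn F a T X ∧ ClassD F P a T X ∧ X T =ᵐ[P] ξ ∧ IsPhi F P T f h g ξ a Y X :=
    fun Y hY hYT => hA.exists_phi hF hCf.le hγ₁.le hγ₂.le hβ₁.le hβ₂.le hγ hβ ha haT hCM hY hYT
  refine ⟨fun Y hY hYT => ?_, hcontr, ?_⟩
  · obtain ⟨X, h1, h2, h3, h4⟩ := hex Y hY hYT
    exact ⟨X, h2.memClassD h1, h3, h4⟩
  · obtain ⟨Y, X, hYr, hYD, -, hΦ, hXY⟩ := hF.exists_fixedPoint haT
      (hF.exists_martingale_classD haT.le hCM hA.ξ_measurable hA.ξ_integrable)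
      (fun Y hYr hYD hYT => hex Y (hYD.memClassD hYr) hYT)
      (by positivity : 0 ≤ (1 + s) / 2) (by linarith)
      (fun Y Y' X X' h1 h2 h3 h4 h5 h6 h7 h8 => hcontr Y Y' X X' (h5.memClassD h1).toMemD
        (h6.memClassD h2).toMemD (h7.memClassD h3).toMemD (h8.memClassD h4).toMemD)
    have hY := hYD.memClassD hYr
    have hΦY : IsPhi F P T f h g ξ a Y Y := hΦ.congr_right fun t ht =>
      hXY.mono fun ω hω => hω t ht
    refine ⟨Y, hY, hΦY, fun Y' hY' hΦY' => ?_⟩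
    obtain ⟨Z, hZ, -, hZY⟩ := hY'.exists_regularOn hF haT.le
    have hle := hcontr Y' Y Y' Y hY' hY.toMemD hY' hY.toMemD hΦY' hΦY
    have hfin := hY'.normOne_sub_lt_top hF haT.le hY.toMemD
    -- A finite quantity bounded by a factor less than one times itself must vanish. Only membership
    -- in `D` is used for `Y'`, so uniqueness holds beyond class (D).
    have h0 : normOne F P a T (fun t ω => Y' t ω - Y t ω) = 0 := by
      by_contra hne
      refine absurd hle (not_le.2 ?_)
      have h1 : ENNReal.ofReal ((1 + s) / 2) < 1 := ENNReal.ofReal_lt_one.2 (by linarith)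
      calc _ < 1 * normOne F P a T (fun t ω => Y' t ω - Y t ω) :=
            ENNReal.mul_lt_mul_left hne hfin.ne h1
        _ = _ := one_mul _
    have h1 : normOne F P a T (fun t ω => Z t ω - Y t ω) = 0 := by
      rw [← h0]
      refine normOne_congr_ae ?_
      filter_upwards [hZY] with ω hω t ht
      rw [hω t ht]
    filter_upwards [(hZ.sub hYr).eq_zero_of_normOne haT h1, hZY] with ω h2 h3 t ht
    rw [← h3 t ht]
    linarith [h2 t ht]
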